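/- **Notation.** Let $z=x+iy$, $\partial=\partial_z$, $\bar\partial=\partial_{\bar z}$. For smooth $p,q:\mathbb C\to\mathbb C$ consider the Davey–Stewartson II (DSII) linear problem $\psi_z=p\varphi$, $\varphi_{\bar z}=q\psi$, i.e. $L(\psi,\varphi)^T=0$ with $L=\mathrm{diag}(\partial,\bar\partial)-\begin{pmatrix}0&p\\q&0\end{pmatrix}$. A function is called decaying with exponent $s$ if it is smooth and it and all its derivatives in $x,y$ are $O((1+|z|)^{-s})$; a family depending on $t$ in an open set $J\subset\mathbb R$ is called decaying with exponent $s$ if it is smooth on $J\times\mathbb C$ and it, all its $z$-derivatives and its $t$-derivative satisfy such bounds locally uniformly in $t\in J$. Throughout, $s>1$. **The hierarchy.** Let $n\ge1$ and $\alpha,\gamma\in\mathbb C$. The $n$-th DSII equation for $p,q$ with leading constants $\alpha,\gamma$ is the compatibility condition of the linear problem with $\psi_{t_n}=A_n\psi+B_n\varphi$, $\varphi_{t_n}=C_n\psi+D_n\varphi$, that is, $L_{t_n}+LM_n=\Lambda L$ for some matrix differential operator $\Lambda$, where $M_n=\begin{pmatrix}A_n&B_n\\C_n&D_n\end{pmatrix}$;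 $A_n,C_n$ are differential operators in $\bar\partial$ and $B_n,D_n$ in $\partial$, of order at most $n$, with smooth coefficients, $A_n=\alpha\bar\partial^n+\dots$, $D_n=\gamma\partial^n+\dots$, and the lower coefficients of $A_n$ and $D_n$ tend to $0$ at infinity with all their derivatives. **Proposition 4.** For every $n\ge1$: 1. For all $\alpha,\gamma$ and all decaying $p,q$ there is exactly one pair $(p_{t_n},q_{t_n})$ for which such operators exist. For the velocities and operators of the $n$-th equation, on all smooth local solutions $(\psi,\varphi)$ of the linear problem, $\partial(A_n\psi+B_n\varphi)=p_{t_n}\varphi+p(C_n\psi+D_n\varphi)$ and $\bar\partial(C_n\psi+D_n\varphi)=q_{t_n}\psi+q(A_n\psi+B_n\varphi)$. 2. If $p,q$ is a decaying solution of the $n$-th equation on $J$, then $pq$ is integrable and $\frac{d}{dt_n}\int_{\mathbb C} pq\,dx\,dy=0$. 3. (Reductions.) Let $p$ be decaying, $\varepsilon=\pm1$, $\gamma=\bar\alpha$ (for instance $\alpha=1$ for $n$ odd, $\alpha=i$ for $n$ even). If $q=\varepsilon\bar p$, then $q_{t_n}=\varepsilon\overline{p_{t_n}}$, and the same velocity of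 $p$ gives the $n$-th equation for the potentials $(\bar p,\varepsilon p)$ with leading constants $(-1)^{n+1}\alpha,(-1)^{n+1}\bar\alpha$. If $p,q$ are decaying and real and $\gamma=(-1)^{n+1}\bar\alpha$, then $p_{t_n},q_{t_n}$ are real. 4. (Surfaces in $\mathbb R^4$, $\varepsilon=-1$, and in $\mathbb R^{2,2}$, $\varepsilon=1$.) Let $p$ be a decaying family on $J$ such that $(p,\varepsilon\bar p)$ solves the $n$-th equation with leading constants $\alpha,\bar\alpha$, and $(\bar p,\varepsilon p)$ the one with leading constants $(-1)^{n+1}\alpha,(-1)^{n+1}\bar\alpha$. Let $(\psi_1,\varphi_1)$ and $(\psi_2,\varphi_2)$ be smooth on $J\times\mathbb C$, solve the linear problems with potentials $(p,\varepsilon\bar p)$ and $(\bar p,\varepsilon p)$ respectively for every $t\in J$, and evolve by the corresponding operators. Put $l=(|\psi_1|^2-\varepsilon|\varphi_1|^2)(|\psi_2|^2-\varepsilon|\varphi_2|^2)$ and assume $l\neq0$ everywhere. Then there are surfaces $\vec X(t,z)$, smooth on $J\times\mathbb C$ and given for every $t\in J$ by the generalized Weierstrass formulae (integrals along any $C^1$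 contour): for $\mathbb R^4$ $$X^1+iX^2=\int(-\varphi_1\varphi_2\,dz'+\psi_1\psi_2\,d\bar z'),\qquad X^3+iX^4=\int(\bar\psi_2\varphi_1\,dz'+\psi_1\bar\varphi_2\,d\bar z'),$$ for $\mathbb R^{2,2}$ (metric $\mathrm{diag}(1,1,-1,-1)$) $$X^1+iX^2=\int(\varphi_1\varphi_2\,dz'+\psi_1\psi_2\,d\bar z'),\qquad X^3+iX^4=i\int(\bar\psi_1\varphi_2\,dz'+\psi_2\bar\varphi_1\,d\bar z'),$$ together with the complex conjugate formulae. Each such $\vec X(t,\cdot)$ is a smooth conformal immersion with metric $l\,dz\,d\bar z$. With the mean curvature vector $\vec H=\vec X_{z\bar z}/g_{z\bar z}$ and the area element $dS=\sqrt{|\det g|}\,dx\,dy$, the function $\vec H^2$ is $dS$-integrable, and the Willmore functional $W=\int\vec H^2\,dS$ equals $4\int|p|^2dx\,dy$ for $\mathbb R^4$ and $-4\,\mathrm{sgn}(l)\int|p|^2dx\,dy$ for $\mathbb R^{2,2}$ (the sign of $l$ being taken at $z=0$), and $W_{t_n}=0$ on $J$. 5. (Surfaces in $\mathbb R^{3,1}$,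 metric $\mathrm{diag}(1,1,1,-1)$.) Let $p,q$ be real decaying families on $J$ solving the $n$-th equation (with any leading constants), and let $(\psi_1,\varphi_1),(\psi_2,\varphi_2)$ be smooth on $J\times\mathbb C$, both solve the linear problem with potentials $(p,q)$ for every $t\in J$ and evolve by the operators of this flow; assume $\psi_1\varphi_2-\psi_2\varphi_1\ne0$ everywhere. Then there are surfaces $\vec X(t,z)$, smooth on $J\times\mathbb C$ and given for every $t\in J$ by $$X^1+iX^2=\int(\bar\psi_2\varphi_1dz'+\psi_1\bar\varphi_2d\bar z'),\quad X^3+X^4=\int(\bar\psi_1\varphi_1dz'+\psi_1\bar\varphi_1d\bar z'),\quad X^3-X^4=-\int(\bar\psi_2\varphi_2dz'+\psi_2\bar\varphi_2d\bar z')$$ and the complex conjugate of the first formula. Each such $\vec X(t,\cdot)$ is a smooth conformal immersion with metric $|\psi_1\varphi_2-\psi_2\varphi_1|^2dz\,d\bar z$, $\vec H^2$ is $dS$-integrable, $W=-4\int pq\,dx\,dy$, and $W_{t_n}=0$ on $J$. -/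

import Mathlib

open scoped ComplexConjugate ContDiff Topology

noncomputable section

namespace DSII

/-! ### Wirtinger derivatives and differential operators -/

/-- `∂f/∂z = (f_x - i f_y) / 2`. -/
def dz (f : ℂ → ℂ) : ℂ → ℂ := fun z =>
  (1 / 2 : ℂ) * (fderiv ℝ f z 1 - Complex.I * fderiv ℝ f z Complex.I)

/-- `∂f/∂z̄ = (f_x + i f_y) / 2`. -/
def dzbar (f : ℂ → ℂ) : ℂ → ℂ := fun z =>
  (1 / 2 : ℂ) * (fderiv ℝ f z 1 + Complex.I * fderiv ℝ f z Complex.I)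

/-- The derivative with respect to the deformation parameter. -/
def dt (f : ℝ → ℂ → ℂ) (t : ℝ) : ℂ → ℂ := fun z => deriv (fun τ => f τ z) t

/-- The differential operator `∑_{k ≤ n} c_k ∂_z^k`. -/
def opZ (n : ℕ) (c : ℕ → ℂ → ℂ) (f : ℂ → ℂ) : ℂ → ℂ := fun z =>
  ∑ k ∈ Finset.range (n + 1), c k z * (dz^[k] f) z

/-- The differential operator `∑_{k ≤ n} c_k ∂_z̄^k`. -/
def opZbar (n : ℕ) (c : ℕ → ℂ → ℂ) (f : ℂ → ℂ) : ℂ → ℂ := fun z =>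
  ∑ k ∈ Finset.range (n + 1), c k z * (dzbar^[k] f) z

/-! ### The linear problem and its deformation operators -/

/-- `(ψ, φ)` solves `ψ_z = p φ`, `φ_z̄ = q ψ` on `U`. -/
def IsDiracSolution (U : Set ℂ) (p q ψ φ : ℂ → ℂ) : Prop :=
  ∀ z ∈ U, dz ψ z = p z * φ z ∧ dzbar φ z = q z * ψ z

/-- Coefficients of the four operators `A, B, C, D` of a deformation
`ψ_t = A ψ + B φ`, `φ_t = C ψ + D φ`.  On solutions of the linear problem `∂_z ψ` and
`∂_z̄ φ` are eliminated, so `A, C` are operators in `∂_z̄` and `B, D` are operators in `∂_z`. -/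
structure LaxCoeffs where
  /-- coefficients of `A` -/
  a : ℕ → ℂ → ℂ
  /-- coefficients of `B` -/
  b : ℕ → ℂ → ℂ
  /-- coefficients of `C` -/
  c : ℕ → ℂ → ℂ
  /-- coefficients of `D` -/
  d : ℕ → ℂ → ℂ

/-- `A ψ + B φ`. -/
def LaxCoeffs.fst (M : LaxCoeffs) (n : ℕ) (ψ φ : ℂ → ℂ) : ℂ → ℂ := fun z =>
  opZbar n M.a ψ z + opZ n M.b φ z

/-- `C ψ + D φ`. -/
def LaxCoeffs.snd (M : LaxCoeffs) (n : ℕ) (ψ φ : ℂ → ℂ) : ℂ → ℂ := fun z =>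
  opZbar n M.c ψ z + opZ n M.d φ z

/-- The operators with coefficients `M` are the `n`-th DSII operators at the potentials `(p, q)`,
and `(P, Q)` are the corresponding velocities `(p_t, q_t)`.

* `A = α ∂_z̄^n + …` and `D = γ ∂_z^n + …` with smooth coefficients; the lower coefficients of
  `A` and `D`, which are nonlocal in `p, q`, are normalized to vanish at infinity (with their
  derivatives): this is the meaning of `∂_z⁻¹` and `∂_z̄⁻¹`.
* With `L = diag(∂_z, ∂_z̄) - (0, p; q, 0)` and `M = (A, B; C, D)` the compatibility condition is
  the identity `L_t + L M = Λ L` of matrix differential operators, for some `Λ`. (Since `A, C`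
  contain only `∂_z̄` and `B, D` only `∂_z`, division by `L` gives first row of `Λ` in `∂_z̄`,
  second row in `∂_z`, of order at most `n`.) -/
structure IsDSIIOperators (n : ℕ) (α γ : ℂ) (p q P Q : ℂ → ℂ) (M : LaxCoeffs) : Prop where
  smooth : ∀ k ≤ n, ContDiff ℝ ∞ (M.a k) ∧ ContDiff ℝ ∞ (M.b k) ∧
    ContDiff ℝ ∞ (M.c k) ∧ ContDiff ℝ ∞ (M.d k)
  lead_a : ∀ z, M.a n z = α
  lead_d : ∀ z, M.d n z = γ
  lower_a : ∀ k < n, ∀ m : ℕ,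
    Filter.Tendsto (iteratedFDeriv ℝ m (M.a k)) (Filter.cocompact ℂ) (𝓝 0)
  lower_d : ∀ k < n, ∀ m : ℕ,
    Filter.Tendsto (iteratedFDeriv ℝ m (M.d k)) (Filter.cocompact ℂ) (𝓝 0)
  compat : ∃ l₁₁ l₁₂ l₂₁ l₂₂ : ℕ → ℂ → ℂ, ∀ ψ φ : ℂ → ℂ,
    ContDiff ℝ ∞ ψ → ContDiff ℝ ∞ φ → ∀ z : ℂ,
      dz (M.fst n ψ φ) z - p z * M.snd n ψ φ z - P z * φ z =
          opZbar n l₁₁ (fun w => dz ψ w - p w * φ w) z +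
            opZbar n l₁₂ (fun w => dzbar φ w - q w * ψ w) z ∧
      dzbar (M.snd n ψ φ) z - q z * M.fst n ψ φ z - Q z * ψ z =
          opZ n l₂₁ (fun w => dz ψ w - p w * φ w) z +
            opZ n l₂₂ (fun w => dzbar φ w - q w * ψ w) z

/-- `(P, Q)` is the value at `(p, q)` of the `n`-th DSII vector field with leading constants
`α, γ`. -/
def IsDSIIVelocity (n : ℕ) (α γ : ℂ) (p q P Q : ℂ → ℂ) : Prop :=
  ∃ M : LaxCoeffs, IsDSIIOperators n α γ p q P Q M

/-- `(p(t), q(t))`, `t ∈ J`, is a solution of the `n`-th equation of the DSII hierarchy, with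
deformation operators `M t`. -/
def IsDSIIFlow (n : ℕ) (α γ : ℂ) (J : Set ℝ) (p q : ℝ → ℂ → ℂ) (M : ℝ → LaxCoeffs) : Prop :=
  ∀ t ∈ J, IsDSIIOperators n α γ (p t) (q t) (dt p t) (dt q t) (M t)

/-- `ψ_t = A ψ + B φ`, `φ_t = C ψ + D φ` for `t ∈ J`. -/
def IsLaxEvolution (n : ℕ) (J : Set ℝ) (M : ℝ → LaxCoeffs) (ψ φ : ℝ → ℂ → ℂ) : Prop :=
  ∀ t ∈ J, ∀ z, dt ψ t z = (M t).fst n (ψ t) (φ t) z ∧ dt φ t z = (M t).snd n (ψ t) (φ t) z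

/-! ### Decaying potentials -/

/-- Smooth functions which are `O(|z|^{-s})` at infinity together with all derivatives. -/
def Decays (s : ℝ) (f : ℂ → ℂ) : Prop :=
  ContDiff ℝ ∞ f ∧ ∀ m : ℕ, ∃ C : ℝ, ∀ z, ‖iteratedFDeriv ℝ m f z‖ ≤ C * (1 + ‖z‖) ^ (-s)

/-- A function of class `C^∞` on `J × ℂ`. -/
def SmoothFamily (J : Set ℝ) (f : ℝ → ℂ → ℂ) : Prop :=
  ContDiffOn ℝ ∞ (fun x : ℝ × ℂ => f x.1 x.2) (J ×ˢ Set.univ)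

/-- Smooth families of functions which, with all derivatives in `z` and with the velocity, are
`O(|z|^{-s})` at infinity, locally uniformly in `t`. -/
structure DecayingFamily (s : ℝ) (J : Set ℝ) (f : ℝ → ℂ → ℂ) : Prop where
  smooth : SmoothFamily J f
  bound : ∀ K ⊆ J, IsCompact K → ∀ m : ℕ, ∃ C : ℝ, ∀ t ∈ K, ∀ z,
    ‖iteratedFDeriv ℝ m (f t) z‖ ≤ C * (1 + ‖z‖) ^ (-s)
  bound_dt : ∀ K ⊆ J, IsCompact K → ∃ C : ℝ, ∀ t ∈ K, ∀ z,
    ‖dt f t z‖ ≤ C * (1 + ‖z‖) ^ (-s)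

/-! ### Surfaces in four-dimensional pseudo-Euclidean spaces -/

/-- The signature of `R^4`. -/
def sigR4 : Fin 4 → ℝ := ![1, 1, 1, 1]

/-- The signature of `R^{2,2}`. -/
def sigR22 : Fin 4 → ℝ := ![1, 1, -1, -1]

/-- The signature of `R^{3,1}`. -/
def sigR31 : Fin 4 → ℝ := ![1, 1, 1, -1]

/-- The scalar product `∑ η_i u_i v_i`. -/
def sprod (η u v : Fin 4 → ℝ) : ℝ := ∑ i, η i * u i * v i

/-- `X_x`, where `z = x + i y`. -/
def dx (X : ℂ → Fin 4 → ℝ) : ℂ → Fin 4 → ℝ := fun z => fderiv ℝ X z 1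

/-- `X_y`, where `z = x + i y`. -/
def dy (X : ℂ → Fin 4 → ℝ) : ℂ → Fin 4 → ℝ := fun z => fderiv ℝ X z Complex.I

/-- `X` is a smooth conformal immersion with nondegenerate induced metric `l dz dz̄`. -/
def IsConformalImmersion (η : Fin 4 → ℝ) (X : ℂ → Fin 4 → ℝ) (l : ℂ → ℝ) : Prop :=
  ContDiff ℝ ∞ X ∧ ∀ z, l z ≠ 0 ∧ sprod η (dx X z) (dx X z) = l z ∧
    sprod η (dy X z) (dy X z) = l z ∧ sprod η (dx X z) (dy X z) = 0

/-- The mean curvature vector `X_{z z̄} / g_{z z̄}` of a conformal immersion, where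
`X_{z z̄} = (X_xx + X_yy) / 4` and `g_{z z̄} = (⟨X_x, X_x⟩ + ⟨X_y, X_y⟩) / 4`. -/
def meanCurvature (η : Fin 4 → ℝ) (X : ℂ → Fin 4 → ℝ) : ℂ → Fin 4 → ℝ := fun z =>
  ((sprod η (dx X z) (dx X z) + sprod η (dy X z) (dy X z)) / 4)⁻¹ •
    ((1 / 4 : ℝ) • (dx (dx X) z + dy (dy X) z))

/-- The density of the area element of the induced metric with respect to `dx dy`. -/
def areaDensity (η : Fin 4 → ℝ) (X : ℂ → Fin 4 → ℝ) : ℂ → ℝ := fun z =>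
  Real.sqrt |sprod η (dx X z) (dx X z) * sprod η (dy X z) (dy X z)
    - sprod η (dx X z) (dy X z) ^ 2|

/-- The density `⟨H, H⟩ dS / (dx dy)` of the Willmore functional. -/
def willmoreDensity (η : Fin 4 → ℝ) (X : ℂ → Fin 4 → ℝ) : ℂ → ℝ := fun z =>
  sprod η (meanCurvature η X z) (meanCurvature η X z) * areaDensity η X z

/-- The Willmore functional `∫ ⟨H, H⟩ dS`. -/
def willmore (η : Fin 4 → ℝ) (X : ℂ → Fin 4 → ℝ) : ℝ := ∫ z, willmoreDensity η X z

/-! ### Generalized Weierstrass representations -/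

/-- The 1-form `f dz + g dz̄`. -/
def oneForm (f g : ℂ → ℂ) : ℂ → ℂ →L[ℝ] ℂ := fun z =>
  f z • ContinuousLinearMap.id ℝ ℂ + g z • (Complex.conjCLE : ℂ →L[ℝ] ℂ)

/-- `F = ∫_Γ (f dz' + g dz̄')` up to a constant, for all (continuously differentiable)
contours `Γ`; in particular the integrals depend only on the end points. -/
def IsContourIntegral (F f g : ℂ → ℂ) : Prop :=
  ∀ (z₀ z : ℂ) (Γ : Path z₀ z), ContDiffOn ℝ 1 Γ.extend (Set.Icc 0 1) →
    F z - F z₀ = curveIntegral (oneForm f g) Γ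

/-- The generalized Weierstrass formulae for `R^4`. -/
def WeierstrassR4 (ψ₁ φ₁ ψ₂ φ₂ : ℂ → ℂ) (X : ℂ → Fin 4 → ℝ) : Prop :=
  IsContourIntegral (fun z => X z 0 + Complex.I * X z 1)
    (fun z => -(φ₁ z * φ₂ z)) (fun z => ψ₁ z * ψ₂ z) ∧
  IsContourIntegral (fun z => X z 0 - Complex.I * X z 1)
    (fun z => conj (ψ₁ z) * conj (ψ₂ z)) (fun z => -(conj (φ₁ z) * conj (φ₂ z))) ∧
  IsContourIntegral (fun z => X z 2 + Complex.I * X z 3)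
    (fun z => conj (ψ₂ z) * φ₁ z) (fun z => ψ₁ z * conj (φ₂ z)) ∧
  IsContourIntegral (fun z => X z 2 - Complex.I * X z 3)
    (fun z => conj (ψ₁ z) * φ₂ z) (fun z => ψ₂ z * conj (φ₁ z))

/-- The generalized Weierstrass formulae for `R^{2,2}`. -/
def WeierstrassR22 (ψ₁ φ₁ ψ₂ φ₂ : ℂ → ℂ) (X : ℂ → Fin 4 → ℝ) : Prop :=
  IsContourIntegral (fun z => X z 0 + Complex.I * X z 1)
    (fun z => φ₁ z * φ₂ z) (fun z => ψ₁ z * ψ₂ z) ∧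
  IsContourIntegral (fun z => X z 0 - Complex.I * X z 1)
    (fun z => conj (ψ₁ z) * conj (ψ₂ z)) (fun z => conj (φ₁ z) * conj (φ₂ z)) ∧
  IsContourIntegral (fun z => X z 2 + Complex.I * X z 3)
    (fun z => Complex.I * (conj (ψ₁ z) * φ₂ z)) (fun z => Complex.I * (ψ₂ z * conj (φ₁ z))) ∧
  IsContourIntegral (fun z => X z 2 - Complex.I * X z 3)
    (fun z => -(Complex.I * (conj (ψ₂ z) * φ₁ z)))
    (fun z => -(Complex.I * (ψ₁ z * conj (φ₂ z))))

/-- The generalized Weierstrass formulae for `R^{3,1}`. -/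
def WeierstrassR31 (ψ₁ φ₁ ψ₂ φ₂ : ℂ → ℂ) (X : ℂ → Fin 4 → ℝ) : Prop :=
  IsContourIntegral (fun z => X z 0 + Complex.I * X z 1)
    (fun z => conj (ψ₂ z) * φ₁ z) (fun z => ψ₁ z * conj (φ₂ z)) ∧
  IsContourIntegral (fun z => X z 0 - Complex.I * X z 1)
    (fun z => conj (ψ₁ z) * φ₂ z) (fun z => ψ₂ z * conj (φ₁ z)) ∧
  IsContourIntegral (fun z => X z 2 + X z 3)
    (fun z => conj (ψ₁ z) * φ₁ z) (fun z => ψ₁ z * conj (φ₁ z)) ∧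
  IsContourIntegral (fun z => X z 2 - X z 3)
    (fun z => -(conj (ψ₂ z) * φ₂ z)) (fun z => -(ψ₂ z * conj (φ₂ z)))

/-- A surface depending smoothly on the deformation parameter. -/
def SmoothSurfaceFamily (J : Set ℝ) (X : ℝ → ℂ → Fin 4 → ℝ) : Prop :=
  ContDiffOn ℝ ∞ (fun x : ℝ × ℂ => X x.1 x.2) (J ×ˢ Set.univ)

/-! ### Deformations of the Weierstrass data -/

/-- A column `(ψ, φ)` depending smoothly on `t ∈ J`, solving the linear problem with potentials
`(p(t), q(t))` for every `t`, and evolving by the operators `M t`. -/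
structure IsSpinorDeformation (n : ℕ) (J : Set ℝ) (p q : ℝ → ℂ → ℂ) (M : ℝ → LaxCoeffs)
    (ψ φ : ℝ → ℂ → ℂ) : Prop where
  smooth_fst : SmoothFamily J ψ
  smooth_snd : SmoothFamily J φ
  linear : ∀ t ∈ J, IsDiracSolution Set.univ (p t) (q t) (ψ t) (φ t)
  evolution : IsLaxEvolution n J M ψ φ

/-- Data of a deformation by the `n`-th DSII flow with the reduction `q = ε p̄`: the first column
has potentials `(p, ε p̄)` and operators with leading constants `α, ᾱ`, the second column has
potentials `(p̄, ε p)` and operators with leading constants `(-1)^(n+1) α, (-1)^(n+1) ᾱ`. -/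
structure IsReducedDeformation (n : ℕ) (α : ℂ) (ε : ℝ) (J : Set ℝ) (p : ℝ → ℂ → ℂ)
    (M₁ M₂ : ℝ → LaxCoeffs) (ψ₁ φ₁ ψ₂ φ₂ : ℝ → ℂ → ℂ) : Prop where
  flow₁ : IsDSIIFlow n α (conj α) J p (fun t z => ε * conj (p t z)) M₁
  flow₂ : IsDSIIFlow n ((-1) ^ (n + 1) * α) ((-1) ^ (n + 1) * conj α) J
    (fun t z => conj (p t z)) (fun t z => ε * p t z) M₂
  spinor₁ : IsSpinorDeformation n J p (fun t z => ε * conj (p t z)) M₁ ψ₁ φ₁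
  spinor₂ : IsSpinorDeformation n J (fun t z => conj (p t z)) (fun t z => ε * p t z) M₂ ψ₂ φ₂

/-- Data of a deformation by the `n`-th real DSII flow: both columns have the real potentials
`(p, q)` and the same operators. -/
structure IsRealDeformation (n : ℕ) (α γ : ℂ) (J : Set ℝ) (p q : ℝ → ℂ → ℝ)
    (M : ℝ → LaxCoeffs) (ψ₁ φ₁ ψ₂ φ₂ : ℝ → ℂ → ℂ) : Prop where
  flow : IsDSIIFlow n α γ J (fun t z => (p t z : ℂ)) (fun t z => (q t z : ℂ)) M
  spinor₁ : IsSpinorDeformation n J (fun t z => (p t z : ℂ)) (fun t z => (q t z : ℂ)) M ψ₁ φ₁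
  spinor₂ : IsSpinorDeformation n J (fun t z => (p t z : ℂ)) (fun t z => (q t z : ℂ)) M ψ₂ φ₂

end DSII

end

open scoped ComplexConjugate ContDiff Topology

noncomputable section

namespace DSII

/-! ### Differential operators over a differential ring -/

section Algebra

open Finset

variable {R : Type*} [CommRing R] [Algebra ℂ R]

/-! The compatibility condition splits into two independent halves, interchanged by `∂ ↔ ∂̄`, `p ↔
q`, `A ↔ D`, `C ↔ B`. The half belonging to `A` says: `[∂, A] = pC - Eq`, `E∂̄ = Ap - A(p)`, `∂̄C =
qA + m`, where `E` is the off-diagonal entry of `Λ` and `m`, `A(p)` are functions (`HalfLax`). Here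
`C` and `E` are a left and a right quotient by `∂̄`, hence explicit in the coefficients of `A`. What
remains is a system for these coefficients, `∂ a_k = p c_k - (Eq)_k` (`CoeffEquations`), which is
strictly triangular: the right side involves only `a_i` with `i > k`. The velocities are the
zeroth-order remainders, `p_t = A(p) + m'` and `q_t = D(q) + m`, with `m'` the analogue of `m` for
the half of `D`.

Conversely, testing the compatibility identity at a point on monomials in `w - z` and its conjugate
recovers all of this from an arbitrary `Λ` (`coeff_of_compat_row`,
`IsDSIIOperators.exists_coeffEquations`). The system is solved downwards from the constant leading
coefficient. Every right side contains a factor from each of `p` and `q`, so it is `O(|z|^{-2s})`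
with `2s > 2`, and the Cauchy transform gives a solution vanishing at infinity
(`DecaysTo.exists_dzbar_eq`). Liouville's theorem makes it unique (`WirtingerPair.coeff_unique`).

The integral `∫ pq` is conserved because `p_t q + p q_t = ∂̄(C(p)) + ∂(B(q))`, a sum of derivatives
of functions decaying with exponent `2s`. The reductions follow from three symmetries together with
uniqueness of velocities: formal adjoints exchange `p` and `q`, complex conjugation maps `(p, q)` to
`(q̄, p̄)`, and a common sign may be put on both potentials.

For the surfaces, the linear problem makes the Weierstrass 1-forms closed, and the Poincaré lemma
with a parameter gives `X`. Conformality, the metric and `H²` are then pointwise algebra in `ψ` and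
`φ`: the Willmore density is a constant multiple of `|p|²` or `pq`, so `W` is conserved along with
`∫ pq`. -/

theorem iterate_derivation_mul (e : Derivation ℂ R R) (m : ℕ) (f g : R) :
    e^[m] (f * g) = ∑ k ∈ range (m + 1), (m.choose k : R) * (e^[m - k] f * e^[k] g) := by
  have h : e^[m] (f * g) =
      ∑ ij ∈ antidiagonal m, (m.choose ij.1 : R) * (e^[ij.2] f * e^[ij.1] g) := by
    induction m with
    | zero => simp
    | succ m ih =>
      rw [sum_antidiagonal_choose_succ_mul (fun i j => e^[j] f * e^[i] g) m,
        Function.iterate_succ_apply', ih, map_sum, ← sum_add_distrib]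
      refine sum_congr rfl fun ij hij => ?_
      have hs : m.choose ij.2 = m.choose ij.1 :=
        Nat.choose_symm_of_eq_add (by have := mem_antidiagonal.1 hij; omega)
      rw [Derivation.leibniz, Derivation.leibniz, Derivation.map_natCast, hs]
      simp only [smul_eq_mul, Function.iterate_succ_apply']
      ring
  rw [h, Nat.sum_antidiagonal_eq_sum_range_succ
    (fun i j => (m.choose i : R) * (e^[j] f * e^[i] g))]

/-- The operator `∑_{k ≤ n} a_k e^k`. -/
def diffOp (e : Derivation ℂ R R) (n : ℕ) (a : ℕ → R) (f : R) : R :=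
  ∑ k ∈ range (n + 1), a k * e^[k] f

/-- The coefficients of the composition of `∑_{k ≤ n} a_k e^k` with the multiplication by `p`. -/
def compCoeff (e : Derivation ℂ R R) (n : ℕ) (a : ℕ → R) (p : R) (k : ℕ) : R :=
  ∑ j ∈ range (n + 1), (j.choose k : R) * (a j * e^[j - k] p)

/-- The coefficients of the right quotient of `A p - A(p)` by `e`, where `A = ∑_{k ≤ n} a_k e^k`. -/
def quotCoeff (e : Derivation ℂ R R) (n : ℕ) (a : ℕ → R) (p : R) (k : ℕ) : R :=
  compCoeff e n a p (k + 1)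

/-- The coefficients of the left quotient of `q A` by `e`, where `A = ∑_{k ≤ n} a_k e^k`. -/
def leftCoeff (e : Derivation ℂ R R) (n : ℕ) (a : ℕ → R) (q : R) (k : ℕ) : R :=
  ∑ j ∈ Ioc k n, (-1) ^ (j - k - 1) * e^[j - k - 1] (q * a j)

/-- The coefficients of the formal adjoint of `∑_{k ≤ n} a_k e^k`. -/
def adjCoeff (e : Derivation ℂ R R) (n : ℕ) (a : ℕ → R) (k : ℕ) : R :=
  ∑ j ∈ range (n + 1), (-1) ^ j * ((j.choose k : R) * e^[j - k] (a j))

variable (e d : Derivation ℂ R R) (n : ℕ) (a : ℕ → R)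

/-- The binomial coefficients vanish beyond `m`, so the summation range can be made independent of
`m`; this lets the double sums below be interchanged. -/
theorem iterate_derivation_mul' {m : ℕ} (hm : m < n + 1) (f g : R) :
    e^[m] (f * g) = ∑ k ∈ range (n + 1), (m.choose k : R) * (e^[m - k] f * e^[k] g) := by
  rw [iterate_derivation_mul]
  refine sum_subset (range_mono (by omega)) fun k _ hk => ?_
  rw [Nat.choose_eq_zero_of_lt (by simpa using hk)]
  simp

theorem diffOp_mul (p f : R) :
    diffOp e n a (p * f) = diffOp e n (compCoeff e n a p) f := by
  unfold diffOp compCoeff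
  simp_rw [sum_mul]
  rw [sum_comm]
  refine sum_congr rfl fun k hk => ?_
  rw [iterate_derivation_mul' e n (mem_range.1 hk), mul_sum]
  exact sum_congr rfl fun j _ => by ring

theorem diffOp_adjCoeff (f : R) :
    diffOp e n (adjCoeff e n a) f = ∑ k ∈ range (n + 1), (-1) ^ k * e^[k] (a k * f) := by
  unfold diffOp adjCoeff
  simp_rw [sum_mul]
  rw [sum_comm]
  refine sum_congr rfl fun k hk => ?_
  rw [iterate_derivation_mul' e n (mem_range.1 hk), mul_sum]
  exact sum_congr rfl fun j _ => by ring

theorem compCoeff_zero (p : R) : compCoeff e n a p 0 = diffOp e n a p := by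
  simp [compCoeff, diffOp]

/-- The quotient has order at most `n - 1`; it is kept as a sum up to `n` with a zero top
coefficient so that all operators share one range. -/
theorem quotCoeff_self (p : R) : quotCoeff e n a p n = 0 := by
  unfold quotCoeff compCoeff
  refine sum_eq_zero fun j hj => ?_
  rw [Nat.choose_eq_zero_of_lt (mem_range.1 hj)]
  simp

/-- The zeroth coefficient of `A ∘ p` is the function `A(p)`. Once it is removed, every remaining
term ends in `e`, which can be split off on the right. -/
theorem diffOp_quotCoeff (p g : R) :
    diffOp e n (quotCoeff e n a p) (e g) = diffOp e n a (p * g) - diffOp e n a p * g := by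
  rw [diffOp_mul e n a, ← compCoeff_zero e n a, diffOp, diffOp, sum_range_succ, quotCoeff_self,
    sum_range_succ' _ n]
  simp [quotCoeff]

theorem leftCoeff_self (q : R) : leftCoeff e n a q n = 0 := by
  simp [leftCoeff]

/-- This is the comparison of the coefficients of `e^(k+1)` in `e ∘ C = q A` modulo functions; with
the zero top coefficient it determines `C`. -/
theorem leftCoeff_rec (q : R) {k : ℕ} (hk : k < n) :
    leftCoeff e n a q k = q * a (k + 1) - e (leftCoeff e n a q (k + 1)) := by
  have : Ioc k n = insert (k + 1) (Ioc (k + 1) n) := by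
    ext j
    simp only [mem_Ioc, mem_insert]
    omega
  unfold leftCoeff
  rw [this, sum_insert (by simp), map_sum, sub_eq_add_neg, ← sum_neg_distrib]
  congr 1
  · simp
  · refine sum_congr rfl fun j hj => ?_
    have hj' := (mem_Ioc.1 hj).1
    obtain ⟨i, rfl⟩ : ∃ i, j = k + 1 + 1 + i := ⟨j - (k + 1 + 1), by omega⟩
    have h1 : k + 1 + 1 + i - k - 1 = i + 1 := by omega
    have h2 : k + 1 + 1 + i - (k + 1) - 1 = i := by omega
    rw [h1, h2, Function.iterate_succ_apply', Derivation.leibniz]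
    have h3 : e ((-1) ^ i : R) = 0 := by
      simpa only [map_pow, map_neg, map_one] using e.map_algebraMap ((-1) ^ i : ℂ)
    rw [h3]
    simp [pow_succ]

/-- The recursion for `C` matches all coefficients of positive order in `e ∘ C` and `q A`. Nothing
is left to match order zero, and this remainder becomes a part of the velocity. -/
theorem derivation_diffOp_leftCoeff (q f : R) :
    e (diffOp e n (leftCoeff e n a q) f) =
      q * diffOp e n a f + (e (leftCoeff e n a q 0) - q * a 0) * f := by
  have h : ∀ k, e (leftCoeff e n a q k * e^[k] f) =
      leftCoeff e n a q k * e^[k + 1] f + e (leftCoeff e n a q k) * e^[k] f := fun k => by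
    rw [Derivation.leibniz, Function.iterate_succ_apply', smul_eq_mul, smul_eq_mul]
    ring
  unfold diffOp
  rw [map_sum, sum_congr rfl fun k _ => h k, sum_add_distrib, sum_range_succ, leftCoeff_self,
    sum_range_succ' (fun k => e (leftCoeff e n a q k) * _), ← add_assoc, zero_mul, add_zero,
    ← sum_add_distrib, sum_range_succ' (fun k => a k * _), mul_add, mul_sum]
  have : ∑ x ∈ range n, (leftCoeff e n a q x * e^[x + 1] f +
      e (leftCoeff e n a q (x + 1)) * e^[x + 1] f) =
      ∑ i ∈ range n, q * (a (i + 1) * e^[i + 1] f) := by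
    refine sum_congr rfl fun k hk => ?_
    rw [leftCoeff_rec e n a q (mem_range.1 hk)]
    ring
  rw [this]
  simp only [Function.iterate_zero, id_eq]
  ring

theorem derivation_diffOp (hde : ∀ f, d (e f) = e (d f)) (f : R) :
    d (diffOp e n a f) = diffOp e n a (d f) + diffOp e n (fun k => d (a k)) f := by
  have hk : ∀ k, d (e^[k] f) = e^[k] (d f) := fun k =>
    (Function.Semiconj.iterate_right (f := d) (fun x => hde x) k) f
  unfold diffOp
  rw [map_sum, ← sum_add_distrib]
  refine sum_congr rfl fun k _ => ?_
  rw [Derivation.leibniz, hk, smul_eq_mul, smul_eq_mul]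
  ring

/-- The equations for the coefficients of the operator `A`. -/
def CoeffEquations (d e : Derivation ℂ R R) (n : ℕ) (p q : R) (a : ℕ → R) : Prop :=
  ∀ k ≤ n, d (a k) = p * leftCoeff e n a q k - compCoeff e n (quotCoeff e n a p) q k

/-- The identities for the operators `A, C, E` which express one half of the compatibility
conditions. -/
structure HalfLax (d e : Derivation ℂ R R) (p q : R) (A C E : R → R) (m μ : R) : Prop where
  comm : ∀ f, d (A f) = A (d f) + p * C f - E (q * f)
  right_quot : ∀ f, E (e f) = A (p * f) - μ * f
  left_quot : ∀ f, e (C f) = q * A f + m * f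

variable {e d n a} in
-- The two quotient identities hold by construction of `leftCoeff` and `quotCoeff`; only the
-- commutator identity uses the coefficient equations.
theorem CoeffEquations.halfLax {p q : R} (h : CoeffEquations d e n p q a)
    (hde : ∀ f, d (e f) = e (d f)) :
    HalfLax d e p q (diffOp e n a) (diffOp e n (leftCoeff e n a q))
      (diffOp e n (quotCoeff e n a p)) (e (leftCoeff e n a q 0) - q * a 0) (diffOp e n a p) where
  comm f := by
    rw [derivation_diffOp e d n a hde, diffOp_mul e n (quotCoeff e n a p), add_sub_assoc]
    congr 1
    unfold diffOp
    rw [mul_sum, ← sum_sub_distrib]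
    refine sum_congr rfl fun k hk => ?_
    beta_reduce
    rw [h k (by have := mem_range.1 hk; omega)]
    ring
  right_quot f := diffOp_quotCoeff e n a p f
  left_quot f := derivation_diffOp_leftCoeff e n a q f

end Algebra

/-! ### Recovering the coefficients from the compatibility conditions -/

section Extraction

open Finset

variable {R : Type*} [CommRing R] [Algebra ℂ R]

theorem diffOp_add (e : Derivation ℂ R R) (n : ℕ) (a : ℕ → R) (f g : R) :
    diffOp e n a (f + g) = diffOp e n a f + diffOp e n a g := by
  simp only [diffOp, iterate_map_add, mul_add, sum_add_distrib]

theorem diffOp_neg (e : Derivation ℂ R R) (n : ℕ) (a : ℕ → R) (f : R) :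
    diffOp e n a (-f) = -diffOp e n a f := by
  simp only [diffOp, iterate_map_neg, mul_neg, sum_neg_distrib]

theorem diffOp_sub (e : Derivation ℂ R R) (n : ℕ) (a : ℕ → R) (f g : R) :
    diffOp e n a (f - g) = diffOp e n a f - diffOp e n a g := by
  rw [sub_eq_add_neg, diffOp_add, diffOp_neg, sub_eq_add_neg]

theorem diffOp_zero (e : Derivation ℂ R R) (n : ℕ) (a : ℕ → R) : diffOp e n a 0 = 0 := by
  simp [diffOp, iterate_map_zero]

/-- For `e = ∂̄` the factors annihilated by `e` are the holomorphic functions, so test monomials in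
one variable pass through operators in the other. -/
theorem diffOp_mul_of_constant (e : Derivation ℂ R R) (n : ℕ) (a : ℕ → R) {f : R} (hf : e f = 0)
    (g : R) : diffOp e n a (f * g) = f * diffOp e n a g := by
  have h : ∀ k, e^[k] (f * g) = f * e^[k] g := fun k => by
    induction k with
    | zero => rfl
    | succ k ih => simp [Function.iterate_succ_apply', ih, hf]
  simp only [diffOp, h, mul_sum]
  exact sum_congr rfl fun k _ => by ring

/-- Here `ev` is evaluation at a point and `w` a coordinate centred there, so powers of `w` isolate
single coefficients of a differential operator. -/
theorem map_iterate_derivation_pow (e : Derivation ℂ R R) (ev : R →+* ℂ) {w : R} (hw : e w = 1)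
    (hev : ev w = 0) (j k : ℕ) : ev (e^[j] (w ^ k)) = if j = k then (k.factorial : ℂ) else 0 := by
  induction j generalizing k with
  | zero =>
    rcases k with _ | k
    · simp
    · simp [hev]
  | succ j ih =>
    rcases k with _ | k
    · simp [Function.iterate_succ_apply, iterate_map_zero]
    · have h1 : e (w ^ (k + 1)) = (k + 1) • w ^ k := by
        simp [Derivation.leibniz_pow, hw]
      rw [Function.iterate_succ_apply, h1, ← Derivation.coeFn_coe, iterate_map_nsmul,
        Derivation.coeFn_coe, map_nsmul, ih]
      by_cases h : j = k
      · simp [h, Nat.factorial_succ]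
      · simp [h]

theorem map_diffOp_pow (e : Derivation ℂ R R) (ev : R →+* ℂ) {w : R} (hw : e w = 1)
    (hev : ev w = 0) (n : ℕ) (a : ℕ → R) (k : ℕ) :
    ev (diffOp e n a (w ^ k)) = if k ≤ n then k.factorial * ev (a k) else 0 := by
  simp only [diffOp, map_sum, map_mul, map_iterate_derivation_pow e ev hw hev, mul_ite, mul_zero,
    sum_ite_eq', mem_range, Nat.lt_succ_iff, mul_comm (ev (a k))]

/-- The consequences, at one point, of one row of the compatibility conditions. -/
theorem coeff_of_compat_row (d e : Derivation ℂ R R) (hde : ∀ f, d (e f) = e (d f))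
    (ev : R →+* ℂ) {w w' : R} (hdw : d w = 1) (hew : e w = 0) (hdw' : d w' = 0) (hew' : e w' = 1)
    (hw : ev w = 0) (hw' : ev w' = 0) (n : ℕ) (p q : R) (a b c g : ℕ → R) (P : ℂ) (l l' : ℕ → ℂ)
    (h : ∀ ψ φ : R, ev (d (diffOp e n a ψ + diffOp d n b φ)) -
      ev p * ev (diffOp e n c ψ + diffOp d n g φ) - P * ev φ =
        ∑ k ∈ range (n + 1), l k * ev (e^[k] (d ψ - p * φ)) +
          ∑ k ∈ range (n + 1), l' k * ev (e^[k] (e φ - q * ψ))) :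
    P = ev (diffOp e n a p + (d (b 0) - p * g 0)) ∧ ev (b n) = 0 ∧
      (∀ k < n, ev (b k) = ev (p * g (k + 1) - d (b (k + 1)))) ∧
      ∀ k ≤ n, ev (d (a k)) = ev (p * c k - compCoeff e n (quotCoeff e n a p) q k) := by
  have hfac : ∀ k : ℕ, (k.factorial : ℂ) ≠ 0 := fun k => Nat.cast_ne_zero.2 k.factorial_ne_zero
  have hdw'k : ∀ k, d (w' ^ k) = 0 := fun k => by simp [Derivation.leibniz_pow, hdw']
  have hewk : ∀ k, e (w ^ k) = 0 := fun k => by simp [Derivation.leibniz_pow, hew]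
  -- Test on `ψ = w w'^k`, `φ = 0`. The factor `w` commutes with `e` and vanishes at the point, so
  -- only the terms in which `d` hits `w` survive; this yields that the first diagonal entry of `Λ`
  -- is `A`.
  have hl : ∀ k ≤ n, l k = ev (a k) := fun k hk => by
    have h1 := h (w * w' ^ k) 0
    rw [diffOp_mul_of_constant e n a hew, diffOp_mul_of_constant e n c hew] at h1
    simp only [diffOp_zero, add_zero, mul_zero, sub_zero, map_zero, zero_sub] at h1
    have h2 : q * (w * w' ^ k) = w * (q * w' ^ k) := by ring
    have h3 : ∀ j, ev (e^[j] (-(q * (w * w' ^ k)))) = 0 := fun j => by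
      have := diffOp_mul_of_constant e j (fun i => if i = j then 1 else 0) hew (-(q * w' ^ k))
      simp only [diffOp, ite_mul, one_mul, zero_mul, sum_ite_eq', mem_range, Nat.lt_succ_iff,
        le_refl, if_true] at this
      rw [h2, ← mul_neg, this, map_mul, hw, zero_mul]
    simp only [h3, mul_zero, sum_const_zero, add_zero] at h1
    rw [Derivation.leibniz, Derivation.leibniz, hdw, hdw'k, smul_zero, zero_add, smul_eq_mul,
      smul_eq_mul, smul_eq_mul, map_add, map_mul, map_mul, map_mul, hw, mul_one,
      map_one, mul_one, map_diffOp_pow e ev hew' hw', if_pos hk] at h1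
    simp only [map_iterate_derivation_pow e ev hew' hw', mul_ite, mul_zero, sum_ite_eq',
      mem_range, Nat.lt_succ_iff, if_pos hk] at h1
    refine mul_right_cancel₀ (hfac k) ?_
    linear_combination -h1
  have hl2 : ∀ f, ∑ k ∈ range (n + 1), l k * ev (e^[k] f) = ev (diffOp e n a f) := fun f => by
    rw [diffOp, map_sum]
    exact sum_congr rfl fun k hk => by
      rw [hl k (by have := mem_range.1 hk; omega), map_mul]
  have hB : ∀ f, d (diffOp d n b f) = diffOp d n b (d f) + diffOp d n (fun k => d (b k)) f :=
    fun f => derivation_diffOp d d n b (fun _ => rfl) f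
  -- Test on `ψ = 0`, `φ = w^k`. As `e` annihilates `φ`, the right side reduces to `-A(p) φ`, and
  -- all information is about `b`, `g` and `P`.
  have hhol : ∀ k, ev (diffOp d n b (d (w ^ k))) + ev (diffOp d n (fun j => d (b j)) (w ^ k)) -
      ev p * ev (diffOp d n g (w ^ k)) - P * ev (w ^ k) =
        -(ev (diffOp e n a p) * ev (w ^ k)) := fun k => by
    have h1 := h 0 (w ^ k)
    rw [hl2, hewk] at h1
    simp only [diffOp_zero, zero_add, map_zero, mul_zero, sub_zero, zero_sub, diffOp_neg,
      iterate_map_zero, sum_const_zero, add_zero] at h1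
    rw [mul_comm p, diffOp_mul_of_constant e n a (hewk k), hB, map_add, map_neg, map_mul] at h1
    rw [h1]
    ring
  -- Test on `ψ = 0`, `φ = w'^(k+1)`. The terms with operators in `d` and the term `P φ` all vanish
  -- at the point. The exponent `k + 1` compensates the one factor `e` applied to `φ`.
  have hl' : ∀ k ≤ n, l' k = ev (quotCoeff e n a p k) := fun k hk => by
    have h1 := h 0 (w' ^ (k + 1))
    have h2 : ev (diffOp d n b (d (w' ^ (k + 1)))) = 0 := by
      rw [hdw'k, diffOp_zero, map_zero]
    have h3 : ∀ c : ℕ → R, ev (diffOp d n c (w' ^ (k + 1))) = 0 := fun c => by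
      rw [← mul_one (w' ^ (k + 1)), diffOp_mul_of_constant d n c (hdw'k _), map_mul, map_pow, hw']
      simp
    rw [hl2, diffOp_zero, diffOp_zero, zero_add, zero_add, hB, map_zero, zero_sub, diffOp_neg,
      map_add, h2, h3, h3, mul_zero, sub_zero, map_pow, hw', mul_zero, sub_zero,
      show diffOp e n a (p * w' ^ (k + 1)) = diffOp e n (quotCoeff e n a p) (e (w' ^ (k + 1))) +
        diffOp e n a p * w' ^ (k + 1) by rw [diffOp_quotCoeff]; ring] at h1
    have h4 : e (w' ^ (k + 1)) = ((k + 1 : ℕ) : R) * w' ^ k := by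
      simp [Derivation.leibniz_pow, hew']
    have h5 : e (((k + 1 : ℕ) : R)) = 0 := e.map_natCast _
    have h6 : ∀ j, ev (e^[j] (((k + 1 : ℕ) : R) * w' ^ k)) =
        (k + 1 : ℕ) * (if j = k then (k.factorial : ℂ) else 0) := fun j => by
      have := diffOp_mul_of_constant e j (fun i => if i = j then 1 else 0) h5 (w' ^ k)
      simp only [diffOp, ite_mul, one_mul, zero_mul, sum_ite_eq', mem_range, Nat.lt_succ_iff,
        le_refl, if_true] at this
      rw [this, map_mul, map_natCast, map_iterate_derivation_pow e ev hew' hw']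
    rw [h4, diffOp_mul_of_constant e n _ h5] at h1
    simp only [h6, mul_ite, mul_zero, sum_ite_eq', mem_range, Nat.lt_succ_iff, if_pos hk, map_neg,
      map_add, map_mul, map_pow, hw', map_natCast, map_diffOp_pow e ev hew' hw'] at h1
    have hk1 : ((k + 1 : ℕ) : ℂ) ≠ 0 := Nat.cast_ne_zero.2 (by omega)
    refine mul_right_cancel₀ (mul_ne_zero hk1 (hfac k)) ?_
    rw [zero_pow (by omega)] at h1
    linear_combination -h1
  have hl2' : ∀ f, ∑ k ∈ range (n + 1), l' k * ev (e^[k] f) =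
      ev (diffOp e n (quotCoeff e n a p) f) := fun f => by
    rw [diffOp, map_sum]
    exact sum_congr rfl fun k hk => by
      rw [hl' k (by have := mem_range.1 hk; omega), map_mul]
  have hpow : ∀ (c : ℕ → R) k, ev (diffOp d n c (d (w ^ (k + 1)))) =
      if k ≤ n then (k + 1).factorial * ev (c k) else 0 := fun c k => by
    have h4 : d (w ^ (k + 1)) = ((k + 1 : ℕ) : R) * w ^ k := by
      simp [Derivation.leibniz_pow, hdw]
    rw [h4, diffOp_mul_of_constant d n c (d.map_natCast _), map_mul, map_natCast,
      map_diffOp_pow d ev hdw hw, Nat.factorial_succ]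
    split_ifs
    · push_cast; ring
    · ring
  refine ⟨?_, ?_, ?_, ?_⟩
  · have h1 := hhol 0
    simp only [pow_zero, Derivation.map_one_eq_zero, diffOp_zero,
      map_zero, map_one] at h1
    have h2 : ∀ c : ℕ → R, ev (diffOp d n c 1) = ev (c 0) := fun c => by
      have := map_diffOp_pow d ev hdw hw n c 0
      simpa using this
    rw [h2, h2] at h1
    simp only [map_add, map_sub, map_mul]
    linear_combination -h1
  -- The exponent `n + 1` exceeds the order of every operator; only `b n`, applied to `d (w^(n+1))`,
  -- is seen.
  · have h1 := hhol (n + 1)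
    rw [hpow, if_pos le_rfl, map_diffOp_pow d ev hdw hw, if_neg (by omega),
      map_diffOp_pow d ev hdw hw, if_neg (by omega), map_pow, hw, zero_pow (by omega)] at h1
    exact (mul_eq_zero.1 (by linear_combination h1)).resolve_left (hfac (n + 1))
  · intro k hk
    have h1 := hhol (k + 1)
    rw [hpow, if_pos hk.le, map_diffOp_pow d ev hdw hw, if_pos (Nat.succ_le_of_lt hk),
      map_diffOp_pow d ev hdw hw, if_pos (Nat.succ_le_of_lt hk), map_pow, hw, zero_pow (by omega)] at h1
    refine mul_left_cancel₀ (hfac (k + 1)) ?_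
    rw [map_sub, map_mul]
    linear_combination h1
  -- With `Λ` now known to be `(A, E)` in this row, the test pair `ψ = w'^k`, `φ = 0` reads off the
  -- coefficients of `[d, A] = pC - Eq`.
  · intro k hk
    have h1 := h (w' ^ k) 0
    rw [hl2, hl2', hdw'k, diffOp_zero, diffOp_zero, map_zero, mul_zero, mul_zero, sub_zero,
      sub_zero, diffOp_zero, map_zero, map_zero, zero_sub, diffOp_neg,
      diffOp_mul e n (quotCoeff e n a p), add_zero, add_zero, derivation_diffOp e d n a hde, hdw'k, diffOp_zero, zero_add, map_neg,
      map_diffOp_pow e ev hew' hw', map_diffOp_pow e ev hew' hw', map_diffOp_pow e ev hew' hw',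
      if_pos hk, if_pos hk, if_pos hk] at h1
    refine mul_left_cancel₀ (hfac k) ?_
    rw [map_sub, map_mul]
    linear_combination h1

/-- The off-diagonal operators therefore carry no freedom: they are determined by the diagonal ones.
-/
theorem eq_leftCoeff (e : Derivation ℂ R R) (n : ℕ) (a c : ℕ → R) (q : R) (hn : c n = 0)
    (h : ∀ k < n, c k = q * a (k + 1) - e (c (k + 1))) {k : ℕ} (hk : k ≤ n) :
    c k = leftCoeff e n a q k := by
  induction hk using Nat.decreasingInduction with
  | self => rw [hn, leftCoeff_self]
  | of_succ k hk ih => rw [h k hk, ih, leftCoeff_rec e n a q hk]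

/-- One row of the compatibility conditions. -/
theorem HalfLax.compat_row {d e : Derivation ℂ R R} {p q : R} {n : ℕ} {a c ε b g : ℕ → R}
    {F : R → R} {m μ m' μ' : R}
    (h : HalfLax d e p q (diffOp e n a) (diffOp e n c) (diffOp e n ε) m μ)
    (h' : HalfLax e d q p (diffOp d n g) (diffOp d n b) F m' μ') (ψ φ : R) :
    d (diffOp e n a ψ + diffOp d n b φ) - p * (diffOp e n c ψ + diffOp d n g φ) -
      (m' + μ) * φ = diffOp e n a (d ψ - p * φ) + diffOp e n ε (e φ - q * ψ) := by
  rw [map_add, h.comm, h'.left_quot, diffOp_sub, diffOp_sub, h.right_quot]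
  ring

end Extraction

/-! ### The differential ring of smooth functions -/

theorem contDiff_fderiv_apply {E F : Type*} [NormedAddCommGroup E] [NormedSpace ℝ E]
    [NormedAddCommGroup F] [NormedSpace ℝ F] {f : E → F} (hf : ContDiff ℝ ∞ f) (v : E) :
    ContDiff ℝ ∞ fun z => fderiv ℝ f z v :=
  (hf.fderiv_right (m := ∞) le_rfl).clm_apply contDiff_const

theorem contDiff_dz {f : ℂ → ℂ} (hf : ContDiff ℝ ∞ f) : ContDiff ℝ ∞ (dz f) :=
  contDiff_const.mul
    ((contDiff_fderiv_apply hf 1).sub (contDiff_const.mul (contDiff_fderiv_apply hf Complex.I)))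

theorem contDiff_dzbar {f : ℂ → ℂ} (hf : ContDiff ℝ ∞ f) : ContDiff ℝ ∞ (dzbar f) :=
  contDiff_const.mul
    ((contDiff_fderiv_apply hf 1).add (contDiff_const.mul (contDiff_fderiv_apply hf Complex.I)))

theorem dz_add {f g : ℂ → ℂ} {z : ℂ} (hf : DifferentiableAt ℝ f z)
    (hg : DifferentiableAt ℝ g z) : dz (fun w => f w + g w) z = dz f z + dz g z := by
  simp only [dz, fderiv_fun_add hf hg, add_apply]
  ring

theorem dzbar_add {f g : ℂ → ℂ} {z : ℂ} (hf : DifferentiableAt ℝ f z)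
    (hg : DifferentiableAt ℝ g z) : dzbar (fun w => f w + g w) z = dzbar f z + dzbar g z := by
  simp only [dzbar, fderiv_fun_add hf hg, add_apply]
  ring

theorem dz_mul {f g : ℂ → ℂ} {z : ℂ} (hf : DifferentiableAt ℝ f z)
    (hg : DifferentiableAt ℝ g z) : dz (fun w => f w * g w) z = f z * dz g z + g z * dz f z := by
  simp only [dz, fderiv_fun_mul hf hg, add_apply,
    smul_apply, smul_eq_mul]
  ring

theorem dzbar_mul {f g : ℂ → ℂ} {z : ℂ} (hf : DifferentiableAt ℝ f z)
    (hg : DifferentiableAt ℝ g z) :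
    dzbar (fun w => f w * g w) z = f z * dzbar g z + g z * dzbar f z := by
  simp only [dzbar, fderiv_fun_mul hf hg, add_apply,
    smul_apply, smul_eq_mul]
  ring

theorem dz_const_mul (c : ℂ) (f : ℂ → ℂ) (z : ℂ) : dz (fun w => c * f w) z = c * dz f z := by
  have h : fderiv ℝ (fun w => c * f w) z = c • fderiv ℝ f z :=
    congrFun (fderiv_const_smul_field (𝕜 := ℝ) (R := ℂ) (f := f) c) z
  simp only [dz, h, smul_apply, smul_eq_mul]
  ring

theorem dzbar_const_mul (c : ℂ) (f : ℂ → ℂ) (z : ℂ) :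
    dzbar (fun w => c * f w) z = c * dzbar f z := by
  have h : fderiv ℝ (fun w => c * f w) z = c • fderiv ℝ f z :=
    congrFun (fderiv_const_smul_field (𝕜 := ℝ) (R := ℂ) (f := f) c) z
  simp only [dzbar, h, smul_apply, smul_eq_mul]
  ring

theorem fderiv_conj (f : ℂ → ℂ) (z v : ℂ) :
    fderiv ℝ (fun w => conj (f w)) z v = conj (fderiv ℝ f z v) := by
  have h := Complex.conjCLE.comp_fderiv (f := f) (x := z)
  exact congrArg (fun L : ℂ →L[ℝ] ℂ => L v) h

theorem dz_conj (f : ℂ → ℂ) (z : ℂ) : dz (fun w => conj (f w)) z = conj (dzbar f z) := by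
  simp only [dz, dzbar, fderiv_conj, map_mul, map_add, map_div₀, map_one, map_ofNat, Complex.conj_I]
  ring

theorem dzbar_conj (f : ℂ → ℂ) (z : ℂ) : dzbar (fun w => conj (f w)) z = conj (dz f z) := by
  simp only [dz, dzbar, fderiv_conj, map_mul, map_sub, map_div₀, map_one, map_ofNat, Complex.conj_I]
  ring

theorem iterate_dz_conj (f : ℂ → ℂ) (k : ℕ) :
    dz^[k] (fun w => conj (f w)) = fun w => conj (dzbar^[k] f w) := by
  induction k with
  | zero => rfl
  | succ k ih =>
    rw [Function.iterate_succ_apply', Function.iterate_succ_apply', ih]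
    exact funext (dz_conj _)

theorem iterate_dzbar_conj (f : ℂ → ℂ) (k : ℕ) :
    dzbar^[k] (fun w => conj (f w)) = fun w => conj (dz^[k] f w) := by
  induction k with
  | zero => rfl
  | succ k ih =>
    rw [Function.iterate_succ_apply', Function.iterate_succ_apply', ih]
    exact funext (dzbar_conj _)

theorem fderiv_dz {f : ℂ → ℂ} (hf : ContDiff ℝ ∞ f) (z v : ℂ) :
    fderiv ℝ (dz f) z v = (1 / 2 : ℂ) *
      (fderiv ℝ (fderiv ℝ f) z v 1 - Complex.I * fderiv ℝ (fderiv ℝ f) z v Complex.I) := by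
  have h2 : Differentiable ℝ (fderiv ℝ f) :=
    (hf.fderiv_right (m := ∞) le_rfl).differentiable (by simp)
  have h3 : ∀ u, HasFDerivAt (fun w => fderiv ℝ f w u) ((fderiv ℝ (fderiv ℝ f) z).flip u) z :=
    fun u => by simpa using (h2 z).hasFDerivAt.clm_apply (hasFDerivAt_const u z)
  have h4 := ((h3 1).sub ((h3 Complex.I).const_mul Complex.I)).const_mul (1 / 2 : ℂ)
  rw [show dz f = fun w => (1 / 2 : ℂ) * (fderiv ℝ f w 1 - Complex.I * fderiv ℝ f w Complex.I)
    from rfl]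
  erw [h4.fderiv]
  simp

theorem fderiv_dzbar {f : ℂ → ℂ} (hf : ContDiff ℝ ∞ f) (z v : ℂ) :
    fderiv ℝ (dzbar f) z v = (1 / 2 : ℂ) *
      (fderiv ℝ (fderiv ℝ f) z v 1 + Complex.I * fderiv ℝ (fderiv ℝ f) z v Complex.I) := by
  have h2 : Differentiable ℝ (fderiv ℝ f) :=
    (hf.fderiv_right (m := ∞) le_rfl).differentiable (by simp)
  have h3 : ∀ u, HasFDerivAt (fun w => fderiv ℝ f w u) ((fderiv ℝ (fderiv ℝ f) z).flip u) z :=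
    fun u => by simpa using (h2 z).hasFDerivAt.clm_apply (hasFDerivAt_const u z)
  have h4 := ((h3 1).add ((h3 Complex.I).const_mul Complex.I)).const_mul (1 / 2 : ℂ)
  rw [show dzbar f = fun w => (1 / 2 : ℂ) * (fderiv ℝ f w 1 + Complex.I * fderiv ℝ f w Complex.I)
    from rfl]
  erw [h4.fderiv]
  simp [mul_add]

theorem dz_dzbar {f : ℂ → ℂ} (hf : ContDiff ℝ ∞ f) (z : ℂ) :
    dz (dzbar f) z = dzbar (dz f) z := by
  have h : fderiv ℝ (fderiv ℝ f) z 1 Complex.I = fderiv ℝ (fderiv ℝ f) z Complex.I 1 :=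
    (hf.contDiffAt.isSymmSndFDerivAt (by simpa using WithTop.coe_le_coe.2 (le_top : (2 : ℕ∞) ≤ ⊤))) 1 Complex.I
  rw [dz, dzbar, fderiv_dz hf, fderiv_dz hf, fderiv_dzbar hf, fderiv_dzbar hf, h]
  ring

/-- The algebra of smooth functions on the plane. -/
def smoothSubalgebra : Subalgebra ℂ (ℂ → ℂ) where
  carrier := {f | ContDiff ℝ ∞ f}
  mul_mem' {f g} hf hg := by
    change ContDiff ℝ ∞ f at hf
    change ContDiff ℝ ∞ g at hg
    exact hf.mul hg
  add_mem' {f g} hf hg := by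
    change ContDiff ℝ ∞ f at hf
    change ContDiff ℝ ∞ g at hg
    exact hf.add hg
  algebraMap_mem' c := by
    change ContDiff ℝ ∞ fun _ : ℂ => c
    exact contDiff_const

/-- Smooth functions on the plane. -/
abbrev Smooth : Type := smoothSubalgebra

namespace Smooth

theorem contDiff (f : Smooth) : ContDiff ℝ ∞ (f : ℂ → ℂ) := f.2

theorem differentiable (f : Smooth) : Differentiable ℝ (f : ℂ → ℂ) :=
  f.contDiff.differentiable (by simp)

/-- `∂_z` on smooth functions. -/
def del : Derivation ℂ Smooth Smooth :=
  Derivation.mk'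
    { toFun := fun f => ⟨dz f, contDiff_dz f.2⟩
      map_add' := fun f g => Subtype.ext <| funext fun z =>
        dz_add (f.differentiable z) (g.differentiable z)
      map_smul' := fun c f => Subtype.ext <| funext fun z => dz_const_mul c f z }
    fun f g => Subtype.ext <| funext fun z => dz_mul (f.differentiable z) (g.differentiable z)

/-- `∂_z̄` on smooth functions. -/
def delbar : Derivation ℂ Smooth Smooth :=
  Derivation.mk'
    { toFun := fun f => ⟨dzbar f, contDiff_dzbar f.2⟩
      map_add' := fun f g => Subtype.ext <| funext fun z =>
        dzbar_add (f.differentiable z) (g.differentiable z)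
      map_smul' := fun c f => Subtype.ext <| funext fun z => dzbar_const_mul c f z }
    fun f g => Subtype.ext <| funext fun z => dzbar_mul (f.differentiable z) (g.differentiable z)

theorem del_delbar (f : Smooth) : del (delbar f) = delbar (del f) :=
  Subtype.ext <| funext fun z => dz_dzbar f.2 z

theorem coe_iterate_del (f : Smooth) (k : ℕ) : (del^[k] f : Smooth).1 = dz^[k] f.1 := by
  induction k with
  | zero => rfl
  | succ k ih => rw [Function.iterate_succ_apply', Function.iterate_succ_apply', ← ih]; rfl

theorem coe_iterate_delbar (f : Smooth) (k : ℕ) :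
    (delbar^[k] f : Smooth).1 = dzbar^[k] f.1 := by
  induction k with
  | zero => rfl
  | succ k ih => rw [Function.iterate_succ_apply', Function.iterate_succ_apply', ← ih]; rfl

/-- The value of a smooth function at a point. -/
def eval (z : ℂ) : Smooth →+* ℂ :=
  (Pi.evalRingHom (fun _ : ℂ => ℂ) z).comp smoothSubalgebra.val.toRingHom

@[simp] theorem eval_apply (z : ℂ) (f : Smooth) : eval z f = (f : ℂ → ℂ) z := rfl

theorem ext_eval {f g : Smooth} (h : ∀ z, eval z f = eval z g) : f = g :=
  Subtype.ext <| funext h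

/-- The function `w ↦ w - z`. -/
def subConst (z : ℂ) : Smooth :=
  ⟨fun w => w - z, show ContDiff ℝ ∞ fun w => w - z from contDiff_id.sub contDiff_const⟩

/-- The function `w ↦ w̄ - z̄`. -/
def conjSubConst (z : ℂ) : Smooth :=
  ⟨fun w => conj (w - z), show ContDiff ℝ ∞ fun w => conj (w - z) from
    Complex.conjCLE.contDiff.comp (contDiff_id.sub contDiff_const)⟩

theorem fderiv_sub_const (z u v : ℂ) : fderiv ℝ (fun w : ℂ => w - z) u v = v := by
  have h : HasFDerivAt (fun w : ℂ => w - z) (ContinuousLinearMap.id ℝ ℂ) u :=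
    (hasFDerivAt_id u).sub_const z
  rw [h.fderiv]
  rfl

theorem del_subConst (z : ℂ) : del (subConst z) = 1 := by
  refine Subtype.ext <| funext fun u => ?_
  change dz (fun w : ℂ => w - z) u = 1
  rw [dz, fderiv_sub_const, fderiv_sub_const, Complex.I_mul_I]
  norm_num

theorem delbar_subConst (z : ℂ) : delbar (subConst z) = 0 := by
  refine Subtype.ext <| funext fun u => ?_
  change dzbar (fun w : ℂ => w - z) u = 0
  rw [dzbar, fderiv_sub_const, fderiv_sub_const, Complex.I_mul_I]
  norm_num

theorem del_conjSubConst (z : ℂ) : del (conjSubConst z) = 0 := by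
  refine Subtype.ext <| funext fun u => ?_
  have h := congrArg (fun f : Smooth => conj ((f : ℂ → ℂ) u)) (delbar_subConst z)
  change dz (fun w : ℂ => conj (w - z)) u = 0
  rw [dz_conj]
  exact h.trans (map_zero _)

theorem delbar_conjSubConst (z : ℂ) : delbar (conjSubConst z) = 1 := by
  refine Subtype.ext <| funext fun u => ?_
  have h := congrArg (fun f : Smooth => conj ((f : ℂ → ℂ) u)) (del_subConst z)
  change dzbar (fun w : ℂ => conj (w - z)) u = 1
  rw [dzbar_conj]
  exact h.trans (map_one _)

theorem eval_subConst (z : ℂ) : eval z (subConst z) = 0 := sub_self z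

theorem eval_conjSubConst (z : ℂ) : eval z (conjSubConst z) = 0 := by
  change conj (z - z) = 0
  simp

theorem coe_sum {ι : Type*} (s : Finset ι) (f : ι → Smooth) (z : ℂ) :
    ((∑ i ∈ s, f i : Smooth) : ℂ → ℂ) z = ∑ i ∈ s, (f i : ℂ → ℂ) z :=
  map_sum (eval z) f s

theorem coe_diffOp_del {n : ℕ} {a : ℕ → Smooth} {c : ℕ → ℂ → ℂ} (h : ∀ k ≤ n, c k = a k)
    (f : Smooth) : ((diffOp del n a f : Smooth) : ℂ → ℂ) = opZ n c f := by
  funext z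
  rw [diffOp, coe_sum, opZ]
  refine Finset.sum_congr rfl fun k hk => ?_
  rw [h k (by have := Finset.mem_range.1 hk; omega), ← coe_iterate_del]
  rfl

theorem coe_diffOp_delbar {n : ℕ} {a : ℕ → Smooth} {c : ℕ → ℂ → ℂ} (h : ∀ k ≤ n, c k = a k)
    (f : Smooth) : ((diffOp delbar n a f : Smooth) : ℂ → ℂ) = opZbar n c f := by
  funext z
  rw [diffOp, coe_sum, opZbar]
  refine Finset.sum_congr rfl fun k hk => ?_
  rw [h k (by have := Finset.mem_range.1 hk; omega), ← coe_iterate_delbar]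
  rfl

end Smooth

open Smooth

/-- The coefficients of the operators of the hierarchy. -/
theorem IsDSIIOperators.exists_coeffEquations {n : ℕ} {α γ : ℂ} {p q : Smooth} {P Q : ℂ → ℂ}
    {M : LaxCoeffs} (h : IsDSIIOperators n α γ p q P Q M) :
    ∃ a g : ℕ → Smooth, (∀ k ≤ n, M.a k = a k ∧ M.d k = g k) ∧
      CoeffEquations del delbar n p q a ∧ CoeffEquations delbar del n q p g ∧
      P = (diffOp delbar n a p + (del (leftCoeff del n g p 0) - p * g 0) : Smooth) ∧
      Q = (diffOp del n g q + (delbar (leftCoeff delbar n a q 0) - q * a 0) : Smooth) := by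
  have lift : ∀ c : ℕ → ℂ → ℂ, (∀ k ≤ n, ContDiff ℝ ∞ (c k)) →
      ∃ c' : ℕ → Smooth, ∀ k ≤ n, c k = c' k := fun c hc =>
    -- Coefficients beyond the order are unconstrained and may fail to be smooth, so they are
    -- replaced by zero.
    ⟨fun k => if hk : k ≤ n then ⟨c k, hc k hk⟩ else 0, fun k hk => by simp [hk]⟩
  obtain ⟨a, ha⟩ := lift M.a fun k hk => (h.smooth k hk).1
  obtain ⟨b, hb⟩ := lift M.b fun k hk => (h.smooth k hk).2.1
  obtain ⟨c, hc⟩ := lift M.c fun k hk => (h.smooth k hk).2.2.1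
  obtain ⟨g, hg⟩ := lift M.d fun k hk => (h.smooth k hk).2.2.2
  obtain ⟨l₁₁, l₁₂, l₂₁, l₂₂, hl⟩ := h.compat
  have hfst : ∀ ψ φ : Smooth, M.fst n ψ φ = (diffOp delbar n a ψ + diffOp del n b φ : Smooth) := by
    intro ψ φ
    funext z
    have h1 := congrFun (coe_diffOp_delbar ha ψ) z
    have h2 := congrFun (coe_diffOp_del hb φ) z
    change opZbar n M.a ψ z + opZ n M.b φ z = _
    rw [← h1, ← h2]
    rfl
  have hsnd : ∀ ψ φ : Smooth, M.snd n ψ φ = (diffOp delbar n c ψ + diffOp del n g φ : Smooth) := by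
    intro ψ φ
    funext z
    have h1 := congrFun (coe_diffOp_delbar hc ψ) z
    have h2 := congrFun (coe_diffOp_del hg φ) z
    change opZbar n M.c ψ z + opZ n M.d φ z = _
    rw [← h1, ← h2]
    rfl
  have hrow₁ := fun z => coeff_of_compat_row del delbar del_delbar (eval z) (del_subConst z)
    (delbar_subConst z) (del_conjSubConst z) (delbar_conjSubConst z) (eval_subConst z)
    (eval_conjSubConst z) n p q a b c g (P z) (fun k => l₁₁ k z) (fun k => l₁₂ k z) fun ψ φ => by
      have := (hl ψ φ ψ.2 φ.2 z).1
      rw [hfst, hsnd] at this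
      simp only [eval_apply, coe_iterate_delbar]
      exact this
  -- The second row is the first one after exchanging `∂` with `∂̄`, `p` with `q`, `(A, B)` with
  -- `(D, C)` and the two test functions.
  have hrow₂ := fun z => coeff_of_compat_row delbar del (fun f => (del_delbar f).symm) (eval z)
    (delbar_conjSubConst z) (del_conjSubConst z) (delbar_subConst z) (del_subConst z)
    (eval_conjSubConst z) (eval_subConst z) n q p g c b a (Q z) (fun k => l₂₂ k z)
    (fun k => l₂₁ k z) fun φ ψ => by
      have := (hl ψ φ ψ.2 φ.2 z).2
      rw [hfst, hsnd] at this
      simp only [eval_apply, coe_iterate_del]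
      rw [add_comm (diffOp del n g φ), add_comm (diffOp del n b φ),
        add_comm (∑ k ∈ Finset.range (n + 1), l₂₂ k z * (dz^[k] _) z)]
      exact this
  have hb' : ∀ k ≤ n, b k = leftCoeff del n g p k := fun k hk =>
    eq_leftCoeff del n g b p (ext_eval fun z => (hrow₁ z).2.1.trans (map_zero _).symm)
      (fun k hk => ext_eval fun z => (hrow₁ z).2.2.1 k hk) hk
  have hc' : ∀ k ≤ n, c k = leftCoeff delbar n a q k := fun k hk =>
    eq_leftCoeff delbar n a c q (ext_eval fun z => (hrow₂ z).2.1.trans (map_zero _).symm)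
      (fun k hk => ext_eval fun z => (hrow₂ z).2.2.1 k hk) hk
  refine ⟨a, g, fun k hk => ⟨ha k hk, hg k hk⟩, fun k hk => ?_, fun k hk => ?_, ?_, ?_⟩
  · rw [← hc' k hk]
    exact ext_eval fun z => (hrow₁ z).2.2.2 k hk
  · rw [← hb' k hk]
    exact ext_eval fun z => (hrow₂ z).2.2.2 k hk
  · rw [← hb' 0 (Nat.zero_le n)]
    exact funext fun z => (hrow₁ z).1
  · rw [← hc' 0 (Nat.zero_le n)]
    exact funext fun z => (hrow₂ z).1

/-- Operators satisfying both halves of the compatibility conditions are operators of the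
hierarchy. -/
theorem isDSIIOperators_of_halfLax {n : ℕ} {α γ : ℂ} {p q : Smooth} {a b c g ε ε' : ℕ → Smooth}
    {m μ m' μ' : Smooth}
    (h : HalfLax del delbar p q (diffOp delbar n a) (diffOp delbar n c) (diffOp delbar n ε) m μ)
    (h' : HalfLax delbar del q p (diffOp del n g) (diffOp del n b) (diffOp del n ε') m' μ')
    (ha : ∀ z, (a n : ℂ → ℂ) z = α) (hg : ∀ z, (g n : ℂ → ℂ) z = γ)
    (ha' : ∀ k < n, ∀ m : ℕ, Filter.Tendsto (iteratedFDeriv ℝ m (a k : ℂ → ℂ))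
      (Filter.cocompact ℂ) (𝓝 0))
    (hg' : ∀ k < n, ∀ m : ℕ, Filter.Tendsto (iteratedFDeriv ℝ m (g k : ℂ → ℂ))
      (Filter.cocompact ℂ) (𝓝 0)) :
    IsDSIIOperators n α γ p q (m' + μ : Smooth) (m + μ' : Smooth)
      ⟨fun k => a k, fun k => b k, fun k => c k, fun k => g k⟩ where
  smooth k _ := ⟨(a k).2, (b k).2, (c k).2, (g k).2⟩
  lead_a := ha
  lead_d := hg
  lower_a := ha'
  lower_d := hg'
  compat := by
    refine ⟨fun k => a k, fun k => ε k, fun k => ε' k, fun k => g k, fun ψ φ hψ hφ z => ?_⟩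
    obtain ⟨ψ, rfl⟩ : ∃ f : Smooth, (f : ℂ → ℂ) = ψ := ⟨⟨ψ, hψ⟩, rfl⟩
    obtain ⟨φ, rfl⟩ : ∃ f : Smooth, (f : ℂ → ℂ) = φ := ⟨⟨φ, hφ⟩, rfl⟩
    have hZ : ∀ (a : ℕ → Smooth) (f : Smooth), opZ n (fun k => a k) f = diffOp del n a f :=
      fun a f => (coe_diffOp_del (fun _ _ => rfl) f).symm
    have hZb : ∀ (a : ℕ → Smooth) (f : Smooth), opZbar n (fun k => a k) f = diffOp delbar n a f :=
      fun a f => (coe_diffOp_delbar (fun _ _ => rfl) f).symm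
    have h1 := congrArg (eval z) (h.compat_row h' ψ φ)
    have h2 := congrArg (eval z) (h'.compat_row h φ ψ)
    have hf : LaxCoeffs.fst ⟨fun k => a k, fun k => b k, fun k => c k, fun k => g k⟩ n ψ φ =
        (diffOp delbar n a ψ + diffOp del n b φ : Smooth) := by
      funext w
      simp only [LaxCoeffs.fst, hZ, hZb]
      rfl
    have hs : LaxCoeffs.snd ⟨fun k => a k, fun k => b k, fun k => c k, fun k => g k⟩ n ψ φ =
        (diffOp delbar n c ψ + diffOp del n g φ : Smooth) := by
      funext w
      simp only [LaxCoeffs.snd, hZ, hZb]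
      rfl
    rw [hf, hs]
    constructor
    · refine h1.trans ?_
      rw [map_add, eval_apply, eval_apply, ← hZb, ← hZb]
      rfl
    · rw [add_comm (diffOp del n g φ), add_comm (diffOp del n b φ)] at h2
      refine h2.trans ?_
      rw [map_add, add_comm, eval_apply, eval_apply, ← hZ, ← hZ]
      rfl

/-! ### Functions decaying or vanishing at infinity with all derivatives -/

section Classes

variable {E F : Type*} [NormedAddCommGroup E] [NormedSpace ℝ E]
  [NormedAddCommGroup F] [NormedSpace ℝ F]

/-- Smooth vector-valued functions which are `O(|z|^{-s})` with all derivatives. -/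
def DecaysTo (s : ℝ) (f : ℂ → E) : Prop :=
  ContDiff ℝ ∞ f ∧ ∀ m : ℕ, ∃ C : ℝ, ∀ z, ‖iteratedFDeriv ℝ m f z‖ ≤ C * (1 + ‖z‖) ^ (-s)

/-- Smooth vector-valued functions which vanish at infinity with all derivatives. -/
def Vanishes (f : ℂ → E) : Prop :=
  ContDiff ℝ ∞ f ∧ ∀ m : ℕ, Filter.Tendsto (iteratedFDeriv ℝ m f) (Filter.cocompact ℂ) (𝓝 0)

theorem norm_iteratedFDeriv_clm_comp_le (L : E →L[ℝ] F) {f : ℂ → E} (hf : ContDiff ℝ ∞ f) (m : ℕ)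
    (z : ℂ) : ‖iteratedFDeriv ℝ m (fun w => L (f w)) z‖ ≤ ‖L‖ * ‖iteratedFDeriv ℝ m f z‖ :=
  L.norm_iteratedFDeriv_comp_left (hf.contDiffAt (x := z)) (by exact_mod_cast le_top)

theorem DecaysTo.clm_comp {s : ℝ} {f : ℂ → E} (hf : DecaysTo s f) (L : E →L[ℝ] F) :
    DecaysTo s fun z => L (f z) := by
  refine ⟨L.contDiff.comp hf.1, fun m => ?_⟩
  obtain ⟨C, hC⟩ := hf.2 m
  refine ⟨‖L‖ * C, fun z => (norm_iteratedFDeriv_clm_comp_le L hf.1 m z).trans ?_⟩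
  rw [mul_assoc]
  exact mul_le_mul_of_nonneg_left (hC z) (norm_nonneg _)

theorem Vanishes.clm_comp {f : ℂ → E} (hf : Vanishes f) (L : E →L[ℝ] F) :
    Vanishes fun z => L (f z) := by
  refine ⟨L.contDiff.comp hf.1, fun m => ?_⟩
  have h := (hf.2 m).norm.const_mul ‖L‖
  rw [norm_zero, mul_zero] at h
  exact squeeze_zero_norm (fun z => norm_iteratedFDeriv_clm_comp_le L hf.1 m z) h

theorem DecaysTo.fderiv {s : ℝ} {f : ℂ → E} (hf : DecaysTo s f) : DecaysTo s (fderiv ℝ f) := by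
  refine ⟨hf.1.fderiv_right (m := ∞) le_rfl, fun m => ?_⟩
  simp only [norm_iteratedFDeriv_fderiv]
  exact hf.2 (m + 1)

theorem Vanishes.fderiv {f : ℂ → E} (hf : Vanishes f) : Vanishes (fderiv ℝ f) := by
  refine ⟨hf.1.fderiv_right (m := ∞) le_rfl, fun m => ?_⟩
  rw [tendsto_zero_iff_norm_tendsto_zero]
  simp only [norm_iteratedFDeriv_fderiv]
  exact tendsto_zero_iff_norm_tendsto_zero.1 (hf.2 (m + 1))

theorem DecaysTo.norm_le {s : ℝ} {f : ℂ → E} (hf : DecaysTo s f) :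
    ∃ C : ℝ, 0 ≤ C ∧ ∀ z, ‖f z‖ ≤ C * (1 + ‖z‖) ^ (-s) := by
  obtain ⟨C, hC⟩ := hf.2 0
  simp only [norm_iteratedFDeriv_zero] at hC
  refine ⟨C, ?_, hC⟩
  have := (norm_nonneg _).trans (hC 0)
  simpa using this

theorem Vanishes.tendsto {f : ℂ → E} (hf : Vanishes f) :
    Filter.Tendsto f (Filter.cocompact ℂ) (𝓝 0) := by
  have h := tendsto_zero_iff_norm_tendsto_zero.1 (hf.2 0)
  simp only [norm_iteratedFDeriv_zero] at h
  exact tendsto_zero_iff_norm_tendsto_zero.2 h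

theorem DecaysTo.add {s : ℝ} {f g : ℂ → E} (hf : DecaysTo s f) (hg : DecaysTo s g) :
    DecaysTo s fun z => f z + g z := by
  refine ⟨hf.1.add hg.1, fun m => ?_⟩
  obtain ⟨C, hC⟩ := hf.2 m
  obtain ⟨D, hD⟩ := hg.2 m
  refine ⟨C + D, fun z => ?_⟩
  rw [show (fun z => f z + g z) = f + g from rfl, iteratedFDeriv_add_apply
    (hf.1.of_le (by exact_mod_cast le_top)).contDiffAt
    (hg.1.of_le (by exact_mod_cast le_top)).contDiffAt, add_mul]
  exact (norm_add_le _ _).trans (add_le_add (hC z) (hD z))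

theorem Vanishes.add {f g : ℂ → E} (hf : Vanishes f) (hg : Vanishes g) :
    Vanishes fun z => f z + g z := by
  refine ⟨hf.1.add hg.1, fun m => ?_⟩
  have h := (hf.2 m).add (hg.2 m)
  rw [add_zero] at h
  refine h.congr fun z => ?_
  rw [show (fun z => f z + g z) = f + g from rfl, iteratedFDeriv_add_apply
    (hf.1.of_le (by exact_mod_cast le_top)).contDiffAt
    (hg.1.of_le (by exact_mod_cast le_top)).contDiffAt]

/-- Exponent `0` means boundedness with all derivatives. In this class the coefficients already
constructed re-enter the recursion, together with the constant leading one. -/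
theorem Vanishes.decaysTo_zero {f : ℂ → E} (hf : Vanishes f) : DecaysTo 0 f := by
  refine ⟨hf.1, fun m => ?_⟩
  have hcont : Continuous (iteratedFDeriv ℝ m f) :=
    hf.1.continuous_iteratedFDeriv (by exact_mod_cast le_top)
  obtain ⟨s, hs, hs'⟩ := Metric.exists_isBounded_image_of_tendsto (hf.2 m)
  obtain ⟨t, ht, hts⟩ := Filter.mem_cocompact.1 hs
  obtain ⟨C, hC⟩ := ((ht.image hcont).isBounded.union hs').exists_norm_le
  refine ⟨C, fun z => ?_⟩
  simp only [neg_zero, Real.rpow_zero, mul_one]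
  refine hC _ ?_
  by_cases hz : z ∈ t
  · exact Or.inl ⟨z, hz, rfl⟩
  · exact Or.inr ⟨z, hts hz, rfl⟩

theorem decaysTo_const (c : E) : DecaysTo 0 fun _ : ℂ => c := by
  refine ⟨contDiff_const, fun m => ?_⟩
  rcases m with _ | m
  · exact ⟨‖c‖, fun z => by simp⟩
  · exact ⟨0, fun z => by simp [iteratedFDeriv_const_of_ne (Nat.succ_ne_zero m)]⟩

theorem vanishes_zero : Vanishes fun _ : ℂ => (0 : E) := by
  refine ⟨contDiff_const, fun m => ?_⟩
  have h : iteratedFDeriv ℝ m (fun _ : ℂ => (0 : E)) = 0 := iteratedFDeriv_fun_zero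
  rw [h]
  exact tendsto_const_nhds

theorem DecaysTo.vanishes {s : ℝ} (hs : 0 < s) {f : ℂ → E} (hf : DecaysTo s f) : Vanishes f := by
  refine ⟨hf.1, fun m => ?_⟩
  obtain ⟨C, hC⟩ := hf.2 m
  refine squeeze_zero_norm hC ?_
  have h1 : Filter.Tendsto (fun z : ℂ => 1 + ‖z‖) (Filter.cocompact ℂ) Filter.atTop :=
    Filter.tendsto_atTop_add_const_left _ _ (tendsto_norm_cocompact_atTop)
  have h2 := ((tendsto_rpow_neg_atTop hs).comp h1).const_mul C
  rwa [mul_zero] at h2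

end Classes

section Scalar

variable {s r : ℝ} {f g : ℂ → ℂ}

theorem Decays.decaysTo (hf : Decays s f) : DecaysTo s f := hf

theorem DecaysTo.mul (hf : DecaysTo s f) (hg : DecaysTo r g) :
    DecaysTo (s + r) fun z => f z * g z := by
  refine ⟨hf.1.mul hg.1, fun m => ?_⟩
  choose C hC using hf.2
  choose D hD using hg.2
  refine ⟨∑ i ∈ Finset.range (m + 1), (m.choose i : ℝ) * C i * D (m - i), fun z =>
    (norm_iteratedFDeriv_mul_le hf.1 hg.1 z (by exact_mod_cast le_top)).trans ?_⟩
  rw [Finset.sum_mul]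
  refine Finset.sum_le_sum fun i _ => ?_
  have h1 : (0 : ℝ) < 1 + ‖z‖ := by positivity
  calc (m.choose i : ℝ) * ‖iteratedFDeriv ℝ i f z‖ * ‖iteratedFDeriv ℝ (m - i) g z‖
      ≤ (m.choose i : ℝ) * (C i * (1 + ‖z‖) ^ (-s)) * (D (m - i) * (1 + ‖z‖) ^ (-r)) := by
        have h2 := (norm_nonneg _).trans (hC i z)
        gcongr
        · exact hC i z
        · exact hD (m - i) z
    _ = _ := by
        rw [neg_add, Real.rpow_add h1]
        ring

theorem DecaysTo.const_mul (c : ℂ) (hf : DecaysTo s f) : DecaysTo s fun z => c * f z := by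
  simpa using (decaysTo_const c).mul hf

theorem DecaysTo.conj (hf : DecaysTo s f) : DecaysTo s fun z => conj (f z) :=
  hf.clm_comp (Complex.conjCLE : ℂ →L[ℝ] ℂ)

theorem Vanishes.conj (hf : Vanishes f) : Vanishes fun z => conj (f z) :=
  hf.clm_comp (Complex.conjCLE : ℂ →L[ℝ] ℂ)

theorem Vanishes.const_mul (c : ℂ) (hf : Vanishes f) : Vanishes fun z => c * f z :=
  hf.clm_comp (ContinuousLinearMap.mul ℝ ℂ c)

/-- The Wirtinger derivatives as functions of the differential. -/
def wirtinger (c : ℂ) : (ℂ →L[ℝ] ℂ) →L[ℝ] ℂ :=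
  (ContinuousLinearMap.mul ℝ ℂ (1 / 2)).comp (ContinuousLinearMap.apply ℝ ℂ (1 : ℂ) +
    (ContinuousLinearMap.mul ℝ ℂ c).comp (ContinuousLinearMap.apply ℝ ℂ Complex.I))

theorem dz_eq_wirtinger (f : ℂ → ℂ) : dz f = fun z => wirtinger (-Complex.I) (fderiv ℝ f z) := by
  funext z
  simp [dz, wirtinger, sub_eq_add_neg, mul_add]

theorem dzbar_eq_wirtinger (f : ℂ → ℂ) :
    dzbar f = fun z => wirtinger Complex.I (fderiv ℝ f z) := by
  funext z
  simp [dzbar, wirtinger, mul_add]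

theorem DecaysTo.dz (hf : DecaysTo s f) : DecaysTo s (dz f) := by
  rw [dz_eq_wirtinger]
  exact hf.fderiv.clm_comp _

theorem DecaysTo.dzbar (hf : DecaysTo s f) : DecaysTo s (dzbar f) := by
  rw [dzbar_eq_wirtinger]
  exact hf.fderiv.clm_comp _

theorem Vanishes.dz (hf : Vanishes f) : Vanishes (dz f) := by
  rw [dz_eq_wirtinger]
  exact hf.fderiv.clm_comp _

theorem Vanishes.dzbar (hf : Vanishes f) : Vanishes (dzbar f) := by
  rw [dzbar_eq_wirtinger]
  exact hf.fderiv.clm_comp _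

/-- The hypothesis is the Cauchy–Riemann equation, and an entire function tending to zero at
infinity is zero by Liouville's theorem. -/
theorem Vanishes.eq_zero_of_dzbar (hf : Vanishes f) (h : ∀ z, DSII.dzbar f z = 0) (z : ℂ) :
    f z = 0 := by
  refine Differentiable.apply_eq_of_tendsto_cocompact (fun w => ?_) z hf.tendsto
  refine differentiableAt_complex_iff_differentiableAt_real.2
    ⟨hf.1.differentiable (by simp) w, ?_⟩
  have h1 : _root_.fderiv ℝ f w 1 + Complex.I * _root_.fderiv ℝ f w Complex.I = 0 :=
    (mul_eq_zero.1 (h w)).resolve_left (by norm_num)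
  rw [smul_eq_mul]
  linear_combination -Complex.I * h1 + _root_.fderiv ℝ f w Complex.I * Complex.I_mul_I

theorem Vanishes.eq_zero_of_dz (hf : Vanishes f) (h : ∀ z, DSII.dz f z = 0) (z : ℂ) :
    f z = 0 := by
  have := hf.conj.eq_zero_of_dzbar (fun w => by rw [dzbar_conj, h, map_zero]) z
  simpa using this

end Scalar

/-! ### The Cauchy transform of decaying functions -/

section Cauchy

open MeasureTheory Filter Set

theorem integrable_one_add_norm_complex {r : ℝ} (hr : 2 < r) :
    Integrable fun w : ℂ => (1 + ‖w‖) ^ (-r) :=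
  integrable_one_add_norm (by simpa [Complex.finrank_real_complex] using hr)

theorem integrable_indicator_norm_inv :
    Integrable ((Metric.ball (0 : ℂ) 1).indicator fun w : ℂ => ‖w‖⁻¹) := by
  rw [integrable_indicator_iff measurableSet_ball,
    integrableOn_fun_norm_addHaar (E := ℂ) volume (f := fun y : ℝ => y⁻¹)]
  refine IntegrableOn.congr_fun (f := fun _ => (1 : ℝ)) (by simp) (fun y hy => ?_) measurableSet_Ioo
  have : y ≠ 0 := hy.1.ne'
  simp [Complex.finrank_real_complex, this]

/-- Separates the singularity of `1/w`, integrable on the unit disc, from the tail, where `1/|w| ≤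
1` and integrability comes from `b`. -/
theorem norm_inv_mul_le (w : ℂ) {b : ℝ} (hb : 0 ≤ b) (hb' : b ≤ 1) :
    ‖w‖⁻¹ * b ≤ (Metric.ball (0 : ℂ) 1).indicator (fun w : ℂ => ‖w‖⁻¹) w + b := by
  by_cases hw : w ∈ Metric.ball (0 : ℂ) 1
  · rw [indicator_of_mem hw]
    have : ‖w‖⁻¹ * b ≤ ‖w‖⁻¹ * 1 := mul_le_mul_of_nonneg_left hb' (by positivity)
    linarith
  · rw [indicator_of_notMem hw, zero_add]
    have h1 : 1 ≤ ‖w‖ := by simpa using hw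
    exact mul_le_of_le_one_left hb (inv_le_one_of_one_le₀ h1)

theorem integrable_norm_inv_mul {r : ℝ} (hr : 2 < r) (z : ℂ) :
    Integrable fun w : ℂ => ‖w‖⁻¹ * (1 + ‖z - w‖) ^ (-r) := by
  have h1 : Integrable fun w : ℂ => (1 + ‖z - w‖) ^ (-r) :=
    (integrable_one_add_norm_complex hr).comp_sub_left z
  refine (integrable_indicator_norm_inv.add h1).mono' ?_ (Eventually.of_forall fun w => ?_)
  · exact (measurable_norm.inv).aestronglyMeasurable.mul h1.aestronglyMeasurable
  · rw [Real.norm_of_nonneg (by positivity)]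
    exact norm_inv_mul_le w (by positivity)
      (Real.rpow_le_one_of_one_le_of_nonpos (by linarith [norm_nonneg (z - w)]) (by linarith))

variable {E : Type} [NormedAddCommGroup E] [NormedSpace ℝ E]

/-- The convolution of `f` with a real kernel. -/
def kernelTransform (k : ℂ → ℝ) (f : ℂ → E) (z : ℂ) : E := ∫ w, k w • f (z - w)

variable {k : ℂ → ℝ} {r : ℝ} {f : ℂ → E}

theorem DecaysTo.aestronglyMeasurable_kernel (hf : DecaysTo r f) (hk : Measurable k) (z : ℂ) :
    AEStronglyMeasurable (fun w => k w • f (z - w)) :=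
  hk.aestronglyMeasurable.smul
    (hf.1.continuous.comp (continuous_const.sub continuous_id)).aestronglyMeasurable

theorem DecaysTo.integrable_kernel (hf : DecaysTo r f) (hr : 2 < r) (hk : Measurable k)
    (hk' : ∀ w, |k w| ≤ ‖w‖⁻¹) (z : ℂ) : Integrable fun w => k w • f (z - w) := by
  obtain ⟨C, hC, hfC⟩ := hf.norm_le
  refine ((integrable_norm_inv_mul hr z).const_mul C).mono'
    (hf.aestronglyMeasurable_kernel hk z) (Eventually.of_forall fun w => ?_)
  rw [norm_smul, Real.norm_eq_abs]
  calc |k w| * ‖f (z - w)‖ ≤ ‖w‖⁻¹ * (C * (1 + ‖z - w‖) ^ (-r)) :=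
        mul_le_mul (hk' w) (hfC _) (norm_nonneg _) (by positivity)
    _ = _ := by ring

/-- In the form `∫ k(w) f(z - w)` the derivative falls on `f` only, so the singularity of the kernel
is never differentiated. -/
theorem DecaysTo.hasFDerivAt_kernelTransform (hf : DecaysTo r f) (hr : 2 < r) (hk : Measurable k)
    (hk' : ∀ w, |k w| ≤ ‖w‖⁻¹) (z : ℂ) :
    HasFDerivAt (kernelTransform k f) (kernelTransform k (_root_.fderiv ℝ f) z) z := by
  obtain ⟨C, hC, hfC⟩ := hf.fderiv.norm_le
  refine hasFDerivAt_integral_of_dominated_of_fderiv_le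
    (bound := fun w => C * 2 ^ r * (‖w‖⁻¹ * (1 + ‖z - w‖) ^ (-r)))
    (F' := fun x w => k w • _root_.fderiv ℝ f (x - w)) (Metric.ball_mem_nhds z one_pos)
    (Eventually.of_forall fun x => hf.aestronglyMeasurable_kernel hk x)
    (hf.integrable_kernel hr hk hk' z) (hf.fderiv.aestronglyMeasurable_kernel hk z)
    (Eventually.of_forall fun w x hx => ?_) ((integrable_norm_inv_mul hr z).const_mul _)
    (Eventually.of_forall fun w x _ => ?_)
  -- Moving the base point within a unit ball changes `1 + ‖z - w‖` by a factor of at most `2`,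
  -- whence the constant `2 ^ r` in the dominating function.
  · have h1 : 1 + ‖z - w‖ ≤ 2 * (1 + ‖x - w‖) := by
      have h2 : ‖z - w‖ ≤ ‖x - z‖ + ‖x - w‖ := by
        rw [norm_sub_rev x z]
        simpa using norm_add_le (z - x) (x - w)
      have h3 : ‖x - z‖ < 1 := by simpa [dist_eq_norm] using hx
      linarith [norm_nonneg (x - w)]
    have h4 : (1 + ‖x - w‖) ^ (-r) ≤ 2 ^ r * (1 + ‖z - w‖) ^ (-r) := by
      rw [Real.rpow_neg (by positivity), Real.rpow_neg (by positivity), ← div_eq_mul_inv,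
        inv_le_comm₀ (by positivity) (by positivity), inv_div, div_le_iff₀ (by positivity),
        ← Real.mul_rpow (by positivity) (by positivity)]
      exact Real.rpow_le_rpow (by positivity) (by linarith) (by linarith)
    rw [norm_smul, Real.norm_eq_abs]
    calc |k w| * ‖_root_.fderiv ℝ f (x - w)‖
        ≤ ‖w‖⁻¹ * (C * (2 ^ r * (1 + ‖z - w‖) ^ (-r))) :=
          mul_le_mul (hk' w) ((hfC _).trans (mul_le_mul_of_nonneg_left h4 hC)) (norm_nonneg _)
            (by positivity)
      _ = _ := by ring
  · have h1 : HasFDerivAt (fun x => x - w) (ContinuousLinearMap.id ℝ ℂ) x :=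
      (hasFDerivAt_id x).sub_const w
    have h2 := ((hf.1.differentiable (by simp)) (x - w)).hasFDerivAt.comp x h1
    exact h2.const_smul (k w)

/-- The kernel is cut at the unit circle. Near the origin it is integrable and `f(z - w)` tends to
zero. Far from the origin the substitution `v = z - w` puts `z` into a kernel that is bounded by `1`
and tends to zero, while `f` is integrable. Both parts go by dominated convergence. -/
theorem DecaysTo.tendsto_kernelTransform (hf : DecaysTo r f) (hr : 2 < r) (hk : Measurable k)
    (hk' : ∀ w, |k w| ≤ ‖w‖⁻¹) : Tendsto (kernelTransform k f) (cocompact ℂ) (𝓝 0) := by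
  have : (cocompact ℂ).IsCountablyGenerated := by
    rw [← Metric.cobounded_eq_cocompact, ← comap_norm_atTop]
    infer_instance
  obtain ⟨C, hC, hfC⟩ := hf.norm_le
  have hf0 := (hf.vanishes (by linarith)).tendsto
  have hsub : ∀ w : ℂ, Tendsto (fun z : ℂ => z - w) (cocompact ℂ) (cocompact ℂ) := fun w =>
    (Homeomorph.subRight w).isClosedEmbedding.tendsto_cocompact
  set B := Metric.ball (0 : ℂ) 1
  have hB : MeasurableSet B := measurableSet_ball
  have hmem : ∀ w : ℂ, w ∉ B → 1 ≤ ‖w‖ := fun w hw => by simpa [B] using hw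
  have hfle : ∀ w, ‖f w‖ ≤ C := fun w => (hfC w).trans <| mul_le_of_le_one_right hC
    (Real.rpow_le_one_of_one_le_of_nonpos (by linarith [norm_nonneg w]) (by linarith))
  have near : Tendsto (fun z => ∫ w, B.indicator (fun w => k w • f (z - w)) w) (cocompact ℂ)
      (𝓝 (∫ _ : ℂ, (0 : E))) := by
    refine tendsto_integral_filter_of_dominated_convergence
      (fun w => C * B.indicator (fun w : ℂ => ‖w‖⁻¹) w)
      (Eventually.of_forall fun z => (hf.aestronglyMeasurable_kernel hk z).indicator hB)
      (Eventually.of_forall fun z => Eventually.of_forall fun w => ?_)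
      (integrable_indicator_norm_inv.const_mul C) (Eventually.of_forall fun w => ?_)
    · by_cases hw : w ∈ B
      · rw [indicator_of_mem hw, indicator_of_mem hw, norm_smul, Real.norm_eq_abs, mul_comm]
        exact mul_le_mul (hfle _) (hk' w) (abs_nonneg _) hC
      · rw [indicator_of_notMem hw, indicator_of_notMem hw]
        simp
    · by_cases hw : w ∈ B
      · simp only [indicator_of_mem hw]
        simpa using (hf0.comp (hsub w)).const_smul (k w)
      · simp only [indicator_of_notMem hw]
        exact tendsto_const_nhds
  have far : Tendsto (fun z => ∫ v, Bᶜ.indicator k (z - v) • f v) (cocompact ℂ)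
      (𝓝 (∫ _ : ℂ, (0 : E))) := by
    have hle : ∀ w, |Bᶜ.indicator k w| ≤ ‖w‖⁻¹ ∧ |Bᶜ.indicator k w| ≤ 1 := fun w => by
      by_cases hw : w ∈ B
      · rw [indicator_of_notMem (by simpa using hw)]
        simp
      · rw [indicator_of_mem (by simpa using hw)]
        exact ⟨hk' w, (hk' w).trans (inv_le_one_of_one_le₀ (hmem w hw))⟩
    refine tendsto_integral_filter_of_dominated_convergence
      (fun v => C * (1 + ‖v‖) ^ (-r))
      (Eventually.of_forall fun z => ?_)
      (Eventually.of_forall fun z => Eventually.of_forall fun v => ?_)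
      ((integrable_one_add_norm_complex hr).const_mul C) (Eventually.of_forall fun v => ?_)
    · exact ((hk.indicator hB.compl).comp
        (measurable_const.sub measurable_id)).aestronglyMeasurable.smul
        hf.1.continuous.aestronglyMeasurable
    · rw [norm_smul, Real.norm_eq_abs]
      exact (mul_le_of_le_one_left (norm_nonneg _) (hle _).2).trans (hfC v)
    · have h1 : Tendsto (fun w : ℂ => ‖w‖⁻¹) (cocompact ℂ) (𝓝 0) :=
        tendsto_inv_atTop_zero.comp tendsto_norm_cocompact_atTop
      have h2 : Tendsto (fun w => Bᶜ.indicator k w) (cocompact ℂ) (𝓝 0) :=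
        squeeze_zero_norm (fun w => (hle w).1) h1
      simpa using (h2.comp (hsub v)).smul_const (f v)
  have h := near.add far
  simp only [integral_zero, add_zero] at h
  refine h.congr fun z => ?_
  have hint := hf.integrable_kernel hr hk hk' z
  have h1 : ∫ v, Bᶜ.indicator k (z - v) • f v =
      ∫ w, Bᶜ.indicator (fun w => k w • f (z - w)) w := by
    rw [← integral_sub_left_eq_self _ volume z]
    refine integral_congr_ae (Eventually.of_forall fun w => ?_)
    by_cases hw : w ∈ B
    · have : w ∉ Bᶜ := by simpa using hw
      simp [this]
    · have : w ∈ Bᶜ := by simpa using hw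
      simp [this]
  rw [h1, ← integral_add (hint.indicator hB) (hint.indicator hB.compl), kernelTransform]
  refine integral_congr_ae (Eventually.of_forall fun w => ?_)
  by_cases hw : w ∈ B
  · have : w ∉ Bᶜ := by simpa using hw
    simp [this, hw]
  · have : w ∈ Bᶜ := by simpa using hw
    simp [this, hw]

theorem fderiv_kernelTransform (hf : DecaysTo r f) (hr : 2 < r) (hk : Measurable k)
    (hk' : ∀ w, |k w| ≤ ‖w‖⁻¹) :
    fderiv ℝ (kernelTransform k f) = kernelTransform k (fderiv ℝ f) :=
  funext fun z => (hf.hasFDerivAt_kernelTransform hr hk hk' z).fderiv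

theorem DecaysTo.vanishes_kernelTransform (hf : DecaysTo r f) (hr : 2 < r) (hk : Measurable k)
    (hk' : ∀ w, |k w| ≤ ‖w‖⁻¹) : Vanishes (kernelTransform k f) := by
  -- The derivative of the transform is the transform of `fderiv ℝ f`, which has values in another
  -- space; the induction on the order must therefore range over all target spaces. This is also why
  -- the kernel is real-valued: it acts on every real normed space.
  have key : ∀ (m : ℕ) (E : Type) [NormedAddCommGroup E] [NormedSpace ℝ E] (f : ℂ → E),
      DecaysTo r f → ContDiff ℝ m (kernelTransform k f) ∧
        Tendsto (fun z => ‖iteratedFDeriv ℝ m (kernelTransform k f) z‖) (cocompact ℂ) (𝓝 0) := by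
    intro m
    induction m with
    | zero =>
      intro E _ _ f hf
      simp only [norm_iteratedFDeriv_zero]
      refine ⟨?_, by simpa using (hf.tendsto_kernelTransform hr hk hk').norm⟩
      exact contDiff_zero.2 (continuous_iff_continuousAt.2 fun z =>
        (hf.hasFDerivAt_kernelTransform hr hk hk' z).continuousAt)
    | succ m ih =>
      intro E _ _ f hf
      obtain ⟨h1, h2⟩ := ih _ _ hf.fderiv
      simp only [← norm_iteratedFDeriv_fderiv, fderiv_kernelTransform hf hr hk hk']
      refine ⟨?_, h2⟩
      rw [Nat.cast_succ]
      exact contDiff_succ_iff_hasFDerivAt.2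
        ⟨_, h1, hf.hasFDerivAt_kernelTransform hr hk hk'⟩
  exact ⟨contDiff_infty.2 fun m => (key m E f hf).1,
    fun m => tendsto_zero_iff_norm_tendsto_zero.2 (key m E f hf).2⟩

end Cauchy

/-! ### The inhomogeneous Cauchy–Riemann equation -/

section CauchyRiemann

open MeasureTheory Filter Set

theorem realLinear_apply (D : ℂ →L[ℝ] ℂ) (v : ℂ) :
    D v = (1 / 2 : ℂ) * (D 1 - Complex.I * D Complex.I) * v +
      (1 / 2 : ℂ) * (D 1 + Complex.I * D Complex.I) * conj v := by
  have h : D v = (v.re : ℂ) * D 1 + (v.im : ℂ) * D Complex.I := by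
    conv_lhs => rw [show v = v.re • (1 : ℂ) + v.im • Complex.I by simp]
    rw [map_add, map_smul, map_smul]
    simp
  rw [h]
  have hc : conj v = (v.re : ℂ) - v.im * Complex.I := by
    apply Complex.ext <;> simp
  rw [hc]
  have hv : (v : ℂ) = v.re + v.im * Complex.I := (Complex.re_add_im v).symm
  generalize v.re = x at *
  generalize v.im = y at *
  rw [hv]
  linear_combination (y : ℂ) * D Complex.I * Complex.I_mul_I

/-- The point `e^{iθ}` of the unit circle. -/
def circlePoint (θ : ℝ) : ℂ := Complex.exp (θ * Complex.I)

theorem norm_circlePoint (θ : ℝ) : ‖circlePoint θ‖ = 1 := Complex.norm_exp_ofReal_mul_I θ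

theorem continuous_circlePoint : Continuous circlePoint := by
  unfold circlePoint
  fun_prop

theorem hasDerivAt_circlePoint (θ : ℝ) :
    HasDerivAt circlePoint (Complex.I * circlePoint θ) θ := by
  have h : HasDerivAt (fun θ : ℝ => (θ : ℂ) * Complex.I) Complex.I θ := by
    simpa using (Complex.ofRealCLM.hasDerivAt (x := θ)).mul_const Complex.I
  have h2 := h.cexp
  rw [mul_comm] at h2
  exact h2

theorem inv_circlePoint (θ : ℝ) : (circlePoint θ)⁻¹ = conj (circlePoint θ) := by
  rw [Complex.inv_def, Complex.normSq_eq_norm_sq, norm_circlePoint]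
  simp

variable {r : ℝ} {f : ℂ → ℂ}

/-- From `1 + |ρ| ≤ (1 + |z|)(1 + |z - ρe^{iθ}|)`; the bound is uniform in the angle and in the unit
direction. -/
theorem DecaysTo.polar_bound (hf : DecaysTo r f) (hr : 0 < r) (z : ℂ) :
    ∃ C : ℝ, ∀ (ρ θ : ℝ) (v : ℂ), ‖v‖ = 1 →
      ‖_root_.fderiv ℝ f (z - ρ * circlePoint θ) v‖ ≤ C * (1 + ‖ρ‖) ^ (-r) := by
  obtain ⟨C, hC, hfC⟩ := hf.fderiv.norm_le
  refine ⟨C * (1 + ‖z‖) ^ r, fun ρ θ v hv => ?_⟩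
  set ζ := z - ρ * circlePoint θ
  have h1 : ‖ρ‖ ≤ ‖z‖ + ‖ζ‖ := by
    have : ‖(ρ : ℂ) * circlePoint θ‖ = ‖ρ‖ := by rw [norm_mul, norm_circlePoint, mul_one]; simp
    rw [← this]
    have h2 : (ρ : ℂ) * circlePoint θ = z - ζ := by simp [ζ]
    rw [h2]
    exact norm_sub_le _ _
  have h3 : 1 + ‖ρ‖ ≤ (1 + ‖z‖) * (1 + ‖ζ‖) := by nlinarith [norm_nonneg z, norm_nonneg ζ]
  have h4 : (1 + ‖ζ‖) ^ (-r) ≤ (1 + ‖z‖) ^ r * (1 + ‖ρ‖) ^ (-r) := by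
    rw [Real.rpow_neg (by positivity), Real.rpow_neg (by positivity), ← div_eq_mul_inv,
      inv_le_comm₀ (by positivity) (by positivity), inv_div, div_le_iff₀ (by positivity),
      ← Real.mul_rpow (by positivity) (by positivity)]
    exact Real.rpow_le_rpow (by positivity) (by linarith) hr.le
  calc ‖_root_.fderiv ℝ f ζ v‖ ≤ ‖_root_.fderiv ℝ f ζ‖ * ‖v‖ :=
        ContinuousLinearMap.le_opNorm _ _
    _ ≤ C * ((1 + ‖z‖) ^ r * (1 + ‖ρ‖) ^ (-r)) := by
        rw [hv, mul_one]
        exact (hfC ζ).trans (mul_le_mul_of_nonneg_left h4 hC)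
    _ = _ := by ring

/-- The Jacobian `ρ` cancels `1/|w|`, so decay faster than `1/ρ` in one variable is enough here. -/
theorem DecaysTo.integrable_polar (hf : DecaysTo r f) (hr : 1 < r) (z : ℂ) {v : ℝ → ℂ}
    (hv : Continuous v) (hv' : ∀ θ, ‖v θ‖ = 1) :
    Integrable (fun x : ℝ × ℝ => _root_.fderiv ℝ f (z - x.1 * circlePoint x.2) (v x.2))
      ((volume.restrict (Ioi (0 : ℝ))).prod (volume.restrict (Ioo (-Real.pi) Real.pi))) := by
  obtain ⟨C, hC⟩ := hf.polar_bound (by linarith) z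
  have h1 : Integrable (fun ρ : ℝ => C * (1 + ‖ρ‖) ^ (-r)) (volume.restrict (Ioi (0 : ℝ))) :=
    ((integrable_one_add_norm (by simpa using hr)).const_mul C).restrict
  have h2 : Integrable (fun _ : ℝ => (1 : ℝ)) (volume.restrict (Ioo (-Real.pi) Real.pi)) := by
    simp
  refine (h1.mul_prod h2).mono' ?_ (Eventually.of_forall fun x => ?_)
  · refine Continuous.aestronglyMeasurable ?_
    refine (hf.1.continuous_fderiv (by simp)).comp ?_ |>.clm_apply (hv.comp continuous_snd)
    exact continuous_const.sub ((Complex.continuous_ofReal.comp continuous_fst).mul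
      (continuous_circlePoint.comp continuous_snd))
  · rw [mul_one]
    exact hC _ _ _ (hv' _)

/-- The integrand is the derivative of `-f(z - ρe^{iθ})` along a ray, and `f` vanishes at infinity.
-/
theorem DecaysTo.integral_radial (hf : DecaysTo r f) (hr : 1 < r) (z : ℂ) (θ : ℝ) :
    ∫ ρ in Ioi (0 : ℝ), _root_.fderiv ℝ f (z - ρ * circlePoint θ) (circlePoint θ) = f z := by
  have hd : ∀ ρ : ℝ, HasDerivAt (fun ρ : ℝ => -f (z - ρ * circlePoint θ))
      (_root_.fderiv ℝ f (z - ρ * circlePoint θ) (circlePoint θ)) ρ := fun ρ => by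
    have h1 : HasDerivAt (fun ρ : ℝ => z - (ρ : ℂ) * circlePoint θ) (-circlePoint θ) ρ := by
      simpa using ((Complex.ofRealCLM.hasDerivAt (x := ρ)).mul_const (circlePoint θ)).const_sub z
    have h2 := ((hf.1.differentiable (by simp)
      (z - ρ * circlePoint θ)).hasFDerivAt.comp_hasDerivAt ρ h1).neg
    simp only [map_neg, neg_neg] at h2
    exact h2
  have hlim : Tendsto (fun ρ : ℝ => -f (z - ρ * circlePoint θ)) atTop (𝓝 0) := by
    have h1 : Tendsto (fun ρ : ℝ => z - (ρ : ℂ) * circlePoint θ) atTop (cocompact ℂ) := by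
      rw [← Metric.cobounded_eq_cocompact, ← tendsto_norm_atTop_iff_cobounded]
      refine tendsto_atTop_mono (f := fun ρ : ℝ => ρ - ‖z‖) (fun ρ => ?_)
        (tendsto_atTop_add_const_right _ _ tendsto_id)
      have h2 : ‖(ρ : ℂ) * circlePoint θ‖ = |ρ| := by
        rw [norm_mul, norm_circlePoint, mul_one]
        simp
      have h3 := norm_sub_norm_le ((ρ : ℂ) * circlePoint θ) z
      rw [norm_sub_rev, h2] at h3
      linarith [le_abs_self ρ]
    simpa using ((hf.vanishes (by linarith)).tendsto.comp h1).neg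
  obtain ⟨C, hC⟩ := hf.polar_bound (by linarith) z
  have hint : IntegrableOn (fun ρ : ℝ =>
      _root_.fderiv ℝ f (z - ρ * circlePoint θ) (circlePoint θ)) (Ioi 0) := by
    refine (((integrable_one_add_norm (by simpa using hr)).const_mul C).restrict).mono' ?_
      (Eventually.of_forall fun ρ => hC ρ θ _ (norm_circlePoint θ))
    refine Continuous.aestronglyMeasurable ?_
    refine (hf.1.continuous_fderiv (by simp)).comp ?_ |>.clm_apply continuous_const
    exact continuous_const.sub (Complex.continuous_ofReal.mul continuous_const)
  rw [integral_Ioi_of_hasDerivAt_of_tendsto' (fun ρ _ => hd ρ) hint hlim]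
  simp

/-- Up to the factor `-ρ`, the integrand is the derivative in `θ` of the `2π`-periodic function `f(z
- ρe^{iθ})`. -/
theorem integral_angular (hf : ContDiff ℝ ∞ f) (z : ℂ) {ρ : ℝ} (hρ : ρ ≠ 0) :
    ∫ θ in Ioo (-Real.pi) Real.pi,
      fderiv ℝ f (z - ρ * circlePoint θ) (Complex.I * circlePoint θ) = 0 := by
  have hd : ∀ θ : ℝ, HasDerivAt (fun θ : ℝ => (-(ρ : ℂ)⁻¹) * f (z - ρ * circlePoint θ))
      (fderiv ℝ f (z - ρ * circlePoint θ) (Complex.I * circlePoint θ)) θ := fun θ => by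
    have h1 : HasDerivAt (fun θ : ℝ => z - (ρ : ℂ) * circlePoint θ)
        (-((ρ : ℂ) * (Complex.I * circlePoint θ))) θ :=
      ((hasDerivAt_circlePoint θ).const_mul (ρ : ℂ)).const_sub z
    have h2 := ((hf.differentiable (by simp)
      (z - ρ * circlePoint θ)).hasFDerivAt.comp_hasDerivAt θ h1).const_mul (-(ρ : ℂ)⁻¹)
    have h3 : ∀ v : ℂ, fderiv ℝ f (z - ρ * circlePoint θ) (ρ * v) =
        ρ * fderiv ℝ f (z - ρ * circlePoint θ) v := fun v => by
      rw [← Complex.real_smul (z := v), map_smul, Complex.real_smul]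
    rw [map_neg, h3] at h2
    have h4 : (ρ : ℂ) ≠ 0 := by exact_mod_cast hρ
    rw [mul_neg, neg_mul, neg_neg, ← mul_assoc, inv_mul_cancel₀ h4, one_mul] at h2
    exact h2
  have hcont : Continuous fun θ : ℝ =>
      fderiv ℝ f (z - ρ * circlePoint θ) (Complex.I * circlePoint θ) := by
    refine (hf.continuous_fderiv (by simp)).comp ?_ |>.clm_apply
      (continuous_const.mul continuous_circlePoint)
    exact continuous_const.sub (continuous_const.mul continuous_circlePoint)
  rw [← integral_Ioc_eq_integral_Ioo, ← intervalIntegral.integral_of_le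
    (by linarith [Real.pi_pos]), intervalIntegral.integral_eq_sub_of_hasDerivAt
    (fun θ _ => hd θ) (hcont.intervalIntegrable _ _)]
  have : circlePoint Real.pi = circlePoint (-Real.pi) := by
    simp [circlePoint, Complex.exp_neg]
  rw [this, sub_self]

/-- The Cauchy–Pompeiu formula on the whole plane. -/
theorem DecaysTo.integral_inv_mul_dzbar (hf : DecaysTo r f) (hr : 1 < r) (z : ℂ) :
    ∫ w, w⁻¹ * DSII.dzbar f (z - w) = Real.pi * f z := by
  rw [← Complex.integral_comp_polarCoord_symm, polarCoord_target]
  -- In polar coordinates `e^{-iθ} ∂̄f` is half of the derivative in the direction `e^{iθ}` plus `i`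
  -- times the one in the direction `ie^{iθ}`. The first integrates to `f(z)` along each ray, the
  -- second to zero on each circle.
  have h1 : ∀ x ∈ Ioi (0 : ℝ) ×ˢ Ioo (-Real.pi) Real.pi,
      x.1 • ((Complex.polarCoord.symm x)⁻¹ * DSII.dzbar f (z - Complex.polarCoord.symm x)) =
        (1 / 2 : ℂ) * (_root_.fderiv ℝ f (z - x.1 * circlePoint x.2) (circlePoint x.2) +
          Complex.I * _root_.fderiv ℝ f (z - x.1 * circlePoint x.2)
            (Complex.I * circlePoint x.2)) := by
    rintro ⟨ρ, θ⟩ hx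
    have hρ : (ρ : ℂ) ≠ 0 := by exact_mod_cast (ne_of_gt hx.1)
    have hp : Complex.polarCoord.symm (ρ, θ) = ρ * circlePoint θ := by
      simp [circlePoint, Complex.exp_mul_I]
    rw [hp, mul_inv, inv_circlePoint, Complex.real_smul, ← mul_assoc, ← mul_assoc,
      mul_inv_cancel₀ hρ, one_mul, DSII.dzbar]
    simp only
    set D := _root_.fderiv ℝ f (z - ρ * circlePoint θ)
    have h2 := realLinear_apply D (circlePoint θ)
    have h3 := realLinear_apply D (Complex.I * circlePoint θ)
    rw [map_mul (starRingEnd ℂ), Complex.conj_I] at h3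
    linear_combination -(1 / 2 : ℂ) * h2 - (1 / 2 : ℂ) * Complex.I * h3 -
      (1 / 4 : ℂ) * ((D 1 - Complex.I * D Complex.I) * circlePoint θ -
        (D 1 + Complex.I * D Complex.I) * conj (circlePoint θ)) * Complex.I_mul_I
  rw [setIntegral_congr_fun (measurableSet_Ioi.prod measurableSet_Ioo) h1,
    Measure.volume_eq_prod, ← Measure.prod_restrict]
  have hF := hf.integrable_polar hr z continuous_circlePoint norm_circlePoint
  have hG := hf.integrable_polar hr z (v := fun θ => Complex.I * circlePoint θ)
    (continuous_const.mul continuous_circlePoint) (fun θ => by simp [norm_circlePoint])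
  rw [integral_const_mul, integral_add hF (hG.const_mul _), integral_const_mul,
    integral_prod_symm _ hF, integral_prod _ hG]
  simp only [hf.integral_radial hr z]
  have h2 : ∫ ρ in Ioi (0 : ℝ), ∫ θ in Ioo (-Real.pi) Real.pi,
      _root_.fderiv ℝ f (z - ρ * circlePoint θ) (Complex.I * circlePoint θ) = 0 := by
    rw [setIntegral_congr_fun measurableSet_Ioi
      (fun ρ hρ => integral_angular hf.1 z (ne_of_gt hρ))]
    simp
  rw [h2]
  have h3 : (0 : ℝ) ≤ Real.pi + Real.pi := by linarith [Real.pi_pos]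
  simp [Measure.real, ENNReal.toReal_ofReal h3]
  ring

theorem dzbar_kernelTransform (hf : DecaysTo r f) (hr : 2 < r) {k : ℂ → ℝ} (hk : Measurable k)
    (hk' : ∀ w, |k w| ≤ ‖w‖⁻¹) (z : ℂ) :
    dzbar (kernelTransform k f) z = kernelTransform k (dzbar f) z := by
  rw [dzbar_eq_wirtinger, dzbar_eq_wirtinger, fderiv_kernelTransform hf hr hk hk']
  change wirtinger Complex.I (∫ w, k w • _root_.fderiv ℝ f (z - w)) =
    ∫ w, k w • wirtinger Complex.I (_root_.fderiv ℝ f (z - w))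
  rw [← (wirtinger Complex.I).integral_comp_comm (hf.fderiv.integrable_kernel hr hk hk' z)]
  simp only [map_smul]

/-- Solvability of `u_z̄ = f` for decaying `f`. -/
theorem DecaysTo.exists_dzbar_eq (hf : DecaysTo r f) (hr : 2 < r) :
    ∃ u, Vanishes u ∧ ∀ z, DSII.dzbar u z = f z := by
  have hre : Measurable fun w : ℂ => (w⁻¹).re := Complex.measurable_re.comp measurable_inv
  have him : Measurable fun w : ℂ => (w⁻¹).im := Complex.measurable_im.comp measurable_inv
  have hre' : ∀ w : ℂ, |(w⁻¹).re| ≤ ‖w‖⁻¹ := fun w => by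
    rw [← norm_inv]
    exact Complex.abs_re_le_norm _
  have him' : ∀ w : ℂ, |(w⁻¹).im| ≤ ‖w‖⁻¹ := fun w => by
    rw [← norm_inv]
    exact Complex.abs_im_le_norm _
  have h1 := hf.vanishes_kernelTransform hr hre hre'
  have h2 := (hf.vanishes_kernelTransform hr him him').const_mul Complex.I
  -- The Cauchy transform is assembled from the real kernels `Re(1/w)` and `Im(1/w)`; the factor
  -- `1/π` normalizes the Cauchy–Pompeiu formula.
  refine ⟨_, (h1.add h2).const_mul (Real.pi : ℂ)⁻¹, fun z => ?_⟩
  rw [dzbar_const_mul, dzbar_add (h1.1.differentiable (by simp) z)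
    (h2.1.differentiable (by simp) z), dzbar_const_mul, dzbar_kernelTransform hf hr hre hre',
    dzbar_kernelTransform hf hr him him', kernelTransform, kernelTransform,
    ← integral_const_mul, ← integral_add (hf.dzbar.integrable_kernel hr hre hre' z)
      ((hf.dzbar.integrable_kernel hr him him' z).const_mul _)]
  have h3 : ∀ w : ℂ, (w⁻¹).re • DSII.dzbar f (z - w) +
      Complex.I * ((w⁻¹).im • DSII.dzbar f (z - w)) = w⁻¹ * DSII.dzbar f (z - w) := fun w => by
    conv_rhs => rw [← Complex.re_add_im w⁻¹]
    simp only [Complex.real_smul]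
    ring
  simp only [h3, hf.integral_inv_mul_dzbar (by linarith) z]
  have : (Real.pi : ℂ) ≠ 0 := by exact_mod_cast Real.pi_ne_zero
  field_simp

theorem DecaysTo.exists_dz_eq (hf : DecaysTo r f) (hr : 2 < r) :
    ∃ u, Vanishes u ∧ ∀ z, DSII.dz u z = f z := by
  obtain ⟨u, hu, hu'⟩ := hf.conj.exists_dzbar_eq hr
  exact ⟨_, hu.conj, fun z => by rw [dz_conj, hu', Complex.conj_conj]⟩

end CauchyRiemann

/-! ### Existence and uniqueness of the velocities -/

section Congr

open Finset

variable {R : Type*} [CommRing R] [Algebra ℂ R] (e : Derivation ℂ R R) {n : ℕ} {a a' : ℕ → R}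

theorem diffOp_congr (h : ∀ k ≤ n, a k = a' k) (f : R) : diffOp e n a f = diffOp e n a' f :=
  sum_congr rfl fun k hk => by rw [h k (by have := mem_range.1 hk; omega)]

theorem leftCoeff_congr {k : ℕ} (h : ∀ i, k < i → i ≤ n → a i = a' i) (q : R) :
    leftCoeff e n a q k = leftCoeff e n a' q k :=
  sum_congr rfl fun j hj => by rw [h j (mem_Ioc.1 hj).1 (mem_Ioc.1 hj).2]

theorem compCoeff_congr {k : ℕ} (h : ∀ i, k ≤ i → i ≤ n → a i = a' i) (p : R) :
    compCoeff e n a p k = compCoeff e n a' p k := by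
  refine sum_congr rfl fun j hj => ?_
  rcases lt_or_ge j k with hjk | hjk
  · simp [Nat.choose_eq_zero_of_lt hjk]
  · rw [h j hjk (by have := mem_range.1 hj; omega)]

/-- The right hand side of the equation for the `k`-th coefficient of the operator `A`. -/
def coeffSource (e : Derivation ℂ R R) (n : ℕ) (p q : R) (a : ℕ → R) (k : ℕ) : R :=
  p * leftCoeff e n a q k - compCoeff e n (quotCoeff e n a p) q k

/-- Strict triangularity: the left quotient sums over `j > k`, and the right quotient shifts the
index by one, so only coefficients above `k` enter. -/
theorem coeffSource_congr {k : ℕ} (h : ∀ i, k < i → i ≤ n → a i = a' i) (p q : R) :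
    coeffSource e n p q a k = coeffSource e n p q a' k := by
  have h1 : compCoeff e n (quotCoeff e n a p) q k = compCoeff e n (quotCoeff e n a' p) q k :=
    compCoeff_congr e (fun i hi _ => compCoeff_congr e (fun j hj hjn => h j (by omega) hjn) p) q
  rw [coeffSource, coeffSource, leftCoeff_congr e h, h1]

/-- The equation of top order is `d (a n) = 0`, consistent with a constant leading coefficient. -/
theorem coeffSource_self (p q : R) : coeffSource e n p q a n = 0 := by
  unfold coeffSource
  rw [leftCoeff_self, mul_zero, zero_sub, neg_eq_zero]
  refine sum_eq_zero fun j hj => ?_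
  rcases lt_or_ge j n with hjn | hjn
  · simp [Nat.choose_eq_zero_of_lt hjn]
  · rw [show j = n by have := mem_range.1 hj; omega, quotCoeff_self]
    simp

end Congr

theorem exists_downward_recursion {X : Type*} [Nonempty X] (n : ℕ) (G : ℕ → (ℕ → X) → X)
    (hG : ∀ k a a', (∀ i, k < i → i ≤ n → a i = a' i) → G k a = G k a') :
    ∃ a : ℕ → X, ∀ k ≤ n, a k = G k a := by
  -- The number `m` counts the top indices at which the recursion already holds; the next step
  -- alters only index `n - m`, which the equations above it do not see.
  have h : ∀ m ≤ n + 1, ∃ a : ℕ → X, ∀ k ≤ n, n < k + m → a k = G k a := by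
    intro m
    induction m with
    | zero => exact fun _ => ⟨fun _ => Classical.arbitrary X, fun k hk hk' => by omega⟩
    | succ m ih =>
      intro hm
      obtain ⟨a, ha⟩ := ih (by omega)
      have hagree : ∀ k, n - m ≤ k → ∀ i, k < i → i ≤ n →
          a i = Function.update a (n - m) (G (n - m) a) i := fun k hk i hi _ => by
        rw [Function.update_of_ne (by omega)]
      refine ⟨Function.update a (n - m) (G (n - m) a), fun k hk hkm => ?_⟩
      rw [← hG k _ _ (hagree k (by omega))]
      by_cases hk' : k = n - m
      · rw [hk', Function.update_self]
      · rw [Function.update_of_ne hk']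
        exact ha k hk (by omega)
  obtain ⟨a, ha⟩ := h (n + 1) le_rfl
  exact ⟨a, fun k hk => ha k hk (by omega)⟩

open Smooth

/-- The properties of the Wirtinger derivatives `d` and `e` used for constructing the operators. -/
structure WirtingerPair (d e : Derivation ℂ Smooth Smooth) : Prop where
  decays : ∀ (r : ℝ) (f : Smooth), DecaysTo r (f : ℂ → ℂ) → DecaysTo r (e f : ℂ → ℂ)
  vanishes : ∀ f : Smooth, Vanishes (f : ℂ → ℂ) → Vanishes (e f : ℂ → ℂ)
  solvable : ∀ (r : ℝ) (f : Smooth), 2 < r → DecaysTo r (f : ℂ → ℂ) →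
    ∃ u : Smooth, Vanishes (u : ℂ → ℂ) ∧ d u = f
  liouville : ∀ u : Smooth, Vanishes (u : ℂ → ℂ) → d u = 0 → u = 0

theorem wirtingerPair_del : WirtingerPair del delbar where
  decays _ _ h := h.dzbar
  vanishes _ h := h.dzbar
  solvable r f hr hf := by
    obtain ⟨u, hu, huf⟩ := hf.exists_dz_eq hr
    exact ⟨⟨u, hu.1⟩, hu, Subtype.ext (funext huf)⟩
  liouville u hu h := Subtype.ext <| funext <|
    hu.eq_zero_of_dz fun z => congrArg (fun f : Smooth => (f : ℂ → ℂ) z) h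

theorem wirtingerPair_delbar : WirtingerPair delbar del where
  decays _ _ h := h.dz
  vanishes _ h := h.dz
  solvable r f hr hf := by
    obtain ⟨u, hu, huf⟩ := hf.exists_dzbar_eq hr
    exact ⟨⟨u, hu.1⟩, hu, Subtype.ext (funext huf)⟩
  liouville u hu h := Subtype.ext <| funext <|
    hu.eq_zero_of_dzbar fun z => congrArg (fun f : Smooth => (f : ℂ → ℂ) z) h

namespace Smooth

theorem decaysTo_mul {s r : ℝ} {f g : Smooth} (hf : DecaysTo s (f : ℂ → ℂ))
    (hg : DecaysTo r (g : ℂ → ℂ)) : DecaysTo (s + r) ((f * g : Smooth) : ℂ → ℂ) := hf.mul hg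

theorem decaysTo_natCast_mul {s : ℝ} (m : ℕ) {f : Smooth} (hf : DecaysTo s (f : ℂ → ℂ)) :
    DecaysTo s (((m : Smooth) * f : Smooth) : ℂ → ℂ) := hf.const_mul m

theorem decaysTo_neg_one_pow_mul {s : ℝ} (m : ℕ) {f : Smooth} (hf : DecaysTo s (f : ℂ → ℂ)) :
    DecaysTo s (((-1) ^ m * f : Smooth) : ℂ → ℂ) := hf.const_mul ((-1) ^ m)

theorem decaysTo_sub {s : ℝ} {f g : Smooth} (hf : DecaysTo s (f : ℂ → ℂ))
    (hg : DecaysTo s (g : ℂ → ℂ)) : DecaysTo s ((f - g : Smooth) : ℂ → ℂ) := by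
  have h := hf.add (hg.const_mul (-1))
  simp only [neg_one_mul, ← sub_eq_add_neg] at h
  exact h

theorem vanishes_sub {f g : Smooth} (hf : Vanishes (f : ℂ → ℂ)) (hg : Vanishes (g : ℂ → ℂ)) :
    Vanishes ((f - g : Smooth) : ℂ → ℂ) := by
  have h := hf.add (hg.const_mul (-1))
  simp only [neg_one_mul, ← sub_eq_add_neg] at h
  exact h

theorem decaysTo_sum {ι : Type*} {s : ℝ} (t : Finset ι) {f : ι → Smooth}
    (hf : ∀ i ∈ t, DecaysTo s (f i : ℂ → ℂ)) : DecaysTo s ((∑ i ∈ t, f i : Smooth) : ℂ → ℂ) := by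
  classical
  induction t using Finset.induction_on with
  | empty =>
    rw [Finset.sum_empty]
    exact ⟨contDiff_const, fun m => ⟨0, fun z => by
      have h : iteratedFDeriv ℝ m (fun _ : ℂ => (0 : ℂ)) = 0 := iteratedFDeriv_fun_zero
      change ‖iteratedFDeriv ℝ m (fun _ : ℂ => (0 : ℂ)) z‖ ≤ _
      simp [h]⟩⟩
  | insert i t hi ih =>
    rw [Finset.sum_insert hi]
    exact (hf i (Finset.mem_insert_self i t)).add
      (ih fun j hj => hf j (Finset.mem_insert_of_mem hj))

end Smooth

section Existence

variable {d e : Derivation ℂ Smooth Smooth} {n : ℕ} {p q : Smooth} {s : ℝ} {a : ℕ → Smooth}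

theorem WirtingerPair.decays_iterate (h : WirtingerPair d e) {f : Smooth}
    (hf : DecaysTo s (f : ℂ → ℂ)) (k : ℕ) : DecaysTo s (e^[k] f : ℂ → ℂ) := by
  induction k with
  | zero => exact hf
  | succ k ih =>
    rw [Function.iterate_succ_apply']
    exact h.decays _ _ ih

theorem WirtingerPair.decays_leftCoeff (h : WirtingerPair d e) {r : ℝ}
    (ha : ∀ k ≤ n, DecaysTo r (a k : ℂ → ℂ)) (hq : DecaysTo s (q : ℂ → ℂ)) (k : ℕ) :
    DecaysTo (s + r) ((leftCoeff e n a q k : Smooth) : ℂ → ℂ) :=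
  decaysTo_sum _ fun j hj => decaysTo_neg_one_pow_mul _
    (h.decays_iterate (decaysTo_mul hq (ha j (Finset.mem_Ioc.1 hj).2)) _)

theorem WirtingerPair.decays_compCoeff (h : WirtingerPair d e) {r : ℝ}
    (ha : ∀ k, DecaysTo r (a k : ℂ → ℂ)) (hp : DecaysTo s (p : ℂ → ℂ)) (k : ℕ) :
    DecaysTo (r + s) ((compCoeff e n a p k : Smooth) : ℂ → ℂ) :=
  decaysTo_sum _ fun j _ => decaysTo_natCast_mul _ (decaysTo_mul (ha j) (h.decays_iterate hp _))

/-- Each summand contains a factor from `p` and one from `q` (or derivatives of them) and otherwise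
bounded coefficients. For `s > 1` the exponent `s + s` exceeds the threshold `2` of the Cauchy
transform. -/
theorem WirtingerPair.decays_coeffSource (h : WirtingerPair d e)
    (ha : ∀ k, DecaysTo 0 (a k : ℂ → ℂ)) (hp : DecaysTo s (p : ℂ → ℂ))
    (hq : DecaysTo s (q : ℂ → ℂ)) (k : ℕ) :
    DecaysTo (s + s) ((coeffSource e n p q a k : Smooth) : ℂ → ℂ) := by
  have h1 := decaysTo_mul hp (h.decays_leftCoeff (n := n) (fun j _ => ha j) hq k)
  have h2 := h.decays_compCoeff (n := n) (fun k => h.decays_compCoeff (n := n) ha hp (k + 1)) hq k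
  rw [add_zero] at h1
  rw [zero_add] at h2
  exact decaysTo_sub h1 h2

theorem WirtingerPair.exists_coeff (h : WirtingerPair d e) (hs : 1 < s) (α : ℂ)
    (hp : DecaysTo s (p : ℂ → ℂ)) (hq : DecaysTo s (q : ℂ → ℂ)) :
    ∃ a : ℕ → Smooth, CoeffEquations d e n p q a ∧ (∀ z, (a n : ℂ → ℂ) z = α) ∧
      ∀ k < n, Vanishes (a k : ℂ → ℂ) := by
  classical
  let X := {f : Smooth // DecaysTo 0 (f : ℂ → ℂ)}
  let c : X := ⟨algebraMap ℂ Smooth α, decaysTo_const α⟩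
  have : Nonempty X := ⟨c⟩
  have hsolve : ∀ (k : ℕ) (a : ℕ → X), ∃ u : X, Vanishes (u.1 : ℂ → ℂ) ∧
      d u.1 = coeffSource e n p q (fun k => (a k).1) k := fun k a => by
    obtain ⟨u, hu, hu'⟩ := h.solvable (s + s) _ (by linarith)
      (h.decays_coeffSource (n := n) (fun k => (a k).2) hp hq k)
    exact ⟨⟨u, hu.decaysTo_zero⟩, hu, hu'⟩
  choose S hS hS' using hsolve
  obtain ⟨a, ha⟩ := exists_downward_recursion n
    -- The chosen solution `S k` may depend on the whole sequence. Replacing the entries outside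
    -- `(k, n]` by a fixed value forces dependence on higher coefficients only; by triangularity
    -- this does not affect the source.
    (fun k a => if k < n then S k (fun i => if k < i ∧ i ≤ n then a i else c) else c) (by
      intro k a a' haa'
      have : (fun i => if k < i ∧ i ≤ n then a i else c) =
          fun i => if k < i ∧ i ≤ n then a' i else c := by
        funext i
        split_ifs with hi
        · exact haa' i hi.1 hi.2
        · rfl
      simp only [this])
  refine ⟨fun k => (a k).1, fun k hk => ?_, fun z => ?_, fun k hk => ?_⟩
  · change d (a k).1 = coeffSource e n p q (fun k => (a k).1) k
    rcases hk.lt_or_eq with hk' | rfl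
    · rw [ha k hk, if_pos hk', hS']
      refine coeffSource_congr e (fun i hi hin => ?_) p q
      rw [if_pos ⟨hi, hin⟩]
    · rw [coeffSource_self, ha k le_rfl, if_neg (lt_irrefl k)]
      exact d.map_algebraMap α
  · beta_reduce
    rw [ha n le_rfl, if_neg (lt_irrefl n)]
    rfl
  · beta_reduce
    rw [ha k hk.le, if_pos hk]
    exact hS _ _

/-- Descending from the common leading coefficient, two solutions have equal sources at level `k`;
their difference is annihilated by `d` and vanishes at infinity, hence is zero. -/
theorem WirtingerPair.coeff_unique (h : WirtingerPair d e) {a' : ℕ → Smooth}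
    (ha : CoeffEquations d e n p q a) (ha' : CoeffEquations d e n p q a') (hn : a n = a' n)
    (hlow : ∀ k < n, Vanishes (a k : ℂ → ℂ)) (hlow' : ∀ k < n, Vanishes (a' k : ℂ → ℂ)) :
    ∀ k ≤ n, a k = a' k := by
  have key : ∀ m k, k ≤ n → n ≤ k + m → a k = a' k := by
    intro m
    induction m with
    | zero =>
      intro k hk hkm
      rwa [show k = n by omega]
    | succ m ih =>
      intro k hk hkm
      rcases hk.lt_or_eq with hk' | rfl
      · refine sub_eq_zero.1 (h.liouville _ (vanishes_sub (hlow k hk') (hlow' k hk')) ?_)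
        have h1 : d (a k) = coeffSource e n p q a k := ha k hk
        have h2 : d (a' k) = coeffSource e n p q a' k := ha' k hk
        rw [map_sub, h1, h2, coeffSource_congr e (fun i hi hin => ih i hin (by omega)), sub_self]
      · exact hn
  exact fun k hk => key n k hk (by omega)

end Existence

theorem exists_velocity {s : ℝ} (hs : 1 < s) (n : ℕ) (α γ : ℂ) {p q : Smooth}
    (hp : DecaysTo s (p : ℂ → ℂ)) (hq : DecaysTo s (q : ℂ → ℂ)) :
    ∃ P Q : ℂ → ℂ, IsDSIIVelocity n α γ p q P Q := by
  obtain ⟨a, ha, hα, ha'⟩ := wirtingerPair_del.exists_coeff (n := n) hs α hp hq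
  obtain ⟨g, hg, hγ, hg'⟩ := wirtingerPair_delbar.exists_coeff (n := n) hs γ hq hp
  exact ⟨_, _, _, isDSIIOperators_of_halfLax (ha.halfLax del_delbar)
    (hg.halfLax fun f => (del_delbar f).symm) hα hγ (fun k hk => (ha' k hk).2)
    fun k hk => (hg' k hk).2⟩

theorem IsDSIIVelocity.unique {n : ℕ} {α γ : ℂ} {p q P Q P' Q' : ℂ → ℂ} (hp : ContDiff ℝ ∞ p)
    (hq : ContDiff ℝ ∞ q) (h : IsDSIIVelocity n α γ p q P Q)
    (h' : IsDSIIVelocity n α γ p q P' Q') : P = P' ∧ Q = Q' := by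
  obtain ⟨p, rfl⟩ : ∃ f : Smooth, (f : ℂ → ℂ) = p := ⟨⟨p, hp⟩, rfl⟩
  obtain ⟨q, rfl⟩ : ∃ f : Smooth, (f : ℂ → ℂ) = q := ⟨⟨q, hq⟩, rfl⟩
  obtain ⟨M, hM⟩ := h
  obtain ⟨M', hM'⟩ := h'
  obtain ⟨a, g, hag, ha, hg, rfl, rfl⟩ := hM.exists_coeffEquations
  obtain ⟨a', g', hag', ha', hg', rfl, rfl⟩ := hM'.exists_coeffEquations
  have h1 : ∀ k ≤ n, a k = a' k := by
    refine wirtingerPair_del.coeff_unique ha ha' (Subtype.ext ?_) (fun k hk => ?_) fun k hk => ?_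
    · rw [← (hag n le_rfl).1, ← (hag' n le_rfl).1]
      exact funext fun z => (hM.lead_a z).trans (hM'.lead_a z).symm
    · rw [← (hag k hk.le).1]
      exact ⟨(hM.smooth k hk.le).1, hM.lower_a k hk⟩
    · rw [← (hag' k hk.le).1]
      exact ⟨(hM'.smooth k hk.le).1, hM'.lower_a k hk⟩
  have h2 : ∀ k ≤ n, g k = g' k := by
    refine wirtingerPair_delbar.coeff_unique hg hg' (Subtype.ext ?_) (fun k hk => ?_) fun k hk => ?_
    · rw [← (hag n le_rfl).2, ← (hag' n le_rfl).2]
      exact funext fun z => (hM.lead_d z).trans (hM'.lead_d z).symm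
    · rw [← (hag k hk.le).2]
      exact ⟨(hM.smooth k hk.le).2.2.2, hM.lower_d k hk⟩
    · rw [← (hag' k hk.le).2]
      exact ⟨(hM'.smooth k hk.le).2.2.2, hM'.lower_d k hk⟩
  rw [diffOp_congr delbar h1, diffOp_congr del h2, h1 0 (Nat.zero_le n), h2 0 (Nat.zero_le n),
    leftCoeff_congr del fun i _ hi => h2 i hi, leftCoeff_congr delbar fun i _ hi => h1 i hi]
  exact ⟨rfl, rfl⟩

/-! ### Integration by parts and formal adjoints -/

open Smooth MeasureTheory

section ByParts

variable {f g : ℂ → ℂ}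

theorem integral_mul_wirtinger (c : ℂ) (hf : Differentiable ℝ f) (hg : Differentiable ℝ g)
    (hfg : Integrable fun z => f z * g z) (hf' : ∀ v, Integrable fun z => fderiv ℝ f z v * g z)
    (hg' : ∀ v, Integrable fun z => f z * fderiv ℝ g z v) :
    ∫ z, f z * wirtinger c (fderiv ℝ g z) = -∫ z, wirtinger c (fderiv ℝ f z) * g z := by
  have hw : ∀ L : ℂ →L[ℝ] ℂ, wirtinger c L = 1 / 2 * L 1 + 1 / 2 * (c * L Complex.I) := fun L => by
    simp [wirtinger]
  have h : ∀ v, ∫ z, f z * fderiv ℝ g z v = -∫ z, fderiv ℝ f z v * g z := fun v =>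
    integral_mul_fderiv_eq_neg_fderiv_mul_of_integrable (hf' v) (hg' v) hfg
      (fun x _ => hf x) fun x _ => hg x
  have h1 : ∀ z, f z * wirtinger c (fderiv ℝ g z) =
      1 / 2 * (f z * fderiv ℝ g z 1) + 1 / 2 * c * (f z * fderiv ℝ g z Complex.I) := fun z => by
    rw [hw]; ring
  have h2 : ∀ z, wirtinger c (fderiv ℝ f z) * g z =
      1 / 2 * (fderiv ℝ f z 1 * g z) + 1 / 2 * c * (fderiv ℝ f z Complex.I * g z) := fun z => by
    rw [hw]; ring
  simp only [h1, h2]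
  rw [integral_add ((hg' 1).const_mul _) ((hg' Complex.I).const_mul _),
    integral_add ((hf' 1).const_mul _) ((hf' Complex.I).const_mul _)]
  simp only [integral_const_mul, h]
  ring

theorem DecaysTo.integrable_mul {s r : ℝ} (hf : DecaysTo s f) (hg : DecaysTo r g)
    (hsr : 2 < s + r) : Integrable fun z => f z * g z := by
  obtain ⟨C, _, hC⟩ := (hf.mul hg).norm_le
  exact ((integrable_one_add_norm_complex hsr).const_mul C).mono'
    (hf.mul hg).1.continuous.aestronglyMeasurable (Filter.Eventually.of_forall hC)

theorem DecaysTo.integral_mul_wirtinger {s r : ℝ} (c : ℂ) (hf : DecaysTo s f) (hg : DecaysTo r g)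
    (hsr : 2 < s + r) :
    ∫ z, f z * wirtinger c (_root_.fderiv ℝ g z) =
      -∫ z, wirtinger c (_root_.fderiv ℝ f z) * g z := by
  have happ : ∀ {s : ℝ} {f : ℂ → ℂ}, DecaysTo s f → ∀ v : ℂ,
      DecaysTo s fun z => _root_.fderiv ℝ f z v := fun h v =>
    h.fderiv.clm_comp (ContinuousLinearMap.apply ℝ ℂ v)
  exact DSII.integral_mul_wirtinger c (hf.1.differentiable (by simp))
    (hg.1.differentiable (by simp)) (hf.integrable_mul hg hsr)
    (fun v => (happ hf v).integrable_mul hg hsr) fun v => hf.integrable_mul (happ hg v) hsr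

theorem integral_mul_wirtinger_of_hasCompactSupport (c : ℂ) (hf : ContDiff ℝ ∞ f)
    (hg : ContDiff ℝ ∞ g) (hc : HasCompactSupport f) :
    ∫ z, f z * wirtinger c (fderiv ℝ g z) = -∫ z, wirtinger c (fderiv ℝ f z) * g z := by
  have hv : ∀ {h : ℂ → ℂ}, ContDiff ℝ ∞ h → ∀ v, Continuous fun z => fderiv ℝ h z v :=
    fun h v => (contDiff_fderiv_apply h v).continuous
  have hc' : ∀ v, HasCompactSupport fun z => fderiv ℝ f z v := fun v =>
    (hc.fderiv ℝ).comp_left (g := fun L : ℂ →L[ℝ] ℂ => L v) rfl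
  exact integral_mul_wirtinger c (hf.differentiable (by simp)) (hg.differentiable (by simp))
    ((hf.continuous.mul hg.continuous).integrable_of_hasCompactSupport hc.mul_right)
    (fun v => ((hv hf v).mul hg.continuous).integrable_of_hasCompactSupport (hc' v).mul_right)
    fun v => (hf.continuous.mul (hv hg v)).integrable_of_hasCompactSupport hc.mul_right

end ByParts

/-! ### Formal adjoints of differential operators and of one half of the compatibility conditions.
-/

section Adjoint

/-- `Y` is a formal adjoint of `X` with respect to the bilinear pairing `∫ f g dx dy`. -/
def IsAdjoint (X Y : Smooth → Smooth) : Prop :=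
  ∀ f g : Smooth, HasCompactSupport (f : ℂ → ℂ) → HasCompactSupport (X f : ℂ → ℂ) ∧
    ∫ z, (X f : ℂ → ℂ) z * (g : ℂ → ℂ) z = ∫ z, (f : ℂ → ℂ) z * (Y g : ℂ → ℂ) z

theorem integrable_mul_of_hasCompactSupport {f : Smooth} (hf : HasCompactSupport (f : ℂ → ℂ))
    (g : Smooth) : Integrable fun z => (f : ℂ → ℂ) z * (g : ℂ → ℂ) z :=
  (f.contDiff.continuous.mul g.contDiff.continuous).integrable_of_hasCompactSupport hf.mul_right

variable {X Y X' Y' : Smooth → Smooth}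

theorem IsAdjoint.comp (h : IsAdjoint X Y) (h' : IsAdjoint X' Y') :
    IsAdjoint (fun f => X (X' f)) fun g => Y' (Y g) := fun f g hf =>
  ⟨(h _ g (h' f g hf).1).1, ((h _ g (h' f g hf).1).2).trans (h' f (Y g) hf).2⟩

theorem IsAdjoint.add (h : IsAdjoint X Y) (h' : IsAdjoint X' Y') :
    IsAdjoint (fun f => X f + X' f) fun g => Y g + Y' g := fun f g hf => by
  obtain ⟨h1, h2⟩ := h f g hf
  obtain ⟨h1', h2'⟩ := h' f g hf
  refine ⟨h1.add h1', ?_⟩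
  have h3 := integral_add (integrable_mul_of_hasCompactSupport h1 g)
    (integrable_mul_of_hasCompactSupport h1' g)
  have h4 := integral_add (integrable_mul_of_hasCompactSupport hf (Y g))
    (integrable_mul_of_hasCompactSupport hf (Y' g))
  rw [h2, h2', ← h4] at h3
  simp only [← add_mul, ← mul_add] at h3
  exact h3

theorem IsAdjoint.neg (h : IsAdjoint X Y) : IsAdjoint (fun f => -X f) fun g => -Y g :=
  fun f g hf => by
  obtain ⟨h1, h2⟩ := h f g hf
  refine ⟨h1.neg, ?_⟩
  change ∫ z, -(X f : ℂ → ℂ) z * _ = ∫ z, _ * -(Y g : ℂ → ℂ) z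
  simp only [neg_mul, mul_neg, integral_neg, h2]

theorem IsAdjoint.sub (h : IsAdjoint X Y) (h' : IsAdjoint X' Y') :
    IsAdjoint (fun f => X f - X' f) fun g => Y g - Y' g := by
  simp only [sub_eq_add_neg]
  exact h.add h'.neg

theorem isAdjoint_mul (p : Smooth) : IsAdjoint (fun f => p * f) fun g => p * g := fun f g hf => by
  refine ⟨hf.mul_left, integral_congr_ae (Filter.Eventually.of_forall fun z => ?_)⟩
  change (p : ℂ → ℂ) z * (f : ℂ → ℂ) z * (g : ℂ → ℂ) z =
    (f : ℂ → ℂ) z * ((p : ℂ → ℂ) z * (g : ℂ → ℂ) z)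
  ring

theorem isAdjoint_id : IsAdjoint (fun f => f) fun g => g := fun _ _ hf => ⟨hf, rfl⟩

theorem isAdjoint_sum {ι : Type*} (t : Finset ι) {X Y : ι → Smooth → Smooth}
    (h : ∀ i ∈ t, IsAdjoint (X i) (Y i)) :
    IsAdjoint (fun f => ∑ i ∈ t, X i f) fun g => ∑ i ∈ t, Y i g := by
  classical
  induction t using Finset.induction_on with
  | empty =>
    intro f g hf
    simp only [Finset.sum_empty]
    refine ⟨HasCompactSupport.zero, ?_⟩
    change ∫ z, (0 : ℂ) * _ = ∫ z, _ * (0 : ℂ)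
    simp
  | insert i t hi ih =>
    simp only [Finset.sum_insert hi]
    exact (h i (Finset.mem_insert_self i t)).add
      (ih fun j hj => h j (Finset.mem_insert_of_mem hj))

theorem eq_of_integral_mul_eq {u v : Smooth} (h : ∀ f : Smooth, HasCompactSupport (f : ℂ → ℂ) →
    ∫ z, (f : ℂ → ℂ) z * (u : ℂ → ℂ) z = ∫ z, (f : ℂ → ℂ) z * (v : ℂ → ℂ) z) : u = v := by
  refine Subtype.ext ((u.contDiff.continuous.ae_eq_iff_eq volume v.contDiff.continuous).1 ?_)
  refine ae_eq_of_integral_contDiff_smul_eq u.contDiff.continuous.locallyIntegrable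
    v.contDiff.continuous.locallyIntegrable fun φ hφ hφc => ?_
  have h1 := h ⟨fun z => (φ z : ℂ), Complex.ofRealCLM.contDiff.comp hφ⟩
    (hφc.comp_left (g := ((↑) : ℝ → ℂ)) Complex.ofReal_zero)
  simpa only [Complex.real_smul] using h1

/-- Operator identities are transposed by this: both sides are adjoints of the same operator, so no
computation with adjoint coefficients is needed. -/
theorem IsAdjoint.unique (h : IsAdjoint X Y) (h' : IsAdjoint X Y') (g : Smooth) : Y g = Y' g :=
  eq_of_integral_mul_eq fun f hf => (h f g hf).2.symm.trans (h' f g hf).2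

/-- Derivations which are formally skew-adjoint. -/
def SkewAdjoint (e : Derivation ℂ Smooth Smooth) : Prop := IsAdjoint e fun g => -e g

theorem skewAdjoint_of_wirtinger {e : Derivation ℂ Smooth Smooth} (c : ℂ)
    (he : ∀ f : Smooth, (e f : ℂ → ℂ) = fun z => wirtinger c (fderiv ℝ (f : ℂ → ℂ) z)) :
    SkewAdjoint e := fun f g hf => by
  refine ⟨?_, ?_⟩
  · rw [he]
    exact (hf.fderiv ℝ).comp_left (g := wirtinger c) (map_zero _)
  · have h := integral_mul_wirtinger_of_hasCompactSupport c f.contDiff g.contDiff hf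
    have h1 : ∀ z, ((-e g : Smooth) : ℂ → ℂ) z = -(e g : ℂ → ℂ) z := fun z => rfl
    simp only [h1, he, mul_neg, integral_neg, h, neg_neg]

theorem skewAdjoint_del : SkewAdjoint del :=
  skewAdjoint_of_wirtinger (-Complex.I) fun f => dz_eq_wirtinger f

theorem skewAdjoint_delbar : SkewAdjoint delbar :=
  skewAdjoint_of_wirtinger Complex.I fun f => dzbar_eq_wirtinger f

theorem SkewAdjoint.iterate {e : Derivation ℂ Smooth Smooth} (he : SkewAdjoint e) (k : ℕ) :
    IsAdjoint (fun f => e^[k] f) fun g => (-1) ^ k * e^[k] g := by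
  induction k with
  | zero => simpa using isAdjoint_id
  | succ k ih =>
    have h := ih.comp he
    refine fun f g hf => ?_
    have h1 := h f g hf
    beta_reduce
    rw [Function.iterate_succ_apply, Function.iterate_succ_apply']
    have h2 : -e ((-1) ^ k * e^[k] g) = (-1) ^ (k + 1) * e (e^[k] g) := by
      have h3 : e ((-1) ^ k : Smooth) = 0 := by
        simpa only [map_pow, map_neg, map_one] using e.map_algebraMap ((-1) ^ k : ℂ)
      rw [Derivation.leibniz, h3, pow_succ, smul_zero, add_zero, smul_eq_mul]
      ring
    rw [← h2]
    exact h1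

theorem SkewAdjoint.isAdjoint_diffOp {e : Derivation ℂ Smooth Smooth} (he : SkewAdjoint e) (n : ℕ)
    (a : ℕ → Smooth) : IsAdjoint (diffOp e n a) (diffOp e n (adjCoeff e n a)) := by
  have h := isAdjoint_sum (Finset.range (n + 1)) fun k _ => (isAdjoint_mul (a k)).comp (he.iterate k)
  have h1 : diffOp e n (adjCoeff e n a) =
      fun g => ∑ k ∈ Finset.range (n + 1), (-1) ^ k * e^[k] (a k * g) :=
    funext fun g => diffOp_adjCoeff e n a g
  rw [h1]
  exact h

theorem diffOp_neg_coeff {R : Type*} [CommRing R] [Algebra ℂ R] (e : Derivation ℂ R R) (n : ℕ)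
    (a : ℕ → R) (f : R) : diffOp e n (fun k => -a k) f = -diffOp e n a f := by
  simp [diffOp]

/-- The formal adjoint of one half of the compatibility conditions. -/
theorem HalfLax.adjoint {d e : Derivation ℂ Smooth Smooth} (hd : SkewAdjoint d)
    (he : SkewAdjoint e) {n : ℕ} {p q m μ : Smooth} {a c ε : ℕ → Smooth}
    (h : HalfLax d e p q (diffOp e n a) (diffOp e n c) (diffOp e n ε) m μ) :
    HalfLax d e q p (diffOp e n fun k => -adjCoeff e n a k)
      (diffOp e n (adjCoeff e n ε)) (diffOp e n (adjCoeff e n c)) μ m where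
  comm f := by
    have h1 := hd.comp (he.isAdjoint_diffOp n a)
    have h2 := (((he.isAdjoint_diffOp n a).comp hd).add ((isAdjoint_mul p).comp (he.isAdjoint_diffOp n c))).sub
      ((he.isAdjoint_diffOp n ε).comp (isAdjoint_mul q))
    -- Now `h1` and `h2` give two adjoints of the same operator `d ∘ A`. The result is the
    -- commutator identity for `-A*`, with `E*` and `C*` in the roles of `C` and `E`.
    simp only [← h.comm] at h2
    have h3 := h1.unique h2 f
    rw [diffOp_neg] at h3
    rw [diffOp_neg_coeff, diffOp_neg_coeff, map_neg]
    linear_combination -h3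
  right_quot f := by
    have h1 := he.comp (he.isAdjoint_diffOp n c)
    have h2 := ((isAdjoint_mul q).comp (he.isAdjoint_diffOp n a)).add (isAdjoint_mul m)
    simp only [← h.left_quot] at h2
    have h3 := h1.unique h2 f
    rw [diffOp_neg] at h3
    rw [diffOp_neg_coeff]
    linear_combination -h3
  left_quot f := by
    have h1 := (he.isAdjoint_diffOp n ε).comp he
    have h2 := ((he.isAdjoint_diffOp n a).comp (isAdjoint_mul p)).sub (isAdjoint_mul μ)
    simp only [← h.right_quot] at h2
    have h3 := h1.unique h2 f
    rw [diffOp_neg_coeff]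
    linear_combination -h3

theorem WirtingerPair.adjCoeff_lead (e : Derivation ℂ Smooth Smooth) (n : ℕ) (a : ℕ → Smooth) :
    adjCoeff e n a n = (-1) ^ n * a n := by
  rw [adjCoeff, Finset.sum_eq_single n]
  · simp
  · intro j hj hjn
    have := Finset.mem_range.1 hj
    rw [Nat.choose_eq_zero_of_lt (by omega)]
    simp
  · simp

/-- The only coefficient not vanishing at infinity is the leading one; being constant, it is killed
by the derivatives with which it enters the lower adjoint coefficients. -/
theorem WirtingerPair.vanishes_adjCoeff {d e : Derivation ℂ Smooth Smooth} (h : WirtingerPair d e)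
    {n : ℕ} {a : ℕ → Smooth} {α : ℂ} (hα : a n = algebraMap ℂ Smooth α)
    (ha : ∀ k < n, Vanishes (a k : ℂ → ℂ)) {k : ℕ} (hk : k < n) :
    Vanishes ((adjCoeff e n a k : Smooth) : ℂ → ℂ) := by
  have hiter : ∀ {f : Smooth}, Vanishes (f : ℂ → ℂ) → ∀ j, Vanishes (e^[j] f : ℂ → ℂ) := by
    intro f hf j
    induction j with
    | zero => exact hf
    | succ j ih =>
      rw [Function.iterate_succ_apply']
      exact h.vanishes _ ih
  have hmul : ∀ {f : Smooth}, Vanishes (f : ℂ → ℂ) → ∀ j l : ℕ,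
      Vanishes (((-1) ^ j * ((l : Smooth) * f) : Smooth) : ℂ → ℂ) := fun hf j l =>
    (hf.const_mul l).const_mul ((-1) ^ j)
  have hterm : ∀ j ∈ Finset.range (n + 1),
      Vanishes (((-1) ^ j * ((j.choose k : Smooth) * e^[j - k] (a j)) : Smooth) : ℂ → ℂ) := by
    intro j hj
    have hj' := Finset.mem_range.1 hj
    by_cases hjn : j = n
    · subst hjn
      obtain ⟨i, hi⟩ : ∃ i, j - k = i + 1 := ⟨j - k - 1, by omega⟩
      rw [hα, hi, Function.iterate_succ_apply, e.map_algebraMap, iterate_map_zero, mul_zero,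
        mul_zero]
      exact vanishes_zero
    · exact hmul (hiter (ha j (by omega)) _) _ _
  unfold adjCoeff
  generalize Finset.range (n + 1) = t at hterm
  classical
  induction t using Finset.induction_on with
  | empty =>
    rw [Finset.sum_empty]
    exact vanishes_zero
  | insert i t hi ih =>
    rw [Finset.sum_insert hi]
    exact (hterm i (Finset.mem_insert_self i t)).add
      (ih fun j hj => hterm j (Finset.mem_insert_of_mem hj))

end Adjoint

/-! ### Symmetries of the hierarchy and its reductions -/

open Smooth

section Symmetries

variable {n : ℕ} {α γ : ℂ} {p q P Q : ℂ → ℂ}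

/-- The symmetry of the hierarchy given by formal adjoints. -/
theorem IsDSIIVelocity.adjoint (hp : ContDiff ℝ ∞ p) (hq : ContDiff ℝ ∞ q)
    (h : IsDSIIVelocity n α γ p q P Q) :
    IsDSIIVelocity n ((-1) ^ (n + 1) * α) ((-1) ^ (n + 1) * γ) q p Q P := by
  obtain ⟨p, rfl⟩ : ∃ f : Smooth, (f : ℂ → ℂ) = p := ⟨⟨p, hp⟩, rfl⟩
  obtain ⟨q, rfl⟩ : ∃ f : Smooth, (f : ℂ → ℂ) = q := ⟨⟨q, hq⟩, rfl⟩
  obtain ⟨M, hM⟩ := h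
  obtain ⟨a, g, hag, ha, hg, rfl, rfl⟩ := hM.exists_coeffEquations
  have hA := (ha.halfLax del_delbar).adjoint skewAdjoint_del skewAdjoint_delbar
  have hD := (hg.halfLax fun f => (del_delbar f).symm).adjoint skewAdjoint_delbar skewAdjoint_del
  have hα : a n = algebraMap ℂ Smooth α := by
    refine Subtype.ext ?_
    rw [← (hag n le_rfl).1]
    exact funext hM.lead_a
  have hγ : g n = algebraMap ℂ Smooth γ := by
    refine Subtype.ext ?_
    rw [← (hag n le_rfl).2]
    exact funext hM.lead_d
  have hlead : ∀ {e : Derivation ℂ Smooth Smooth} {a : ℕ → Smooth} {α : ℂ},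
      a n = algebraMap ℂ Smooth α → ∀ z, ((-adjCoeff e n a n : Smooth) : ℂ → ℂ) z =
        (-1) ^ (n + 1) * α := fun {e a α} h z => by
    rw [WirtingerPair.adjCoeff_lead, h]
    change -((-1) ^ n * α) = _
    ring
  have ha' : ∀ k < n, Vanishes (a k : ℂ → ℂ) := fun k hk => by
    rw [← (hag k hk.le).1]
    exact ⟨(hM.smooth k hk.le).1, hM.lower_a k hk⟩
  have hg' : ∀ k < n, Vanishes (g k : ℂ → ℂ) := fun k hk => by
    rw [← (hag k hk.le).2]
    exact ⟨(hM.smooth k hk.le).2.2.2, hM.lower_d k hk⟩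
  have hneg : ∀ {f : Smooth}, Vanishes (f : ℂ → ℂ) → Vanishes ((-f : Smooth) : ℂ → ℂ) :=
    fun {f} h => by
      have h' := h.const_mul (-1)
      simp only [neg_one_mul] at h'
      exact h'
  -- Passing to adjoints exchanges the remainders `m` and `μ` in each half, hence `m' + μ` and `m +
  -- μ'`: the velocities trade places together with the potentials. The leading constants acquire
  -- `-(-1)^n`.
  have := isDSIIOperators_of_halfLax hA hD (hlead hα) (hlead hγ)
    (fun k hk => (hneg (wirtingerPair_del.vanishes_adjCoeff hα ha' hk)).2)
    (fun k hk => (hneg (wirtingerPair_delbar.vanishes_adjCoeff hγ hg' hk)).2)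
  exact ⟨_, this⟩

theorem opZbar_conj (c : ℕ → ℂ → ℂ) (f : ℂ → ℂ) (z : ℂ) :
    opZbar n c (fun w => conj (f w)) z = conj (opZ n (fun k w => conj (c k w)) f z) := by
  simp only [opZbar, opZ, iterate_dzbar_conj, map_sum, map_mul, Complex.conj_conj]

theorem opZ_conj (c : ℕ → ℂ → ℂ) (f : ℂ → ℂ) (z : ℂ) :
    opZ n c (fun w => conj (f w)) z = conj (opZbar n (fun k w => conj (c k w)) f z) := by
  simp only [opZbar, opZ, iterate_dz_conj, map_sum, map_mul, Complex.conj_conj]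

/-- The symmetry of the hierarchy given by the complex conjugation. -/
theorem IsDSIIVelocity.conj (h : IsDSIIVelocity n α γ p q P Q) :
    IsDSIIVelocity n (conj γ) (conj α) (fun z => conj (q z)) (fun z => conj (p z))
      (fun z => conj (Q z)) (fun z => conj (P z)) := by
  obtain ⟨M, hM⟩ := h
  have hsm : ∀ {f : ℂ → ℂ}, ContDiff ℝ ∞ f → ContDiff ℝ ∞ fun z => (starRingEnd ℂ) (f z) :=
    fun h => Complex.conjCLE.contDiff.comp h
  obtain ⟨l₁₁, l₁₂, l₂₁, l₂₂, hl⟩ := hM.compat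
  -- Conjugation exchanges `∂` and `∂̄`, so the two components must be exchanged as well: `A`, `B`
  -- become the conjugates of `D`, `C`, and likewise for `Λ`.
  refine ⟨⟨fun k w => (starRingEnd ℂ) (M.d k w), fun k w => (starRingEnd ℂ) (M.c k w),
    fun k w => (starRingEnd ℂ) (M.b k w), fun k w => (starRingEnd ℂ) (M.a k w)⟩,
    fun k hk => ⟨hsm (hM.smooth k hk).2.2.2, hsm (hM.smooth k hk).2.2.1,
      hsm (hM.smooth k hk).2.1, hsm (hM.smooth k hk).1⟩,
    fun z => congrArg (starRingEnd ℂ) (hM.lead_d z), fun z => congrArg (starRingEnd ℂ) (hM.lead_a z),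
    fun k hk => (Vanishes.conj ⟨(hM.smooth k hk.le).2.2.2, hM.lower_d k hk⟩).2,
    fun k hk => (Vanishes.conj ⟨(hM.smooth k hk.le).1, hM.lower_a k hk⟩).2,
    fun k w => (starRingEnd ℂ) (l₂₂ k w), fun k w => (starRingEnd ℂ) (l₂₁ k w),
    fun k w => (starRingEnd ℂ) (l₁₂ k w), fun k w => (starRingEnd ℂ) (l₁₁ k w),
    fun ψ φ hψ hφ z => ?_⟩
  have h1 := hl _ _ (hsm hφ) (hsm hψ) z
  have hf : M.fst n (fun w => (starRingEnd ℂ) (φ w)) (fun w => (starRingEnd ℂ) (ψ w)) =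
      fun w => (starRingEnd ℂ) (opZbar n (fun k w => (starRingEnd ℂ) (M.b k w)) ψ w +
        opZ n (fun k w => (starRingEnd ℂ) (M.a k w)) φ w) := by
    funext w
    rw [LaxCoeffs.fst, opZbar_conj, opZ_conj, ← map_add, add_comm]
  have hs : M.snd n (fun w => (starRingEnd ℂ) (φ w)) (fun w => (starRingEnd ℂ) (ψ w)) =
      fun w => (starRingEnd ℂ) (opZbar n (fun k w => (starRingEnd ℂ) (M.d k w)) ψ w +
        opZ n (fun k w => (starRingEnd ℂ) (M.c k w)) φ w) := by
    funext w
    rw [LaxCoeffs.snd, opZbar_conj, opZ_conj, ← map_add, add_comm]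
  have hr₁ : (fun w => dz (fun w => (starRingEnd ℂ) (φ w)) w - p w * (starRingEnd ℂ) (ψ w)) =
      fun w => (starRingEnd ℂ) (dzbar φ w - (starRingEnd ℂ) (p w) * ψ w) := by
    funext w
    simp [dz_conj]
  have hr₂ : (fun w => dzbar (fun w => (starRingEnd ℂ) (ψ w)) w - q w * (starRingEnd ℂ) (φ w)) =
      fun w => (starRingEnd ℂ) (dz ψ w - (starRingEnd ℂ) (q w) * φ w) := by
    funext w
    simp [dzbar_conj]
  rw [hf, hs, hr₁, hr₂, dz_conj, dzbar_conj, opZbar_conj, opZbar_conj, opZ_conj, opZ_conj] at h1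
  have h2 := congrArg (starRingEnd ℂ) h1.1
  have h3 := congrArg (starRingEnd ℂ) h1.2
  simp only [map_sub, map_mul, map_add, Complex.conj_conj] at h2 h3
  refine ⟨?_, ?_⟩
  · rw [add_comm (opZbar n _ _ z)]
    exact h3
  · rw [add_comm (opZ n _ _ z)]
    exact h2

theorem iterate_dz_const_mul (ε : ℂ) (f : ℂ → ℂ) (k : ℕ) :
    dz^[k] (fun w => ε * f w) = fun w => ε * dz^[k] f w := by
  induction k with
  | zero => rfl
  | succ k ih =>
    rw [Function.iterate_succ_apply', Function.iterate_succ_apply', ih]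
    exact funext (dz_const_mul ε _)

theorem iterate_dzbar_const_mul (ε : ℂ) (f : ℂ → ℂ) (k : ℕ) :
    dzbar^[k] (fun w => ε * f w) = fun w => ε * dzbar^[k] f w := by
  induction k with
  | zero => rfl
  | succ k ih =>
    rw [Function.iterate_succ_apply', Function.iterate_succ_apply', ih]
    exact funext (dzbar_const_mul ε _)

theorem opZ_const_mul (c : ℕ → ℂ → ℂ) (ε : ℂ) (f : ℂ → ℂ) (z : ℂ) :
    opZ n c (fun w => ε * f w) z = ε * opZ n c f z := by
  simp only [opZ, iterate_dz_const_mul, Finset.mul_sum]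
  exact Finset.sum_congr rfl fun k _ => by ring

theorem opZbar_const_mul (c : ℕ → ℂ → ℂ) (ε : ℂ) (f : ℂ → ℂ) (z : ℂ) :
    opZbar n c (fun w => ε * f w) z = ε * opZbar n c f z := by
  simp only [opZbar, iterate_dzbar_const_mul, Finset.mul_sum]
  exact Finset.sum_congr rfl fun k _ => by ring

theorem opZ_coeff_const_mul (c : ℕ → ℂ → ℂ) (ε : ℂ) (f : ℂ → ℂ) (z : ℂ) :
    opZ n (fun k w => ε * c k w) f z = ε * opZ n c f z := by
  simp only [opZ, Finset.mul_sum, mul_assoc]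

theorem opZbar_coeff_const_mul (c : ℕ → ℂ → ℂ) (ε : ℂ) (f : ℂ → ℂ) (z : ℂ) :
    opZbar n (fun k w => ε * c k w) f z = ε * opZbar n c f z := by
  simp only [opZbar, Finset.mul_sum, mul_assoc]

/-- The symmetry of the hierarchy given by the change of the signs of both potentials. -/
theorem IsDSIIVelocity.scale {ε : ℂ} (hε : ε * ε = 1) (h : IsDSIIVelocity n α γ p q P Q) :
    IsDSIIVelocity n α γ (fun z => ε * p z) (fun z => ε * q z)
      (fun z => ε * P z) (fun z => ε * Q z) := by
  obtain ⟨M, hM⟩ := h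
  obtain ⟨l₁₁, l₁₂, l₂₁, l₂₂, hl⟩ := hM.compat
  refine ⟨⟨M.a, fun k w => ε * M.b k w, fun k w => ε * M.c k w, M.d⟩,
    fun k hk => ⟨(hM.smooth k hk).1, contDiff_const.mul (hM.smooth k hk).2.1,
      contDiff_const.mul (hM.smooth k hk).2.2.1, (hM.smooth k hk).2.2.2⟩,
    hM.lead_a, hM.lead_d, hM.lower_a, hM.lower_d,
    l₁₁, fun k w => ε * l₁₂ k w, fun k w => ε * l₂₁ k w, l₂₂, fun ψ φ hψ hφ z => ?_⟩
  -- The symmetry is conjugation by `diag(1, ε)`.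
  have h1 := hl ψ (fun w => ε * φ w) hψ (contDiff_const.mul hφ) z
  have hf : M.fst n ψ (fun w => ε * φ w) =
      LaxCoeffs.fst ⟨M.a, fun k w => ε * M.b k w, fun k w => ε * M.c k w, M.d⟩ n ψ φ := by
    funext w
    simp only [LaxCoeffs.fst, opZ_const_mul, opZ_coeff_const_mul]
  have hs : M.snd n ψ (fun w => ε * φ w) = fun w => ε *
      LaxCoeffs.snd ⟨M.a, fun k w => ε * M.b k w, fun k w => ε * M.c k w, M.d⟩ n ψ φ w := by
    funext w
    simp only [LaxCoeffs.snd, opZ_const_mul, opZbar_coeff_const_mul]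
    linear_combination -(opZbar n M.c ψ w) * hε
  have hr₁ : (fun w => dz ψ w - p w * (ε * φ w)) = fun w => dz ψ w - ε * p w * φ w := by
    funext w
    ring
  have hr₂ : (fun w => dzbar (fun w => ε * φ w) w - q w * ψ w) =
      fun w => ε * (dzbar φ w - ε * q w * ψ w) := by
    funext w
    rw [dzbar_const_mul]
    linear_combination (q w * ψ w) * hε
  rw [hf, hs, hr₁, hr₂, dzbar_const_mul, opZbar_const_mul, opZ_const_mul] at h1
  rw [opZbar_coeff_const_mul, opZ_coeff_const_mul]
  refine ⟨?_, ?_⟩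
  · rw [← h1.1]
    ring
  · have h2 := h1.2
    generalize dzbar (LaxCoeffs.snd _ n ψ φ) z = S at h2 ⊢
    generalize LaxCoeffs.fst _ n ψ φ z = T at h2 ⊢
    linear_combination ε * h2 +
      (-S + opZ n l₂₂ (fun w => dzbar φ w - ε * q w * ψ w) z) * hε

end Symmetries

/-! ### The reductions `q = ε p̄` and real `p, q`. -/

section Reductions

variable {n : ℕ} {s : ℝ}

/-- Conjugation followed by the scaling by `ε` fixes the potentials `(p, ε p̄)` and the leading
constants `(α, ᾱ)`; uniqueness of the velocity gives the first claim. The adjoint followed by the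
same scaling carries `(p, ε p̄)` to `(p̄, ε p)`, which gives the second. -/
theorem conj_reduction {α : ℂ} {ε : ℝ} {p P Q : ℂ → ℂ} (hε : ε = 1 ∨ ε = -1)
    (hp : ContDiff ℝ ∞ p)
    (h : IsDSIIVelocity n α (conj α) p (fun z => ε * conj (p z)) P Q) :
    (∀ z, Q z = ε * conj (P z)) ∧
      IsDSIIVelocity n ((-1) ^ (n + 1) * α) ((-1) ^ (n + 1) * conj α)
        (fun z => conj (p z)) (fun z => ε * p z) (fun z => conj (P z)) (fun z => ε * P z) := by
  have hε' : (ε : ℂ) * ε = 1 := by rcases hε with rfl | rfl <;> norm_num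
  have hq : ContDiff ℝ ∞ fun z => (ε : ℂ) * conj (p z) :=
    contDiff_const.mul (Complex.conjCLE.contDiff.comp hp)
  have hεε : ∀ x : ℂ, (ε : ℂ) * (ε * x) = x := fun x => by rw [← mul_assoc, hε', one_mul]
  have h1 := h.conj.scale hε'
  simp only [map_mul, Complex.conj_conj, Complex.conj_ofReal, hεε] at h1
  have h2 := congrFun (h.unique hp hq h1).2
  have h3 := (h.adjoint hp hq).scale hε'
  simp only [hεε] at h3
  have h4 : (fun z => (ε : ℂ) * Q z) = fun z => conj (P z) := funext fun z => by rw [h2, hεε]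
  rw [h4] at h3
  exact ⟨h2, h3⟩

/-- On real potentials conjugation and the adjoint both lead to `(q, p)`. The relation between the
leading constants makes them agree there too, so uniqueness identifies each velocity with its
conjugate. -/
theorem real_reduction {α : ℂ} {p q : ℂ → ℝ} {P Q : ℂ → ℂ}
    (hp : ContDiff ℝ ∞ fun z => (p z : ℂ)) (hq : ContDiff ℝ ∞ fun z => (q z : ℂ))
    (h : IsDSIIVelocity n α ((-1) ^ (n + 1) * conj α) (fun z => (p z : ℂ)) (fun z => (q z : ℂ))
      P Q) (z : ℂ) : (P z).im = 0 ∧ (Q z).im = 0 := by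
  have h1 := h.conj
  have h2 := h.adjoint hp hq
  have h3 : ((-1) ^ (n + 1) * ((-1) ^ (n + 1) * conj α) : ℂ) = conj α := by
    rw [← mul_assoc, ← mul_pow]
    simp
  rw [h3] at h2
  simp only [map_mul, map_pow, map_neg, map_one, Complex.conj_conj, Complex.conj_ofReal] at h1
  obtain ⟨h4, h5⟩ := h1.unique hq hp h2
  exact ⟨Complex.conj_eq_iff_im.1 (congrFun h5 z), Complex.conj_eq_iff_im.1 (congrFun h4 z)⟩

end Reductions

/-! ### Locality, and equality of mixed derivatives on local solutions. -/

section Local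

open Filter

variable {f g : ℂ → ℂ} {z : ℂ}

theorem dz_eventuallyEq (h : f =ᶠ[𝓝 z] g) : dz f =ᶠ[𝓝 z] dz g :=
  (h.fderiv (𝕜 := ℝ)).mono fun w hw => by simp only [dz, hw]

theorem dzbar_eventuallyEq (h : f =ᶠ[𝓝 z] g) : dzbar f =ᶠ[𝓝 z] dzbar g :=
  (h.fderiv (𝕜 := ℝ)).mono fun w hw => by simp only [dzbar, hw]

theorem opZ_eventuallyEq (n : ℕ) (c : ℕ → ℂ → ℂ) (h : f =ᶠ[𝓝 z] g) :
    opZ n c f =ᶠ[𝓝 z] opZ n c g := by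
  have hk : ∀ k, dz^[k] f =ᶠ[𝓝 z] dz^[k] g := fun k => by
    induction k with
    | zero => exact h
    | succ k ih =>
      rw [Function.iterate_succ_apply', Function.iterate_succ_apply']
      exact dz_eventuallyEq ih
  filter_upwards [eventually_all.2 fun i : Fin (n + 1) => hk i] with w hw
  exact Finset.sum_congr rfl fun k hk => by rw [hw ⟨k, Finset.mem_range.1 hk⟩]

theorem opZbar_eventuallyEq (n : ℕ) (c : ℕ → ℂ → ℂ) (h : f =ᶠ[𝓝 z] g) :
    opZbar n c f =ᶠ[𝓝 z] opZbar n c g := by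
  have hk : ∀ k, dzbar^[k] f =ᶠ[𝓝 z] dzbar^[k] g := fun k => by
    induction k with
    | zero => exact h
    | succ k ih =>
      rw [Function.iterate_succ_apply', Function.iterate_succ_apply']
      exact dzbar_eventuallyEq ih
  filter_upwards [eventually_all.2 fun i : Fin (n + 1) => hk i] with w hw
  exact Finset.sum_congr rfl fun k hk => by rw [hw ⟨k, Finset.mem_range.1 hk⟩]

theorem opZ_zero (n : ℕ) (c : ℕ → ℂ → ℂ) : opZ n c (fun _ => 0) z = 0 := by
  simpa using opZ_const_mul (n := n) c 0 (fun _ => 0) z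

theorem opZbar_zero (n : ℕ) (c : ℕ → ℂ → ℂ) : opZbar n c (fun _ => 0) z = 0 := by
  simpa using opZbar_const_mul (n := n) c 0 (fun _ => 0) z

/-- A function smooth on an open set coincides near every point with a globally smooth function. -/
theorem exists_contDiff_eventuallyEq {U : Set ℂ} (hU : IsOpen U) (hf : ContDiffOn ℝ ∞ f U)
    (hz : z ∈ U) : ∃ g : ℂ → ℂ, ContDiff ℝ ∞ g ∧ g =ᶠ[𝓝 z] f := by
  obtain ⟨r, hr, hrU⟩ := Metric.isOpen_iff.1 hU z hz
  let χ : ContDiffBump z := ⟨r / 4, r / 2, by positivity, by linarith⟩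
  refine ⟨fun w => (χ w : ℂ) * f w, contDiff_iff_contDiffAt.2 fun w => ?_, ?_⟩
  · by_cases hw : w ∈ U
    · exact (Complex.ofRealCLM.contDiff.contDiffAt.comp w χ.contDiffAt).mul
        (hf.contDiffAt (hU.mem_nhds hw))
    · have h1 : w ∉ tsupport χ := by
        rw [χ.tsupport_eq]
        intro h2
        refine hw (hrU ?_)
        have h3 : dist w z ≤ r / 2 := h2
        exact Metric.mem_ball.2 (by linarith)
      have h2 : (fun w => (χ w : ℂ) * f w) =ᶠ[𝓝 w] fun _ => 0 := by
        filter_upwards [notMem_tsupport_iff_eventuallyEq.1 h1] with v hv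
        rw [hv]
        simp
      exact contDiffAt_const.congr_of_eventuallyEq h2
  · filter_upwards [χ.eventuallyEq_one] with w hw
    rw [hw]
    simp

/-- The compatibility identity is stated for globally smooth functions. A local solution is replaced
near `z` by a global extension; the arguments of `Λ` then vanish in a neighbourhood of `z`, and so
does the right side at `z`. -/
theorem IsDSIIOperators.mixed_derivatives {n : ℕ} {α γ : ℂ} {p q P Q : ℂ → ℂ} {M : LaxCoeffs}
    (h : IsDSIIOperators n α γ p q P Q M) {U : Set ℂ} {ψ φ : ℂ → ℂ} (hU : IsOpen U)
    (hψ : ContDiffOn ℝ ∞ ψ U) (hφ : ContDiffOn ℝ ∞ φ U) (hs : IsDiracSolution U p q ψ φ)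
    (hz : z ∈ U) :
    dz (M.fst n ψ φ) z = P z * φ z + p z * M.snd n ψ φ z ∧
      dzbar (M.snd n ψ φ) z = Q z * ψ z + q z * M.fst n ψ φ z := by
  obtain ⟨ψ', hψ', hψψ'⟩ := exists_contDiff_eventuallyEq hU hψ hz
  obtain ⟨φ', hφ', hφφ'⟩ := exists_contDiff_eventuallyEq hU hφ hz
  obtain ⟨l₁₁, l₁₂, l₂₁, l₂₂, hl⟩ := h.compat
  have h1 := hl ψ' φ' hψ' hφ' z
  have hf : M.fst n ψ' φ' =ᶠ[𝓝 z] M.fst n ψ φ := by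
    filter_upwards [opZbar_eventuallyEq n M.a hψψ', opZ_eventuallyEq n M.b hφφ'] with w hw hw'
    simp only [LaxCoeffs.fst, hw, hw']
  have hs' : M.snd n ψ' φ' =ᶠ[𝓝 z] M.snd n ψ φ := by
    filter_upwards [opZbar_eventuallyEq n M.c hψψ', opZ_eventuallyEq n M.d hφφ'] with w hw hw'
    simp only [LaxCoeffs.snd, hw, hw']
  have hr₁ : (fun w => dz ψ' w - p w * φ' w) =ᶠ[𝓝 z] fun _ => 0 := by
    filter_upwards [dz_eventuallyEq hψψ', hφφ', hU.mem_nhds hz] with w hw hw' hwU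
    rw [hw, hw', (hs w hwU).1, sub_self]
  have hr₂ : (fun w => dzbar φ' w - q w * ψ' w) =ᶠ[𝓝 z] fun _ => 0 := by
    filter_upwards [dzbar_eventuallyEq hφφ', hψψ', hU.mem_nhds hz] with w hw hw' hwU
    rw [hw, hw', (hs w hwU).2, sub_self]
  rw [(opZbar_eventuallyEq n l₁₁ hr₁).eq_of_nhds, (opZbar_eventuallyEq n l₁₂ hr₂).eq_of_nhds,
    (opZ_eventuallyEq n l₂₁ hr₁).eq_of_nhds, (opZ_eventuallyEq n l₂₂ hr₂).eq_of_nhds,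
    (dz_eventuallyEq hf).eq_of_nhds, (dzbar_eventuallyEq hs').eq_of_nhds, hf.eq_of_nhds,
    hs'.eq_of_nhds, hψψ'.eq_of_nhds, hφφ'.eq_of_nhds, opZ_zero, opZ_zero, opZbar_zero,
    opZbar_zero] at h1
  exact ⟨by linear_combination h1.1, by linear_combination h1.2⟩

end Local

/-! ### Conservation of `∫ p q` -/

open Smooth MeasureTheory

theorem DecaysTo.integral_wirtinger {r : ℝ} {f : ℂ → ℂ} (c : ℂ) (hf : DecaysTo r f) (hr : 2 < r) :
    ∫ z, wirtinger c (_root_.fderiv ℝ f z) = 0 := by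
  have h := (decaysTo_const (1 : ℂ)).integral_mul_wirtinger c hf (by rwa [zero_add])
  simpa using h

theorem DecaysTo.integral_dz {r : ℝ} {f : ℂ → ℂ} (hf : DecaysTo r f) (hr : 2 < r) :
    ∫ z, DSII.dz f z = 0 := by
  rw [dz_eq_wirtinger]
  exact hf.integral_wirtinger _ hr

theorem DecaysTo.integral_dzbar {r : ℝ} {f : ℂ → ℂ} (hf : DecaysTo r f) (hr : 2 < r) :
    ∫ z, DSII.dzbar f z = 0 := by
  rw [dzbar_eq_wirtinger]
  exact hf.integral_wirtinger _ hr

theorem DecaysTo.integrable {r : ℝ} {f : ℂ → ℂ} (hf : DecaysTo r f) (hr : 2 < r) :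
    Integrable f := by
  simpa using (decaysTo_const (1 : ℂ)).integrable_mul hf (by rwa [zero_add])

theorem WirtingerPair.decays_diffOp_leftCoeff {d e : Derivation ℂ Smooth Smooth}
    (h : WirtingerPair d e) {n : ℕ} {s : ℝ} {a : ℕ → Smooth} {p q : Smooth}
    (ha : ∀ k ≤ n, DecaysTo 0 (a k : ℂ → ℂ)) (hp : DecaysTo s (p : ℂ → ℂ))
    (hq : DecaysTo s (q : ℂ → ℂ)) :
    DecaysTo (s + s) ((diffOp e n (leftCoeff e n a q) p : Smooth) : ℂ → ℂ) := by
  have hc := fun k => h.decays_leftCoeff ha hq k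
  rw [add_zero] at hc
  exact decaysTo_sum _ fun k _ => decaysTo_mul (hc k) (h.decays_iterate hp k)

/-- The flows of the hierarchy are infinitesimally orthogonal to `∫ p q`. -/
theorem IsDSIIOperators.integral_velocity {n : ℕ} {α γ : ℂ} {s : ℝ} {p q P Q : ℂ → ℂ}
    {M : LaxCoeffs} (hM : IsDSIIOperators n α γ p q P Q M) (hs : 1 < s) (hp : Decays s p)
    (hq : Decays s q) : ∫ z, (P z * q z + p z * Q z) = 0 := by
  obtain ⟨p, rfl⟩ : ∃ f : Smooth, (f : ℂ → ℂ) = p := ⟨⟨p, hp.1⟩, rfl⟩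
  obtain ⟨q, rfl⟩ : ∃ f : Smooth, (f : ℂ → ℂ) = q := ⟨⟨q, hq.1⟩, rfl⟩
  obtain ⟨a, g, hag, -, -, rfl, rfl⟩ := hM.exists_coeffEquations
  have hbdd : ∀ (c : ℂ) (m : ℕ → ℂ → ℂ) (f : ℕ → Smooth), (∀ k ≤ n, m k = f k) →
      (∀ z, m n z = c) → (∀ k < n, Vanishes (m k)) → ∀ k ≤ n, DecaysTo 0 (f k : ℂ → ℂ) := by
    intro c m f hmf hc hv k hk
    rw [← hmf k hk]
    rcases hk.lt_or_eq with hk | rfl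
    · exact (hv k hk).decaysTo_zero
    · rw [funext hc]
      exact decaysTo_const c
  have ha := hbdd α M.a a (fun k hk => (hag k hk).1) hM.lead_a
    fun k hk => ⟨(hM.smooth k hk.le).1, hM.lower_a k hk⟩
  have hg := hbdd γ M.d g (fun k hk => (hag k hk).2) hM.lead_d
    fun k hk => ⟨(hM.smooth k hk.le).2.2.2, hM.lower_d k hk⟩
  have h1 := wirtingerPair_del.decays_diffOp_leftCoeff ha hp.decaysTo hq.decaysTo
  have h2 := wirtingerPair_delbar.decays_diffOp_leftCoeff hg hq.decaysTo hp.decaysTo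
  have hs2 : 2 < s + s := by linarith
  -- The identities `∂̄C = qA + m` and `∂B = pD + m'`, applied to `p` and `q` respectively, exhibit
  -- the density as a divergence.
  have key : (diffOp delbar n a p + (del (leftCoeff del n g p 0) - p * g 0)) * q +
      p * (diffOp del n g q + (delbar (leftCoeff delbar n a q 0) - q * a 0)) =
      delbar (diffOp delbar n (leftCoeff delbar n a q) p) +
        del (diffOp del n (leftCoeff del n g p) q) := by
    rw [derivation_diffOp_leftCoeff, derivation_diffOp_leftCoeff]
    ring
  have key' := congrArg (fun f : Smooth => ∫ z, (f : ℂ → ℂ) z) key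
  refine key'.trans ?_
  change ∫ z, (dzbar (diffOp delbar n (leftCoeff delbar n a q) p : Smooth) z +
    dz (diffOp del n (leftCoeff del n g p) q : Smooth) z) = 0
  rw [integral_add (h1.dzbar.integrable hs2) (h2.dz.integrable hs2), h1.integral_dzbar hs2,
    h2.integral_dz hs2, add_zero]

/-! ### Families of potentials depending on `t` and differentiation under the integral. -/

section Families

variable {J : Set ℝ} {f : ℝ → ℂ → ℂ} {t : ℝ}

theorem SmoothFamily.contDiff (hf : SmoothFamily J f) (ht : t ∈ J) : ContDiff ℝ ∞ (f t) :=
  contDiffOn_univ.1 (ContDiffOn.comp (g := fun x : ℝ × ℂ => f x.1 x.2) (f := fun z => (t, z)) hf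
    (contDiff_prodMk_right t).contDiffOn fun _ _ => ⟨ht, trivial⟩)

theorem SmoothFamily.hasDerivAt (hf : SmoothFamily J f) (hJ : IsOpen J) (ht : t ∈ J) (z : ℂ) :
    HasDerivAt (fun τ => f τ z) (fderiv ℝ (fun x : ℝ × ℂ => f x.1 x.2) (t, z) (1, 0)) t := by
  have h : HasFDerivAt (fun x : ℝ × ℂ => f x.1 x.2) _ (t, z) :=
    ((hf.contDiffAt ((hJ.prod isOpen_univ).mem_nhds ⟨ht, trivial⟩)).differentiableAt
      (by simp)).hasFDerivAt
  exact HasFDerivAt.comp_hasDerivAt (f := fun τ => (τ, z)) t h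
    ((hasDerivAt_id t).prodMk (hasDerivAt_const t z))

theorem SmoothFamily.hasDerivAt_dt (hf : SmoothFamily J f) (hJ : IsOpen J) (ht : t ∈ J) (z : ℂ) :
    HasDerivAt (fun τ => f τ z) (dt f t z) t :=
  (hf.hasDerivAt hJ ht z).differentiableAt.hasDerivAt

theorem SmoothFamily.continuous_dt (hf : SmoothFamily J f) (hJ : IsOpen J) (ht : t ∈ J) :
    Continuous (dt f t) := by
  have h : ∀ z, dt f t z = fderiv ℝ (fun x : ℝ × ℂ => f x.1 x.2) (t, z) (1, 0) := fun z =>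
    (hf.hasDerivAt hJ ht z).deriv
  rw [funext h]
  have h1 := hf.continuousOn_fderiv_of_isOpen (hJ.prod isOpen_univ) (by simp)
  have h2 : Continuous fun z : ℂ => fderiv ℝ (fun x : ℝ × ℂ => f x.1 x.2) (t, z) :=
    h1.comp_continuous (Continuous.prodMk_right t) fun _ => ⟨ht, trivial⟩
  exact h2.clm_apply continuous_const

variable {s : ℝ} {p q : ℝ → ℂ → ℂ}

theorem DecayingFamily.decays (hf : DecayingFamily s J f) (ht : t ∈ J) : Decays s (f t) :=
  ⟨hf.smooth.contDiff ht, fun m => by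
    obtain ⟨C, hC⟩ := hf.bound {t} (by simpa using ht) isCompact_singleton m
    exact ⟨C, hC t rfl⟩⟩

theorem DecayingFamily.hasDerivAt_integral_mul (hs : 1 < s) (hJ : IsOpen J)
    (hp : DecayingFamily s J p) (hq : DecayingFamily s J q) (ht : t ∈ J) :
    HasDerivAt (fun τ => ∫ z, p τ z * q τ z) (∫ z, (dt p t z * q t z + p t z * dt q t z)) t := by
  obtain ⟨r, hr, hrJ⟩ := Metric.isOpen_iff.1 hJ t ht
  have hKJ : Metric.closedBall t (r / 2) ⊆ J :=
    (Metric.closedBall_subset_ball (by linarith)).trans hrJ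
  have hK : IsCompact (Metric.closedBall t (r / 2)) := isCompact_closedBall t _
  have h0 : ∀ {f : ℝ → ℂ → ℂ}, DecayingFamily s J f → ∃ C : ℝ, ∀ τ ∈ Metric.closedBall t (r / 2),
      ∀ z, ‖f τ z‖ ≤ C * (1 + ‖z‖) ^ (-s) := fun h => by
    simpa using h.bound _ hKJ hK 0
  obtain ⟨C, hC⟩ := h0 hp
  obtain ⟨D, hD⟩ := h0 hq
  obtain ⟨C', hC'⟩ := hp.bound_dt _ hKJ hK
  obtain ⟨D', hD'⟩ := hq.bound_dt _ hKJ hK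
  have hmul : ∀ {a b A B : ℝ} {z : ℂ}, 0 ≤ a → 0 ≤ b → a ≤ A * (1 + ‖z‖) ^ (-s) →
      b ≤ B * (1 + ‖z‖) ^ (-s) → a * b ≤ A * B * (1 + ‖z‖) ^ (-(s + s)) := by
    intro a b A B z ha hb hA hB
    refine (mul_le_mul hA hB hb (ha.trans hA)).trans_eq ?_
    rw [neg_add, Real.rpow_add (by positivity)]
    ring
  refine (hasDerivAt_integral_of_dominated_loc_of_deriv_le
    (F' := fun τ z => dt p τ z * q τ z + p τ z * dt q τ z)
    (bound := fun z => (C' * D + C * D') * (1 + ‖z‖) ^ (-(s + s)))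
    (Metric.closedBall_mem_nhds t (half_pos hr)) ?_ ?_ ?_ ?_ ?_ ?_).2
  · filter_upwards [hJ.mem_nhds ht] with τ hτ
    exact ((hp.smooth.contDiff hτ).continuous.mul
      (hq.smooth.contDiff hτ).continuous).aestronglyMeasurable
  · exact (hp.decays ht).decaysTo.integrable_mul (hq.decays ht).decaysTo (by linarith)
  · exact (((hp.smooth.continuous_dt hJ ht).mul (hq.smooth.contDiff ht).continuous).add
      ((hp.smooth.contDiff ht).continuous.mul
        (hq.smooth.continuous_dt hJ ht))).aestronglyMeasurable
  · refine Filter.Eventually.of_forall fun z τ hτ => (norm_add_le _ _).trans ?_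
    rw [norm_mul, norm_mul, add_mul]
    exact add_le_add
      (hmul (norm_nonneg _) (norm_nonneg _) (hC' τ hτ z) (hD τ hτ z))
      (hmul (norm_nonneg _) (norm_nonneg _) (hC τ hτ z) (hD' τ hτ z))
  · exact (integrable_one_add_norm_complex (by linarith)).const_mul _
  · exact Filter.Eventually.of_forall fun z τ hτ =>
      (hp.smooth.hasDerivAt_dt hJ (hKJ hτ) z).mul (hq.smooth.hasDerivAt_dt hJ (hKJ hτ) z)

/-- `∫ p q` is an integral of motion. -/
theorem IsDSIIFlow.hasDerivAt_integral {n : ℕ} {α γ : ℂ} {M : ℝ → LaxCoeffs} (hs : 1 < s)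
    (hJ : IsOpen J) (hp : DecayingFamily s J p) (hq : DecayingFamily s J q)
    (h : IsDSIIFlow n α γ J p q M) (ht : t ∈ J) :
    HasDerivAt (fun τ => ∫ z, p τ z * q τ z) 0 t := by
  have h1 := hp.hasDerivAt_integral_mul hs hJ hq ht
  rwa [(h t ht).integral_velocity hs (hp.decays ht) (hq.decays ht)] at h1

theorem DecayingFamily.const_mul_conj (hp : DecayingFamily s J p) (c : ℂ) :
    DecayingFamily s J fun t z => c * conj (p t z) := by
  let L : ℂ →L[ℝ] ℂ := (ContinuousLinearMap.mul ℝ ℂ c).comp (Complex.conjCLE : ℂ →L[ℝ] ℂ)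
  refine ⟨L.contDiff.comp_contDiffOn hp.smooth, fun K hKJ hK m => ?_, fun K hKJ hK => ?_⟩
  · obtain ⟨C, hC⟩ := hp.bound K hKJ hK m
    refine ⟨‖L‖ * C, fun t ht z => ?_⟩
    refine (norm_iteratedFDeriv_clm_comp_le L (hp.smooth.contDiff (hKJ ht)) m z).trans ?_
    rw [mul_assoc]
    exact mul_le_mul_of_nonneg_left (hC t ht z) (norm_nonneg _)
  · obtain ⟨C, hC⟩ := hp.bound_dt K hKJ hK
    refine ⟨‖c‖ * C, fun t ht z => ?_⟩
    have h : dt (fun t z => c * conj (p t z)) t z = c * conj (dt p t z) := by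
      unfold dt
      rw [deriv_const_mul_field]
      congr 1
      exact deriv.star (f := fun τ => p τ z)
    rw [h, norm_mul, RCLike.norm_conj, mul_assoc]
    exact mul_le_mul_of_nonneg_left (hC t ht z) (norm_nonneg _)

end Families

/-! ### Contour integrals -/

section Contour

open MeasureTheory unitInterval

variable {F f g : ℂ → ℂ}

@[simp] theorem oneForm_apply (f g : ℂ → ℂ) (z v : ℂ) :
    oneForm f g z v = f z * v + g z * conj v := rfl

theorem continuous_oneForm (hf : Continuous f) (hg : Continuous g) :
    Continuous (oneForm f g) :=
  (hf.smul continuous_const).add (hg.smul continuous_const)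

theorem contDiff_oneForm (hf : ContDiff ℝ ∞ f) (hg : ContDiff ℝ ∞ g) :
    ContDiff ℝ ∞ (oneForm f g) :=
  (hf.smul contDiff_const).add (hg.smul contDiff_const)

/-- Only straight segments starting at `z` are needed to recover the differential. -/
theorem IsContourIntegral.hasFDerivAt (h : IsContourIntegral F f g) (hf : Continuous f)
    (hg : Continuous g) (z : ℂ) : HasFDerivAt F (oneForm f g z) z := by
  have h1 := (HasFDerivAt.curveIntegral_segment_source (a := z)
    (continuous_oneForm hf hg)).add_const (F z)
  refine h1.congr_of_eventuallyEq (Filter.Eventually.of_forall fun w => ?_)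
  have hw := h z w (Path.segment z w) <| ContDiffOn.congr
    (f := fun t : ℝ => AffineMap.lineMap z w t)
    (by simp only [AffineMap.lineMap_apply, vsub_eq_sub, vadd_eq_add]; fun_prop)
    fun t ht => Path.eqOn_extend_segment z w ht
  change F w = _ + F z
  rw [← hw, sub_add_cancel]

theorem isContourIntegral_of_hasFDerivAt (h : ∀ z, HasFDerivAt F (oneForm f g z) z)
    (hf : Continuous f) (hg : Continuous g) : IsContourIntegral F f g := by
  intro z₀ z Γ hΓ
  have hint : CurveIntegrable (oneForm f g) Γ :=
    (continuous_oneForm hf hg).continuousOn.curveIntegrable_of_contDiffOn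
      (s := Set.univ) hΓ fun _ => trivial
  rw [curveIntegral_def, intervalIntegral.integral_eq_sub_of_hasDerivAt_of_le zero_le_one
    (f := fun t => F (Γ.extend t)) ?_ (fun t ht => ?_) hint]
  · simp
  · exact (continuous_iff_continuousAt.2 fun z => (h z).continuousAt).comp_continuousOn
      hΓ.continuousOn
  · rw [curveIntegralFun_def]
    have hd : HasDerivWithinAt Γ.extend (derivWithin Γ.extend I t) I t :=
      ((hΓ.differentiableOn one_ne_zero) t (Set.Ioo_subset_Icc_self ht)).hasDerivWithinAt
    exact (h _).comp_hasDerivAt t (hd.hasDerivAt (Icc_mem_nhds ht.1 ht.2))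

theorem fderiv_eq_wirtinger (f : ℂ → ℂ) (z v : ℂ) :
    fderiv ℝ f z v = dz f z * v + dzbar f z * conj v := by
  have hv : v = v.re • (1 : ℂ) + v.im • Complex.I := by
    simp [Complex.re_add_im]
  have h : fderiv ℝ f z v =
      (v.re : ℂ) * fderiv ℝ f z 1 + (v.im : ℂ) * fderiv ℝ f z Complex.I := by
    conv_lhs => rw [hv, map_add, map_smul, map_smul]
    rfl
  have hc : conj v = (v.re : ℂ) - v.im * Complex.I := by
    apply Complex.ext <;> simp
  rw [h, hc]
  nth_rw 3 [← Complex.re_add_im v]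
  unfold dz dzbar
  linear_combination ((v.im : ℂ) * fderiv ℝ f z Complex.I) * Complex.I_mul_I

/-- The Poincaré lemma for `f dz + g dz̄`. -/
theorem hasFDerivAt_curveIntegral (hf : ContDiff ℝ ∞ f) (hg : ContDiff ℝ ∞ g)
    (hfg : ∀ z, dzbar f z = dz g z) (z : ℂ) :
    HasFDerivAt (fun w => curveIntegral (oneForm f g) (Path.segment 0 w)) (oneForm f g z) z := by
  have hω := (contDiff_oneForm hf hg).differentiable (by simp)
  have hd : ∀ z u v, fderiv ℝ (oneForm f g) z u v =
      fderiv ℝ f z u * v + fderiv ℝ g z u * conj v := by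
    intro z u v
    have h1 : HasFDerivAt (oneForm f g) _ z :=
      ((hf.differentiable (by simp) z).hasFDerivAt.smul_const (ContinuousLinearMap.id ℝ ℂ)).add
        ((hg.differentiable (by simp) z).hasFDerivAt.smul_const (Complex.conjCLE : ℂ →L[ℝ] ℂ))
    rw [h1.fderiv]
    rfl
  have h : HasFDerivWithinAt (fun w => curveIntegral (oneForm f g) (Path.segment 0 w))
      (oneForm f g z) Set.univ z :=
    convex_univ.hasFDerivWithinAt_curveIntegral_segment_of_hasFDerivWithinAt_symmetric
    (dω := fderiv ℝ (oneForm f g)) (a := 0) (b := z)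
    (fun x _ => (hω x).hasFDerivAt.hasFDerivWithinAt)
    (fun a _ u _ v _ => by
      rw [hd, hd, fderiv_eq_wirtinger f, fderiv_eq_wirtinger f, fderiv_eq_wirtinger g,
        fderiv_eq_wirtinger g, hfg]
      ring) trivial trivial
  exact hasFDerivWithinAt_univ.1 h

/-- The integral is the value at `0` of the convolution of the indicator of `(0, 1]` with `t ↦ b(t)
G(x, -t)`. The cutoff `b` equals `1` on `[-1, 1]` and provides the compact support under which
convolutions depend smoothly on parameters. -/
theorem contDiffOn_intervalIntegral {P : Type*} [NormedAddCommGroup P] [NormedSpace ℝ P]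
    {s : Set P} (hs : IsOpen s) {G : P → ℝ → ℂ}
    (hG : ContDiffOn ℝ ∞ (fun x : P × ℝ => G x.1 x.2) (s ×ˢ Set.univ)) :
    ContDiffOn ℝ ∞ (fun x => ∫ t in (0 : ℝ)..1, G x t) s := by
  let b : ContDiffBump (0 : ℝ) := ⟨1, 2, one_pos, one_lt_two⟩
  have h := contDiffOn_convolution_right_with_param_comp (n := ⊤) (𝕜 := ℝ)
    (μ := volume) (ContinuousLinearMap.lsmul ℝ ℝ : ℝ →L[ℝ] ℂ →L[ℝ] ℂ) (s := s)
    (v := fun _ => (0 : ℝ)) contDiffOn_const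
    (f := Set.indicator (Set.Ioc 0 1) fun _ => (1 : ℝ)) (g := fun x t => b t • G x (-t))
    (k := Metric.closedBall 0 2) hs (isCompact_closedBall _ _)
    (fun x t _ ht => by
      rw [b.zero_of_le_dist (not_le.1 fun h => ht h).le, zero_smul])
    (((integrable_indicator_iff measurableSet_Ioc).2
      (integrableOn_const (by simp))).locallyIntegrable)
    ((b.contDiff.comp contDiff_snd).contDiffOn.smul
      (hG.comp (contDiff_fst.prodMk contDiff_snd.neg).contDiffOn fun x hx => ⟨hx.1, trivial⟩))
  refine h.congr fun x _ => ?_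
  rw [intervalIntegral.integral_of_le zero_le_one, ← integral_indicator measurableSet_Ioc]
  refine integral_congr_ae (Filter.Eventually.of_forall fun t => ?_)
  by_cases ht : t ∈ Set.Ioc (0 : ℝ) 1
  · have hb : b (0 - t) = 1 := b.one_of_mem_closedBall (by
      rw [mem_closedBall_zero_iff, zero_sub, norm_neg, Real.norm_eq_abs, abs_of_pos ht.1]
      exact ht.2)
    simp only [Set.indicator_of_mem ht, hb]
    simp
  · simp only [Set.indicator_of_notMem ht]
    simp

/-- The primitive is the integral along the segment from `0` to `z`. Parametrized over `[0, 1]` it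
has an integrand jointly smooth in `t` and `z`, hence is smooth in both. -/
theorem exists_primitive_family {J : Set ℝ} (hJ : IsOpen J) {f g : ℝ → ℂ → ℂ}
    (hf : SmoothFamily J f) (hg : SmoothFamily J g)
    (hfg : ∀ t ∈ J, ∀ z, dzbar (f t) z = dz (g t) z) :
    ∃ F : ℝ → ℂ → ℂ, SmoothFamily J F ∧
      ∀ t ∈ J, ∀ z, HasFDerivAt (F t) (oneForm (f t) (g t) z) z := by
  refine ⟨fun t z => curveIntegral (oneForm (f t) (g t)) (Path.segment 0 z), ?_, fun t ht =>
    hasFDerivAt_curveIntegral (hf.contDiff ht) (hg.contDiff ht) (hfg t ht)⟩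
  have h : ∀ (t : ℝ) (z : ℂ), curveIntegral (oneForm (f t) (g t)) (Path.segment 0 z) =
      ∫ s in (0 : ℝ)..1, (f t (s • z) * z + g t (s • z) * conj z) := fun t z => by
    rw [curveIntegral_segment]
    simp [AffineMap.lineMap_apply]
  simp only [SmoothFamily, h]
  refine contDiffOn_intervalIntegral (hJ.prod isOpen_univ)
    (G := fun (x : ℝ × ℂ) s => f x.1 (s • x.2) * x.2 + g x.1 (s • x.2) * conj x.2) ?_
  have hm : ContDiff ℝ ∞ fun y : (ℝ × ℂ) × ℝ => (y.1.1, y.2 • y.1.2) := by fun_prop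
  have hz : ContDiff ℝ ∞ fun y : (ℝ × ℂ) × ℝ => y.1.2 := by fun_prop
  have hcomp : ∀ {f : ℝ → ℂ → ℂ}, SmoothFamily J f →
      ContDiffOn ℝ ∞ (fun y : (ℝ × ℂ) × ℝ => f y.1.1 (y.2 • y.1.2))
        ((J ×ˢ Set.univ) ×ˢ Set.univ) := fun hf =>
    ContDiffOn.comp (g := fun x : ℝ × ℂ => _) hf hm.contDiffOn fun y hy => ⟨hy.1.1, trivial⟩
  exact ((hcomp hf).mul hz.contDiffOn).add
    ((hcomp hg).mul (Complex.conjCLE.contDiff.comp hz).contDiffOn)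

end Contour

/-! ### Conformal immersions with prescribed `∂X` -/

section Immersion

variable {η : Fin 4 → ℝ} {X : ℂ → Fin 4 → ℝ} {h : Fin 4 → ℂ → ℂ} {l : ℂ → ℝ}

/-- `∂X = h`, where `X` is real and `h` is smooth. -/
structure IsHolomorphicDifferential (X : ℂ → Fin 4 → ℝ) (h : Fin 4 → ℂ → ℂ) : Prop where
  smooth : ∀ i, ContDiff ℝ ∞ (h i)
  hasFDerivAt : ∀ i z, HasFDerivAt (fun w => (X w i : ℂ)) (oneForm (h i) (fun w => conj (h i w)) z) z

namespace IsHolomorphicDifferential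

theorem contDiff (H : IsHolomorphicDifferential X h) : ContDiff ℝ ∞ X := by
  refine contDiff_pi.2 fun i => ?_
  have hc : ContDiff ℝ ∞ fun w => (X w i : ℂ) := by
    refine contDiff_infty_iff_fderiv.2
      ⟨fun z => (H.hasFDerivAt i z).differentiableAt, ?_⟩
    rw [funext fun z => (H.hasFDerivAt i z).fderiv]
    exact contDiff_oneForm (H.smooth i) (Complex.conjCLE.contDiff.comp (H.smooth i))
  exact Complex.reCLM.contDiff.comp hc

theorem fderiv_apply (H : IsHolomorphicDifferential X h) (z v : ℂ) (i : Fin 4) :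
    fderiv ℝ X z v i = 2 * (h i z * v).re := by
  have h1 : HasFDerivAt (fun w => X w i) (Complex.reCLM.comp _) z :=
    Complex.reCLM.hasFDerivAt.comp z (H.hasFDerivAt i z)
  have h2 := hasFDerivAt_pi'.1 (H.contDiff.differentiable (by simp) z).hasFDerivAt i
  have h3 := congrArg (fun L : ℂ →L[ℝ] ℝ => L v) (h2.unique h1)
  refine h3.trans ?_
  change (h i z * v + conj (h i z) * conj v).re = _
  rw [← map_mul, Complex.add_re, Complex.conj_re]
  ring

theorem dx_eq (H : IsHolomorphicDifferential X h) : dx X = fun z i => 2 * (h i z).re := by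
  funext z i
  rw [dx, H.fderiv_apply, mul_one]

theorem dy_eq (H : IsHolomorphicDifferential X h) : dy X = fun z i => -2 * (h i z).im := by
  funext z i
  rw [dy, H.fderiv_apply, Complex.mul_I_re]
  ring

/-- Since `h = X_z`, the left side is `X_{z z̄} = h_z̄`; taking the real part uses only the formulae
for `X_x` and `X_y`. -/
theorem laplacian_eq (H : IsHolomorphicDifferential X h) (z : ℂ) (i : Fin 4) :
    ((1 / 4 : ℝ) • (dx (dx X) z + dy (dy X) z)) i = (dzbar (h i) z).re := by
  have key : ∀ (c : ℝ) (L : ℂ →L[ℝ] ℝ) (z v : ℂ) (i : Fin 4),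
      fderiv ℝ (fun z (i : Fin 4) => c * L (h i z)) z v i = c * L (fderiv ℝ (h i) z v) := by
    intro c L z v i
    have h1 : ∀ i, HasFDerivAt (fun z => c * L (h i z)) (c • L.comp (fderiv ℝ (h i) z)) z :=
      fun i => (L.hasFDerivAt.comp z
        ((H.smooth i).differentiable (by simp) z).hasFDerivAt).const_smul c
    rw [(hasFDerivAt_pi.2 h1).fderiv]
    rfl
  have h1 : dx (dx X) z i = 2 * (fderiv ℝ (h i) z 1).re := by
    rw [H.dx_eq]
    exact key 2 Complex.reCLM z 1 i
  have h2 : dy (dy X) z i = -2 * (fderiv ℝ (h i) z Complex.I).im := by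
    rw [H.dy_eq]
    exact key (-2) Complex.imCLM z Complex.I i
  rw [Pi.smul_apply, Pi.add_apply, h1, h2, dzbar, smul_eq_mul,
    show (1 / 2 : ℂ) = ((1 / 2 : ℝ) : ℂ) by norm_num, Complex.re_ofReal_mul, Complex.add_re,
    Complex.I_mul_re]
  ring

/-- The sum `∑ η_i h_i²` equals `(⟨X_x, X_x⟩ - ⟨X_y, X_y⟩ - 2i⟨X_x, X_y⟩) / 4`, so its real and
imaginary parts express conformality. -/
theorem metric (H : IsHolomorphicDifferential X h) {z : ℂ}
    (hconf : ∑ i, (η i : ℂ) * h i z ^ 2 = 0) (hl : 2 * ∑ i, η i * ‖h i z‖ ^ 2 = l z) :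
    sprod η (dx X z) (dx X z) = l z ∧ sprod η (dy X z) (dy X z) = l z ∧
      sprod η (dx X z) (dy X z) = 0 := by
  have hre := congrArg Complex.re hconf
  have him := congrArg Complex.im hconf
  simp only [Complex.add_re, Complex.add_im, Complex.ofReal_re, Complex.ofReal_im,
    Fin.sum_univ_four, sq, Complex.mul_re, Complex.mul_im, Complex.zero_re, Complex.zero_im]
    at hre him
  simp only [Complex.sq_norm, Complex.normSq_apply, Fin.sum_univ_four] at hl
  rw [H.dx_eq, H.dy_eq]
  simp only [sprod, Fin.sum_univ_four]
  refine ⟨?_, ?_, ?_⟩ <;> linarith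

theorem isConformalImmersion (H : IsHolomorphicDifferential X h)
    (hconf : ∀ z, ∑ i, (η i : ℂ) * h i z ^ 2 = 0)
    (hl : ∀ z, 2 * ∑ i, η i * ‖h i z‖ ^ 2 = l z) (hl0 : ∀ z, l z ≠ 0) :
    IsConformalImmersion η X l :=
  ⟨H.contDiff, fun z => ⟨hl0 z, H.metric (hconf z) (hl z)⟩⟩

/-- As `g_{z z̄} = l / 2`, one has `H = 2 X_{z z̄} / l`, while `dS` has density `|l|`. For
indefinite metrics `l` may be negative, which leaves the sign in the formula. -/
theorem willmoreDensity_eq (H : IsHolomorphicDifferential X h) {z : ℂ}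
    (hconf : ∑ i, (η i : ℂ) * h i z ^ 2 = 0) (hl : 2 * ∑ i, η i * ‖h i z‖ ^ 2 = l z)
    (hl0 : l z ≠ 0) :
    willmoreDensity η X z = 4 * (∑ i, η i * (dzbar (h i) z).re ^ 2) / l z * SignType.sign (l z) := by
  obtain ⟨hxx, hyy, hxy⟩ := H.metric hconf hl
  have harea : areaDensity η X z = |l z| := by
    rw [areaDensity, hxx, hyy, hxy, show l z * l z - 0 ^ 2 = l z ^ 2 by ring,
      abs_of_nonneg (sq_nonneg _), Real.sqrt_sq_eq_abs]
  have hH : ∀ i, meanCurvature η X z i = 2 / l z * (dzbar (h i) z).re := fun i => by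
    rw [meanCurvature, hxx, hyy, Pi.smul_apply, H.laplacian_eq, smul_eq_mul]
    congr 1
    field_simp
    norm_num
  rw [willmoreDensity, harea, sprod]
  simp only [hH]
  have hs : |l z| = l z * SignType.sign (l z) := by
    rw [mul_comm]
    exact (sign_mul_self (l z)).symm
  rw [hs]
  simp only [Fin.sum_univ_four]
  field_simp
  ring

theorem surface (H : IsHolomorphicDifferential X h) {k : ℂ → ℝ}
    (hconf : ∀ z, ∑ i, (η i : ℂ) * h i z ^ 2 = 0)
    (hl : ∀ z, 2 * ∑ i, η i * ‖h i z‖ ^ 2 = l z) (hl0 : ∀ z, l z ≠ 0)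
    (hk : ∀ z, ∑ i, η i * (dzbar (h i) z).re ^ 2 = k z * l z) :
    IsConformalImmersion η X l ∧
      willmoreDensity η X = fun z => 4 * k z * SignType.sign (l z) := by
  refine ⟨H.isConformalImmersion hconf hl hl0, funext fun z => ?_⟩
  rw [H.willmoreDensity_eq (hconf z) (hl z) (hl0 z), hk]
  congr 1
  have := hl0 z
  field_simp

end IsHolomorphicDifferential

/-- The real and imaginary parts of a contour integral, as components of `∂X`. -/
def reDiff (f g : ℂ → ℂ) : ℂ → ℂ := fun z => (f z + conj (g z)) / 2

/-- See `reDiff`. -/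
def imDiff (f g : ℂ → ℂ) : ℂ → ℂ := fun z => -Complex.I * (f z - conj (g z)) / 2

/-- The differentials of the real and imaginary parts of `∫ f dz + g dz̄`. -/
theorem hasFDerivAt_re_im {F f g : ℂ → ℂ} {z : ℂ} (hF : HasFDerivAt F (oneForm f g z) z) :
    HasFDerivAt (fun w => ((F w).re : ℂ))
      (oneForm (reDiff f g) (fun w => conj (reDiff f g w)) z) z ∧
    HasFDerivAt (fun w => ((F w).im : ℂ))
      (oneForm (imDiff f g) (fun w => conj (imDiff f g w)) z) z := by
  have hre := (Complex.ofRealCLM.comp Complex.reCLM).hasFDerivAt.comp z hF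
  have him := (Complex.ofRealCLM.comp Complex.imCLM).hasFDerivAt.comp z hF
  refine ⟨hre.congr_fderiv ?_, him.congr_fderiv ?_⟩
  · ext v
    change (((f z * v + g z * conj v).re : ℝ) : ℂ) =
      (f z + conj (g z)) / 2 * v + conj ((f z + conj (g z)) / 2) * conj v
    rw [Complex.re_eq_add_conj]
    simp only [map_add, map_mul, map_div₀, Complex.conj_conj, map_ofNat]
    ring
  · ext v
    change (((f z * v + g z * conj v).im : ℝ) : ℂ) =
      -Complex.I * (f z - conj (g z)) / 2 * v +
        conj (-Complex.I * (f z - conj (g z)) / 2) * conj v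
    rw [Complex.im_eq_sub_conj]
    simp only [map_add, map_sub, map_neg, map_mul, map_div₀, Complex.conj_conj, map_ofNat,
      Complex.conj_I]
    field_simp
    rw [Complex.I_sq]
    ring

theorem contDiff_conj_comp {f : ℂ → ℂ} (hf : ContDiff ℝ ∞ f) : ContDiff ℝ ∞ fun z => conj (f z) :=
  Complex.conjCLE.contDiff.comp hf

/-- By closedness `f_z̄ = g_z` is the mixed derivative of the complex primitive; its real and
imaginary parts are the Laplacian terms of the two components. -/
theorem dzbar_reDiff_imDiff {f g : ℂ → ℂ} (hf : ContDiff ℝ ∞ f) (hg : ContDiff ℝ ∞ g)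
    (hfg : ∀ z, dzbar f z = dz g z) (z : ℂ) :
    (dzbar (reDiff f g) z).re = (dzbar f z).re ∧ (dzbar (imDiff f g) z).re = (dzbar f z).im := by
  have hf' := hf.differentiable (by simp) z
  have hg' := (contDiff_conj_comp hg).differentiable (by simp) z
  constructor
  · have h : reDiff f g = fun w => (1 / 2 : ℂ) * (f w + conj (g w)) := by
      funext w
      simp only [reDiff]
      ring
    rw [h, dzbar_const_mul, dzbar_add hf' hg', dzbar_conj, ← hfg, Complex.add_conj]
    rw [show (1 / 2 : ℂ) = ((1 / 2 : ℝ) : ℂ) by norm_num, ← Complex.ofReal_mul, Complex.ofReal_re]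
    ring
  · have h : imDiff f g =
        fun w => (-Complex.I / 2) * (f w + (-1) * conj (g w)) := by
      funext w
      simp only [imDiff]
      ring
    rw [h, dzbar_const_mul, dzbar_add hf' (hg'.const_mul _), dzbar_const_mul, dzbar_conj, ← hfg]
    have : dzbar f z + -1 * conj (dzbar f z) = (2 * (dzbar f z).im : ℝ) * Complex.I := by
      rw [← Complex.sub_conj]
      ring
    rw [this, show -Complex.I / 2 * (((2 * (dzbar f z).im : ℝ) : ℂ) * Complex.I) =
      (((dzbar f z).im : ℝ) : ℂ) by
        push_cast
        linear_combination (-((dzbar f z).im : ℂ)) * Complex.I_mul_I, Complex.ofReal_re]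

end Immersion

/-! ### Surfaces given by two complex contour integrals -/

section Pairs

open MeasureTheory

variable {X : ℂ → Fin 4 → ℝ} {f₁ g₁ f₂ g₂ : ℂ → ℂ} {l k : ℂ → ℝ}

theorem contDiff_reDiff (hf : ContDiff ℝ ∞ f₁) (hg : ContDiff ℝ ∞ g₁) :
    ContDiff ℝ ∞ (reDiff f₁ g₁) :=
  (hf.add (contDiff_conj_comp hg)).div_const 2

theorem contDiff_imDiff (hf : ContDiff ℝ ∞ f₁) (hg : ContDiff ℝ ∞ g₁) :
    ContDiff ℝ ∞ (imDiff f₁ g₁) :=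
  (contDiff_const.mul (hf.sub (contDiff_conj_comp hg))).div_const 2

theorem reDiff_sq_add_imDiff_sq (z : ℂ) :
    reDiff f₁ g₁ z ^ 2 + imDiff f₁ g₁ z ^ 2 = f₁ z * conj (g₁ z) := by
  unfold reDiff imDiff
  linear_combination ((f₁ z - conj (g₁ z)) ^ 2 / 4) * Complex.I_sq

theorem norm_reDiff_sq_add_norm_imDiff_sq (z : ℂ) :
    2 * (‖reDiff f₁ g₁ z‖ ^ 2 + ‖imDiff f₁ g₁ z‖ ^ 2) = ‖f₁ z‖ ^ 2 + ‖g₁ z‖ ^ 2 := by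
  have h := parallelogram_law_with_norm ℝ (f₁ z) (conj (g₁ z))
  rw [RCLike.norm_conj] at h
  unfold reDiff imDiff
  simp only [norm_div, norm_mul, norm_neg, Complex.norm_I, Complex.norm_ofNat, one_mul]
  linarith

theorem IsContourIntegral.hasFDerivAt_components {i j : Fin 4}
    (h : IsContourIntegral (fun z => X z i + Complex.I * X z j) f₁ g₁) (hf : ContDiff ℝ ∞ f₁)
    (hg : ContDiff ℝ ∞ g₁) (z : ℂ) :
    HasFDerivAt (fun w => (X w i : ℂ))
      (oneForm (reDiff f₁ g₁) (fun w => conj (reDiff f₁ g₁ w)) z) z ∧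
    HasFDerivAt (fun w => (X w j : ℂ))
      (oneForm (imDiff f₁ g₁) (fun w => conj (imDiff f₁ g₁ w)) z) z := by
  have h1 := hasFDerivAt_re_im (h.hasFDerivAt hf.continuous hg.continuous z)
  have hre : ∀ w, ((X w i : ℂ) + Complex.I * X w j).re = X w i := by simp
  have him : ∀ w, ((X w i : ℂ) + Complex.I * X w j).im = X w j := by simp
  simpa only [hre, him] using h1

/-- Each complex coordinate contributes `f ḡ` to `∑ η_i h_i²`, `|f|² + |g|²` to the metric and
`|f_z̄|²` to `⟨X_{z z̄}, X_{z z̄}⟩`. The sign `e` of the second plane treats `R^4` and `R^{2,2}`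
together. -/
theorem pair_surface {e : ℝ} (hf₁ : ContDiff ℝ ∞ f₁) (hg₁ : ContDiff ℝ ∞ g₁)
    (hf₂ : ContDiff ℝ ∞ f₂) (hg₂ : ContDiff ℝ ∞ g₂)
    (h₁ : IsContourIntegral (fun z => X z 0 + Complex.I * X z 1) f₁ g₁)
    (h₂ : IsContourIntegral (fun z => X z 2 + Complex.I * X z 3) f₂ g₂)
    (hfg₁ : ∀ z, dzbar f₁ z = dz g₁ z) (hfg₂ : ∀ z, dzbar f₂ z = dz g₂ z)
    (hconf : ∀ z, f₁ z * conj (g₁ z) + e * (f₂ z * conj (g₂ z)) = 0)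
    (hl : ∀ z, ‖f₁ z‖ ^ 2 + ‖g₁ z‖ ^ 2 + e * (‖f₂ z‖ ^ 2 + ‖g₂ z‖ ^ 2) = l z)
    (hl0 : ∀ z, l z ≠ 0)
    (hk : ∀ z, ‖dzbar f₁ z‖ ^ 2 + e * ‖dzbar f₂ z‖ ^ 2 = k z * l z) :
    IsConformalImmersion ![1, 1, e, e] X l ∧
      willmoreDensity ![1, 1, e, e] X = fun z => 4 * k z * SignType.sign (l z) := by
  have H : IsHolomorphicDifferential X
      ![reDiff f₁ g₁, imDiff f₁ g₁, reDiff f₂ g₂, imDiff f₂ g₂] := by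
    refine ⟨fun i => ?_, fun i z => ?_⟩
    · fin_cases i
      exacts [contDiff_reDiff hf₁ hg₁, contDiff_imDiff hf₁ hg₁, contDiff_reDiff hf₂ hg₂,
        contDiff_imDiff hf₂ hg₂]
    · have H₁ := h₁.hasFDerivAt_components hf₁ hg₁ z
      have H₂ := h₂.hasFDerivAt_components hf₂ hg₂ z
      fin_cases i
      exacts [H₁.1, H₁.2, H₂.1, H₂.2]
  refine H.surface (fun z => ?_) (fun z => ?_) hl0 fun z => ?_
  · have h1 := reDiff_sq_add_imDiff_sq (f₁ := f₁) (g₁ := g₁) z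
    have h2 := reDiff_sq_add_imDiff_sq (f₁ := f₂) (g₁ := g₂) z
    simp only [Fin.sum_univ_four, Matrix.cons_val, Complex.ofReal_one, one_mul]
    linear_combination h1 + e * h2 + hconf z
  · have h1 := norm_reDiff_sq_add_norm_imDiff_sq (f₁ := f₁) (g₁ := g₁) z
    have h2 := norm_reDiff_sq_add_norm_imDiff_sq (f₁ := f₂) (g₁ := g₂) z
    simp only [Fin.sum_univ_four, Matrix.cons_val, one_mul]
    linear_combination h1 + e * h2 + hl z
  · have h1 := dzbar_reDiff_imDiff hf₁ hg₁ hfg₁ z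
    have h2 := dzbar_reDiff_imDiff hf₂ hg₂ hfg₂ z
    have h3 := hk z
    simp only [Complex.sq_norm, Complex.normSq_apply] at h3
    simp only [Fin.sum_univ_four, Matrix.cons_val, one_mul, h1, h2]
    linear_combination h3

/-- Surfaces in `R^{3,1}` are given by a complex and two real contour integrals. -/
theorem triple_surface {fR fS : ℂ → ℂ} (hf₁ : ContDiff ℝ ∞ f₁) (hg₁ : ContDiff ℝ ∞ g₁)
    (hfR : ContDiff ℝ ∞ fR) (hfS : ContDiff ℝ ∞ fS)
    (h₁ : IsContourIntegral (fun z => X z 0 + Complex.I * X z 1) f₁ g₁)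
    (hR : IsContourIntegral (fun z => X z 2 + X z 3) fR fun z => conj (fR z))
    (hS : IsContourIntegral (fun z => X z 2 - X z 3) fS fun z => conj (fS z))
    (hfg₁ : ∀ z, dzbar f₁ z = dz g₁ z)
    (hconf : ∀ z, f₁ z * conj (g₁ z) + fR z * fS z = 0)
    (hl : ∀ z, ‖f₁ z‖ ^ 2 + ‖g₁ z‖ ^ 2 + 2 * (fR z * conj (fS z)).re = l z)
    (hl0 : ∀ z, l z ≠ 0)
    (hk : ∀ z, ‖dzbar f₁ z‖ ^ 2 + (dzbar fR z).re * (dzbar fS z).re = k z * l z) :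
    IsConformalImmersion sigR31 X l ∧
      willmoreDensity sigR31 X = fun z => 4 * k z * SignType.sign (l z) := by
  have hR' := hR.hasFDerivAt hfR.continuous (contDiff_conj_comp hfR).continuous
  have hS' := hS.hasFDerivAt hfS.continuous (contDiff_conj_comp hfS).continuous
  have hadd : ∀ z, HasFDerivAt (fun w => (X w 2 : ℂ)) (oneForm (fun w => 1 / 2 * (fR w + fS w))
      (fun w => conj (1 / 2 * (fR w + fS w))) z) z := fun z => by
    refine ((((hR' z).add (hS' z)).const_mul (1 / 2 : ℂ)).congr_fderiv ?_).congr_of_eventuallyEq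
      (Filter.Eventually.of_forall fun w => ?_)
    · ext v
      change (1 / 2 : ℂ) * ((fR z * v + conj (fR z) * conj v) + (fS z * v + conj (fS z) * conj v)) =
        1 / 2 * (fR z + fS z) * v + conj (1 / 2 * (fR z + fS z)) * conj v
      simp only [map_add, map_mul, map_div₀, map_one, map_ofNat]
      ring
    · change (X w 2 : ℂ) = 1 / 2 * (((X w 2 : ℂ) + X w 3) + ((X w 2 : ℂ) - X w 3))
      ring
  have hsub : ∀ z, HasFDerivAt (fun w => (X w 3 : ℂ))
      (oneForm (fun w => 1 / 2 * (fR w + -1 * fS w))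
      (fun w => conj (1 / 2 * (fR w + -1 * fS w))) z) z := fun z => by
    refine ((((hR' z).sub (hS' z)).const_mul (1 / 2 : ℂ)).congr_fderiv ?_).congr_of_eventuallyEq
      (Filter.Eventually.of_forall fun w => ?_)
    · ext v
      change (1 / 2 : ℂ) * ((fR z * v + conj (fR z) * conj v) - (fS z * v + conj (fS z) * conj v)) =
        1 / 2 * (fR z + -1 * fS z) * v + conj (1 / 2 * (fR z + -1 * fS z)) * conj v
      simp only [map_add, map_mul, map_neg, map_div₀, map_one, map_ofNat]
      ring
    · change (X w 3 : ℂ) = 1 / 2 * (((X w 2 : ℂ) + X w 3) - ((X w 2 : ℂ) - X w 3))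
      ring
  have H : IsHolomorphicDifferential X ![reDiff f₁ g₁, imDiff f₁ g₁,
      fun w => 1 / 2 * (fR w + fS w), fun w => 1 / 2 * (fR w + -1 * fS w)] := by
    refine ⟨fun i => ?_, fun i z => ?_⟩
    · fin_cases i
      exacts [contDiff_reDiff hf₁ hg₁, contDiff_imDiff hf₁ hg₁,
        contDiff_const.mul (hfR.add hfS),
        contDiff_const.mul (hfR.add (contDiff_const.mul hfS))]
    · have H₁ := h₁.hasFDerivAt_components hf₁ hg₁ z
      fin_cases i
      exacts [H₁.1, H₁.2, hadd z, hsub z]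
  refine H.surface (fun z => ?_) (fun z => ?_) hl0 fun z => ?_
  · have h1 := reDiff_sq_add_imDiff_sq (f₁ := f₁) (g₁ := g₁) z
    simp only [sigR31, Fin.sum_univ_four, Matrix.cons_val, Complex.ofReal_one,
      Complex.ofReal_neg, one_mul]
    linear_combination h1 + hconf z
  · have h1 := norm_reDiff_sq_add_norm_imDiff_sq (f₁ := f₁) (g₁ := g₁) z
    have h2 : ‖fR z + fS z‖ ^ 2 - ‖fR z + -1 * fS z‖ ^ 2 = 4 * (fR z * conj (fS z)).re := by
      simp only [Complex.sq_norm, Complex.normSq_apply, Complex.add_re, Complex.add_im,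
        Complex.mul_re, Complex.mul_im, Complex.conj_re, Complex.conj_im, Complex.neg_re,
        Complex.neg_im, Complex.one_re, Complex.one_im]
      ring
    simp only [sigR31, Fin.sum_univ_four, Matrix.cons_val, one_mul, norm_mul, norm_div,
      norm_one, Complex.norm_ofNat]
    linear_combination h1 + h2 / 2 + hl z
  · have h1 := dzbar_reDiff_imDiff hf₁ hg₁ hfg₁ z
    have h3 := hk z
    have hR1 := hfR.differentiable (by simp) z
    have hS1 := hfS.differentiable (by simp) z
    have hhalf : (1 / 2 : ℂ) = ((1 / 2 : ℝ) : ℂ) := by norm_num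
    simp only [Complex.sq_norm, Complex.normSq_apply] at h3
    simp only [sigR31, Fin.sum_univ_four, Matrix.cons_val, one_mul, h1,
      dzbar_const_mul, dzbar_add hR1 hS1, dzbar_add hR1 (hS1.const_mul (-1))]
    rw [hhalf, Complex.re_ofReal_mul, Complex.re_ofReal_mul, Complex.add_re, Complex.add_re,
      show (-1 * dzbar fS z).re = -(dzbar fS z).re by simp]
    linear_combination h3

end Pairs

/-! ### Smooth families of surfaces from closed Weierstrass forms. -/

section Existence

variable {J : Set ℝ}

theorem SmoothFamily.mul {f g : ℝ → ℂ → ℂ} (hf : SmoothFamily J f) (hg : SmoothFamily J g) :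
    SmoothFamily J fun t z => f t z * g t z := ContDiffOn.mul hf hg

theorem SmoothFamily.neg {f : ℝ → ℂ → ℂ} (hf : SmoothFamily J f) :
    SmoothFamily J fun t z => -f t z := ContDiffOn.neg hf

theorem SmoothFamily.conj {f : ℝ → ℂ → ℂ} (hf : SmoothFamily J f) :
    SmoothFamily J fun t z => conj (f t z) := Complex.conjCLE.contDiff.comp_contDiffOn hf

theorem SmoothFamily.const_mul {f : ℝ → ℂ → ℂ} (c : ℂ) (hf : SmoothFamily J f) :
    SmoothFamily J fun t z => c * f t z := contDiffOn_const.mul hf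

theorem hasFDerivAt_conj_oneForm {F f g : ℂ → ℂ} {z : ℂ} (h : HasFDerivAt F (oneForm f g z) z) :
    HasFDerivAt (fun w => conj (F w))
      (oneForm (fun w => conj (g w)) (fun w => conj (f w)) z) z := by
  refine ((Complex.conjCLE : ℂ →L[ℝ] ℂ).hasFDerivAt.comp z h).congr_fderiv ?_
  ext v
  change conj (f z * v + g z * conj v) = conj (g z) * v + conj (f z) * conj v
  simp only [map_add, map_mul, Complex.conj_conj]
  ring

theorem isContourIntegral_pair {F f g : ℂ → ℂ} (h : ∀ z, HasFDerivAt F (oneForm f g z) z)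
    (hf : Continuous f) (hg : Continuous g) :
    IsContourIntegral (fun z => (F z).re + Complex.I * (F z).im) f g ∧
      IsContourIntegral (fun z => (F z).re - Complex.I * (F z).im)
        (fun z => conj (g z)) (fun z => conj (f z)) := by
  have h1 : (fun z => ((F z).re : ℂ) + Complex.I * (F z).im) = F := by
    funext z
    rw [mul_comm, Complex.re_add_im]
  have h2 : (fun z => ((F z).re : ℂ) - Complex.I * (F z).im) = fun z => conj (F z) := by
    funext z
    apply Complex.ext <;> simp
  rw [h1, h2]
  exact ⟨isContourIntegral_of_hasFDerivAt h hf hg,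
    isContourIntegral_of_hasFDerivAt (fun z => hasFDerivAt_conj_oneForm (h z))
      (Complex.continuous_conj.comp hg) (Complex.continuous_conj.comp hf)⟩

theorem exists_surface_pair (hJ : IsOpen J) {f₁ g₁ f₂ g₂ : ℝ → ℂ → ℂ}
    (hf₁ : SmoothFamily J f₁) (hg₁ : SmoothFamily J g₁) (hf₂ : SmoothFamily J f₂)
    (hg₂ : SmoothFamily J g₂) (h₁ : ∀ t ∈ J, ∀ z, dzbar (f₁ t) z = dz (g₁ t) z)
    (h₂ : ∀ t ∈ J, ∀ z, dzbar (f₂ t) z = dz (g₂ t) z) :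
    ∃ X : ℝ → ℂ → Fin 4 → ℝ, SmoothSurfaceFamily J X ∧ ∀ t ∈ J,
      IsContourIntegral (fun z => X t z 0 + Complex.I * X t z 1) (f₁ t) (g₁ t) ∧
      IsContourIntegral (fun z => X t z 0 - Complex.I * X t z 1)
        (fun z => conj (g₁ t z)) (fun z => conj (f₁ t z)) ∧
      IsContourIntegral (fun z => X t z 2 + Complex.I * X t z 3) (f₂ t) (g₂ t) ∧
      IsContourIntegral (fun z => X t z 2 - Complex.I * X t z 3)
        (fun z => conj (g₂ t z)) (fun z => conj (f₂ t z)) := by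
  obtain ⟨F, hF, hF'⟩ := exists_primitive_family hJ hf₁ hg₁ h₁
  obtain ⟨G, hG, hG'⟩ := exists_primitive_family hJ hf₂ hg₂ h₂
  refine ⟨fun t z => ![(F t z).re, (F t z).im, (G t z).re, (G t z).im],
    contDiffOn_pi.2 fun i => ?_, fun t ht => ?_⟩
  · fin_cases i
    exacts [Complex.reCLM.contDiff.comp_contDiffOn hF, Complex.imCLM.contDiff.comp_contDiffOn hF,
      Complex.reCLM.contDiff.comp_contDiffOn hG, Complex.imCLM.contDiff.comp_contDiffOn hG]
  · have p1 := isContourIntegral_pair (hF' t ht) (hf₁.contDiff ht).continuous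
      (hg₁.contDiff ht).continuous
    have p2 := isContourIntegral_pair (hG' t ht) (hf₂.contDiff ht).continuous
      (hg₂.contDiff ht).continuous
    exact ⟨p1.1, p1.2, p2.1, p2.2⟩

theorem isContourIntegral_re {F f : ℂ → ℂ}
    (h : ∀ z, HasFDerivAt F (oneForm f (fun w => conj (f w)) z) z) (hf : Continuous f) :
    IsContourIntegral (fun z => ((F z).re : ℂ)) f fun z => conj (f z) := by
  refine isContourIntegral_of_hasFDerivAt (fun z => ?_) hf (Complex.continuous_conj.comp hf)
  have h1 := (hasFDerivAt_re_im (h z)).1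
  have hf' : reDiff f (fun w => conj (f w)) = f := by
    funext w
    rw [reDiff, Complex.conj_conj, add_self_div_two]
  rwa [hf'] at h1

theorem exists_surface_triple (hJ : IsOpen J) {f₁ g₁ fR fS : ℝ → ℂ → ℂ}
    (hf₁ : SmoothFamily J f₁) (hg₁ : SmoothFamily J g₁) (hfR : SmoothFamily J fR)
    (hfS : SmoothFamily J fS) (h₁ : ∀ t ∈ J, ∀ z, dzbar (f₁ t) z = dz (g₁ t) z)
    (hR : ∀ t ∈ J, ∀ z, dzbar (fR t) z = dz (fun w => conj (fR t w)) z)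
    (hS : ∀ t ∈ J, ∀ z, dzbar (fS t) z = dz (fun w => conj (fS t w)) z) :
    ∃ X : ℝ → ℂ → Fin 4 → ℝ, SmoothSurfaceFamily J X ∧ ∀ t ∈ J,
      IsContourIntegral (fun z => X t z 0 + Complex.I * X t z 1) (f₁ t) (g₁ t) ∧
      IsContourIntegral (fun z => X t z 0 - Complex.I * X t z 1)
        (fun z => conj (g₁ t z)) (fun z => conj (f₁ t z)) ∧
      IsContourIntegral (fun z => X t z 2 + X t z 3) (fR t) (fun z => conj (fR t z)) ∧
      IsContourIntegral (fun z => X t z 2 - X t z 3) (fS t) (fun z => conj (fS t z)) := by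
  obtain ⟨F, hF, hF'⟩ := exists_primitive_family hJ hf₁ hg₁ h₁
  obtain ⟨G, hG, hG'⟩ := exists_primitive_family hJ hfR hfR.conj hR
  obtain ⟨H, hH, hH'⟩ := exists_primitive_family hJ hfS hfS.conj hS
  have hGr := Complex.reCLM.contDiff.comp_contDiffOn hG
  have hHr := Complex.reCLM.contDiff.comp_contDiffOn hH
  -- The last two coordinates are solved from the primitives of `X³ + X⁴` and `X³ - X⁴`. The forms
  -- `f dz + f̄ dz̄` are real, so the real parts of the primitives may be used.
  refine ⟨fun t z => ![(F t z).re, (F t z).im, ((G t z).re + (H t z).re) / 2,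
    ((G t z).re - (H t z).re) / 2], contDiffOn_pi.2 fun i => ?_, fun t ht => ?_⟩
  · fin_cases i
    exacts [Complex.reCLM.contDiff.comp_contDiffOn hF, Complex.imCLM.contDiff.comp_contDiffOn hF,
      (hGr.add hHr).div_const 2, (hGr.sub hHr).div_const 2]
  · have p1 := isContourIntegral_pair (hF' t ht) (hf₁.contDiff ht).continuous
      (hg₁.contDiff ht).continuous
    have p2 := isContourIntegral_re (hG' t ht) (hfR.contDiff ht).continuous
    have p3 := isContourIntegral_re (hH' t ht) (hfS.contDiff ht).continuous
    refine ⟨p1.1, p1.2, ?_, ?_⟩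
    · convert p2 using 2 with z
      simp only [Matrix.cons_val]
      push_cast
      ring
    · convert p3 using 2 with z
      simp only [Matrix.cons_val]
      push_cast
      ring

end Existence

/-! ### Deformations of surfaces -/

/-! ### Derivatives of the quadratic expressions in solutions that enter the Weierstrass forms. -/

section Products

variable {p₁ q₁ ψ₁ φ₁ p₂ q₂ ψ₂ φ₂ : ℂ → ℂ}

theorem dzbar_snd_mul_snd (h₁ : IsDiracSolution Set.univ p₁ q₁ ψ₁ φ₁)
    (h₂ : IsDiracSolution Set.univ p₂ q₂ ψ₂ φ₂) (hφ₁ : ContDiff ℝ ∞ φ₁) (hφ₂ : ContDiff ℝ ∞ φ₂)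
    (z : ℂ) : dzbar (fun w => φ₁ w * φ₂ w) z =
      q₁ z * ψ₁ z * φ₂ z + φ₁ z * (q₂ z * ψ₂ z) := by
  rw [dzbar_mul (hφ₁.differentiable (by simp) z) (hφ₂.differentiable (by simp) z),
    (h₁ z trivial).2, (h₂ z trivial).2]
  ring

theorem dz_fst_mul_fst (h₁ : IsDiracSolution Set.univ p₁ q₁ ψ₁ φ₁)
    (h₂ : IsDiracSolution Set.univ p₂ q₂ ψ₂ φ₂) (hψ₁ : ContDiff ℝ ∞ ψ₁) (hψ₂ : ContDiff ℝ ∞ ψ₂)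
    (z : ℂ) : dz (fun w => ψ₁ w * ψ₂ w) z =
      p₁ z * φ₁ z * ψ₂ z + ψ₁ z * (p₂ z * φ₂ z) := by
  rw [dz_mul (hψ₁.differentiable (by simp) z) (hψ₂.differentiable (by simp) z),
    (h₁ z trivial).1, (h₂ z trivial).1]
  ring

theorem dzbar_conj_fst_mul_snd (h₁ : IsDiracSolution Set.univ p₁ q₁ ψ₁ φ₁)
    (h₂ : IsDiracSolution Set.univ p₂ q₂ ψ₂ φ₂) (hψ₁ : ContDiff ℝ ∞ ψ₁) (hφ₂ : ContDiff ℝ ∞ φ₂)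
    (z : ℂ) : dzbar (fun w => conj (ψ₁ w) * φ₂ w) z =
      conj (p₁ z * φ₁ z) * φ₂ z + conj (ψ₁ z) * (q₂ z * ψ₂ z) := by
  rw [dzbar_mul ((contDiff_conj_comp hψ₁).differentiable (by simp) z)
    (hφ₂.differentiable (by simp) z), dzbar_conj, (h₁ z trivial).1, (h₂ z trivial).2]
  ring

theorem dz_fst_mul_conj_snd (h₁ : IsDiracSolution Set.univ p₁ q₁ ψ₁ φ₁)
    (h₂ : IsDiracSolution Set.univ p₂ q₂ ψ₂ φ₂) (hψ₁ : ContDiff ℝ ∞ ψ₁) (hφ₂ : ContDiff ℝ ∞ φ₂)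
    (z : ℂ) : dz (fun w => ψ₁ w * conj (φ₂ w)) z =
      p₁ z * φ₁ z * conj (φ₂ z) + ψ₁ z * conj (q₂ z * ψ₂ z) := by
  rw [dz_mul (hψ₁.differentiable (by simp) z)
    ((contDiff_conj_comp hφ₂).differentiable (by simp) z), dz_conj, (h₁ z trivial).1,
    (h₂ z trivial).2]
  ring

theorem dzbar_neg (f : ℂ → ℂ) (z : ℂ) : dzbar (fun w => -f w) z = -dzbar f z := by
  simpa only [neg_one_mul] using dzbar_const_mul (-1) f z

theorem dz_neg (f : ℂ → ℂ) (z : ℂ) : dz (fun w => -f w) z = -dz f z := by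
  simpa only [neg_one_mul] using dz_const_mul (-1) f z

end Products

/-! ### Conservation of `∫ |p|²` and of the real integral `∫ pq`. -/

section Willmore

open MeasureTheory

variable {n : ℕ} {α γ : ℂ} {s : ℝ} {J : Set ℝ} {t : ℝ}

theorem integral_mul_conj {ε : ℝ} (f : ℂ → ℂ) :
    ∫ z, f z * (ε * conj (f z)) = ((ε * ∫ z, ‖f z‖ ^ 2 : ℝ) : ℂ) := by
  rw [← integral_const_mul, ← integral_complex_ofReal]
  refine integral_congr_ae (Filter.Eventually.of_forall fun z => ?_)
  change f z * (ε * conj (f z)) = ((ε * ‖f z‖ ^ 2 : ℝ) : ℂ)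
  push_cast
  rw [← Complex.mul_conj']
  ring

theorem Decays.integrable_norm_sq {f : ℂ → ℂ} (hs : 1 < s) (hf : Decays s f) :
    Integrable fun z => ‖f z‖ ^ 2 := by
  have h := (hf.decaysTo.integrable_mul hf.decaysTo (by linarith)).norm
  simpa only [← sq, norm_pow] using h

theorem hasDerivAt_integral_norm_sq {p : ℝ → ℂ → ℂ} {ε : ℝ} {M : ℝ → LaxCoeffs} (hε : ε ≠ 0)
    (hs : 1 < s) (hJ : IsOpen J) (hp : DecayingFamily s J p)
    (hM : IsDSIIFlow n α γ J p (fun t z => ε * conj (p t z)) M) (ht : t ∈ J) :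
    HasDerivAt (fun τ => ∫ z, ‖p τ z‖ ^ 2) 0 t := by
  have h := hM.hasDerivAt_integral hs hJ hp (hp.const_mul_conj ε) ht
  simp only [integral_mul_conj] at h
  have h1 := (Complex.reCLM.hasFDerivAt.comp_hasDerivAt t h).const_mul ε⁻¹
  have h2 : (fun τ => ε⁻¹ * (Complex.reCLM ∘ fun τ => ((ε * ∫ z, ‖p τ z‖ ^ 2 : ℝ) : ℂ)) τ) =
      fun τ => ∫ z, ‖p τ z‖ ^ 2 := by
    funext τ
    change ε⁻¹ * (ε * ∫ z, ‖p τ z‖ ^ 2) = _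
    rw [← mul_assoc, inv_mul_cancel₀ hε, one_mul]
  rw [h2] at h1
  simpa using h1

theorem hasDerivAt_integral_mul_real {p q : ℝ → ℂ → ℝ} {M : ℝ → LaxCoeffs} (hs : 1 < s)
    (hJ : IsOpen J) (hp : DecayingFamily s J fun t z => (p t z : ℂ))
    (hq : DecayingFamily s J fun t z => (q t z : ℂ))
    (hM : IsDSIIFlow n α γ J (fun t z => (p t z : ℂ)) (fun t z => (q t z : ℂ)) M) (ht : t ∈ J) :
    HasDerivAt (fun τ => ∫ z, p τ z * q τ z) 0 t := by
  have h := hM.hasDerivAt_integral hs hJ hp hq ht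
  simp only [← Complex.ofReal_mul, integral_complex_ofReal] at h
  simpa using! Complex.reCLM.hasFDerivAt.comp_hasDerivAt t h

end Willmore

/-! ### Surfaces in `R^4` and `R^{2,2}`. -/

section Reduced

variable {p ψ₁ φ₁ ψ₂ φ₂ : ℂ → ℂ} {X : ℂ → Fin 4 → ℝ}

theorem closed_R4 (h₁ : IsDiracSolution Set.univ p (fun z => ((-1 : ℝ) : ℂ) * conj (p z)) ψ₁ φ₁)
    (h₂ : IsDiracSolution Set.univ (fun z => conj (p z)) (fun z => ((-1 : ℝ) : ℂ) * p z) ψ₂ φ₂)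
    (hψ₁ : ContDiff ℝ ∞ ψ₁) (hφ₁ : ContDiff ℝ ∞ φ₁) (hψ₂ : ContDiff ℝ ∞ ψ₂)
    (hφ₂ : ContDiff ℝ ∞ φ₂) (z : ℂ) :
    dzbar (fun w => -(φ₁ w * φ₂ w)) z = dz (fun w => ψ₁ w * ψ₂ w) z ∧
      dzbar (fun w => conj (ψ₂ w) * φ₁ w) z = dz (fun w => ψ₁ w * conj (φ₂ w)) z := by
  rw [dzbar_neg, dzbar_snd_mul_snd h₁ h₂ hφ₁ hφ₂, dz_fst_mul_fst h₁ h₂ hψ₁ hψ₂,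
    dzbar_conj_fst_mul_snd h₂ h₁ hψ₂ hφ₁, dz_fst_mul_conj_snd h₁ h₂ hψ₁ hφ₂]
  simp only [map_mul, Complex.conj_conj, Complex.conj_ofReal]
  push_cast
  constructor <;> ring

/-- The two mixed derivatives are `p̄ψ₁φ₂ + pφ₁ψ₂` and `pφ₁φ̄₂ - p̄ψ₁ψ̄₂`. In the sum of their
squared moduli the cross terms are conjugate and cancel, which leaves `|p|²` times the conformal
factor. -/
theorem surface_R4 (h₁ : IsDiracSolution Set.univ p (fun z => ((-1 : ℝ) : ℂ) * conj (p z)) ψ₁ φ₁)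
    (h₂ : IsDiracSolution Set.univ (fun z => conj (p z)) (fun z => ((-1 : ℝ) : ℂ) * p z) ψ₂ φ₂)
    (hψ₁ : ContDiff ℝ ∞ ψ₁) (hφ₁ : ContDiff ℝ ∞ φ₁) (hψ₂ : ContDiff ℝ ∞ ψ₂)
    (hφ₂ : ContDiff ℝ ∞ φ₂)
    (hl : ∀ z, (‖ψ₁ z‖ ^ 2 + ‖φ₁ z‖ ^ 2) * (‖ψ₂ z‖ ^ 2 + ‖φ₂ z‖ ^ 2) ≠ 0)
    (hX : WeierstrassR4 ψ₁ φ₁ ψ₂ φ₂ X) :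
    IsConformalImmersion sigR4 X
        (fun z => (‖ψ₁ z‖ ^ 2 + ‖φ₁ z‖ ^ 2) * (‖ψ₂ z‖ ^ 2 + ‖φ₂ z‖ ^ 2)) ∧
      willmoreDensity sigR4 X = fun z => 4 * ‖p z‖ ^ 2 := by
  have hcl := closed_R4 h₁ h₂ hψ₁ hφ₁ hψ₂ hφ₂
  obtain ⟨hc, hw⟩ := pair_surface (e := 1) (k := fun z => ‖p z‖ ^ 2)
    (l := fun z => (‖ψ₁ z‖ ^ 2 + ‖φ₁ z‖ ^ 2) * (‖ψ₂ z‖ ^ 2 + ‖φ₂ z‖ ^ 2))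
    (hφ₁.mul hφ₂).neg (hψ₁.mul hψ₂) ((contDiff_conj_comp hψ₂).mul hφ₁)
    (hψ₁.mul (contDiff_conj_comp hφ₂)) hX.1 hX.2.2.1 (fun z => (hcl z).1) (fun z => (hcl z).2)
    (fun z => by
      simp only [map_mul, Complex.conj_conj]
      push_cast
      ring)
    (fun z => by
      simp only [norm_mul, norm_neg, RCLike.norm_conj]
      ring)
    hl (fun z => by
      rw [dzbar_neg, dzbar_snd_mul_snd h₁ h₂ hφ₁ hφ₂, dzbar_conj_fst_mul_snd h₂ h₁ hψ₂ hφ₁]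
      apply Complex.ofReal_injective
      push_cast
      simp only [← Complex.mul_conj', map_add, map_mul, map_neg, map_one, Complex.conj_conj]
      ring)
  refine ⟨hc, hw.trans (funext fun z => ?_)⟩
  have hpos : 0 < (‖ψ₁ z‖ ^ 2 + ‖φ₁ z‖ ^ 2) * (‖ψ₂ z‖ ^ 2 + ‖φ₂ z‖ ^ 2) :=
    lt_of_le_of_ne (by positivity) (hl z).symm
  simp [sign_pos hpos]

theorem closed_R22 (h₁ : IsDiracSolution Set.univ p (fun z => ((1 : ℝ) : ℂ) * conj (p z)) ψ₁ φ₁)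
    (h₂ : IsDiracSolution Set.univ (fun z => conj (p z)) (fun z => ((1 : ℝ) : ℂ) * p z) ψ₂ φ₂)
    (hψ₁ : ContDiff ℝ ∞ ψ₁) (hφ₁ : ContDiff ℝ ∞ φ₁) (hψ₂ : ContDiff ℝ ∞ ψ₂)
    (hφ₂ : ContDiff ℝ ∞ φ₂) (z : ℂ) :
    dzbar (fun w => φ₁ w * φ₂ w) z = dz (fun w => ψ₁ w * ψ₂ w) z ∧
      dzbar (fun w => Complex.I * (conj (ψ₁ w) * φ₂ w)) z =
        dz (fun w => Complex.I * (ψ₂ w * conj (φ₁ w))) z := by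
  rw [dzbar_const_mul, dz_const_mul, dzbar_snd_mul_snd h₁ h₂ hφ₁ hφ₂,
    dz_fst_mul_fst h₁ h₂ hψ₁ hψ₂, dzbar_conj_fst_mul_snd h₁ h₂ hψ₁ hφ₂,
    dz_fst_mul_conj_snd h₂ h₁ hψ₂ hφ₁]
  simp only [map_mul, Complex.conj_conj, Complex.conj_ofReal]
  push_cast
  constructor <;> ring

theorem sign_eq_of_continuous {l : ℂ → ℝ} (hl : Continuous l) (h0 : ∀ z, l z ≠ 0) (z w : ℂ) :
    SignType.sign (l z) = SignType.sign (l w) :=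
  PreconnectedSpace.constant inferInstance <| continuous_iff_continuousAt.2 fun z =>
    (continuousAt_sign_of_ne_zero (h0 z)).comp hl.continuousAt

/-- The same cancellation of cross terms occurs in the difference of squared moduli and gives `-|p|²
l`. As `l` is continuous and has no zeros on the connected plane, its sign may be evaluated at `0`.
-/
theorem surface_R22 (h₁ : IsDiracSolution Set.univ p (fun z => ((1 : ℝ) : ℂ) * conj (p z)) ψ₁ φ₁)
    (h₂ : IsDiracSolution Set.univ (fun z => conj (p z)) (fun z => ((1 : ℝ) : ℂ) * p z) ψ₂ φ₂)
    (hψ₁ : ContDiff ℝ ∞ ψ₁) (hφ₁ : ContDiff ℝ ∞ φ₁) (hψ₂ : ContDiff ℝ ∞ ψ₂)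
    (hφ₂ : ContDiff ℝ ∞ φ₂)
    (hl : ∀ z, (‖ψ₁ z‖ ^ 2 - ‖φ₁ z‖ ^ 2) * (‖ψ₂ z‖ ^ 2 - ‖φ₂ z‖ ^ 2) ≠ 0)
    (hX : WeierstrassR22 ψ₁ φ₁ ψ₂ φ₂ X) :
    IsConformalImmersion sigR22 X
        (fun z => (‖ψ₁ z‖ ^ 2 - ‖φ₁ z‖ ^ 2) * (‖ψ₂ z‖ ^ 2 - ‖φ₂ z‖ ^ 2)) ∧
      willmoreDensity sigR22 X = fun z => -4 *
        (SignType.sign ((‖ψ₁ 0‖ ^ 2 - ‖φ₁ 0‖ ^ 2) * (‖ψ₂ 0‖ ^ 2 - ‖φ₂ 0‖ ^ 2)) : ℝ) *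
          ‖p z‖ ^ 2 := by
  have hcl := closed_R22 h₁ h₂ hψ₁ hφ₁ hψ₂ hφ₂
  obtain ⟨hc, hw⟩ := pair_surface (e := -1) (k := fun z => -‖p z‖ ^ 2)
    (l := fun z => (‖ψ₁ z‖ ^ 2 - ‖φ₁ z‖ ^ 2) * (‖ψ₂ z‖ ^ 2 - ‖φ₂ z‖ ^ 2))
    (hφ₁.mul hφ₂) (hψ₁.mul hψ₂) (contDiff_const.mul ((contDiff_conj_comp hψ₁).mul hφ₂))
    (contDiff_const.mul (hψ₂.mul (contDiff_conj_comp hφ₁))) hX.1 hX.2.2.1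
    (fun z => (hcl z).1) (fun z => (hcl z).2)
    (fun z => by
      simp only [map_mul, Complex.conj_conj, Complex.conj_I]
      push_cast
      linear_combination (φ₁ z * φ₂ z * conj (ψ₁ z) * conj (ψ₂ z)) * Complex.I_sq)
    (fun z => by
      simp only [norm_mul, RCLike.norm_conj, Complex.norm_I]
      ring)
    hl (fun z => by
      rw [dzbar_const_mul, dzbar_snd_mul_snd h₁ h₂ hφ₁ hφ₂,
        dzbar_conj_fst_mul_snd h₁ h₂ hψ₁ hφ₂, norm_mul, Complex.norm_I, one_mul]
      apply Complex.ofReal_injective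
      push_cast
      simp only [← Complex.mul_conj', map_add, map_mul, map_one, Complex.conj_conj]
      ring)
  refine ⟨hc, hw.trans (funext fun z => ?_)⟩
  have hcont : Continuous fun z =>
      (‖ψ₁ z‖ ^ 2 - ‖φ₁ z‖ ^ 2) * (‖ψ₂ z‖ ^ 2 - ‖φ₂ z‖ ^ 2) :=
    ((hψ₁.continuous.norm.pow 2).sub (hφ₁.continuous.norm.pow 2)).mul
      ((hψ₂.continuous.norm.pow 2).sub (hφ₂.continuous.norm.pow 2))
  have h := sign_eq_of_continuous hcont hl z 0
  rw [h]
  ring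

end Reduced

/-! ### Surfaces in `R^{3,1}`. -/

section Real

variable {p q : ℂ → ℝ} {ψ₁ φ₁ ψ₂ φ₂ : ℂ → ℂ} {X : ℂ → Fin 4 → ℝ}

theorem closed_R31 (h₁ : IsDiracSolution Set.univ (fun z => (p z : ℂ)) (fun z => (q z : ℂ)) ψ₁ φ₁)
    (h₂ : IsDiracSolution Set.univ (fun z => (p z : ℂ)) (fun z => (q z : ℂ)) ψ₂ φ₂)
    (hφ₁ : ContDiff ℝ ∞ φ₁) (hψ₂ : ContDiff ℝ ∞ ψ₂) (hψ₁ : ContDiff ℝ ∞ ψ₁)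
    (hφ₂ : ContDiff ℝ ∞ φ₂) (z : ℂ) :
    dzbar (fun w => conj (ψ₂ w) * φ₁ w) z = dz (fun w => ψ₁ w * conj (φ₂ w)) z := by
  rw [dzbar_conj_fst_mul_snd h₂ h₁ hψ₂ hφ₁, dz_fst_mul_conj_snd h₁ h₂ hψ₁ hφ₂]
  simp only [map_mul, Complex.conj_ofReal]
  ring

theorem surface_R31
    (h₁ : IsDiracSolution Set.univ (fun z => (p z : ℂ)) (fun z => (q z : ℂ)) ψ₁ φ₁)
    (h₂ : IsDiracSolution Set.univ (fun z => (p z : ℂ)) (fun z => (q z : ℂ)) ψ₂ φ₂)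
    (hψ₁ : ContDiff ℝ ∞ ψ₁) (hφ₁ : ContDiff ℝ ∞ φ₁) (hψ₂ : ContDiff ℝ ∞ ψ₂)
    (hφ₂ : ContDiff ℝ ∞ φ₂) (hl : ∀ z, ‖ψ₁ z * φ₂ z - ψ₂ z * φ₁ z‖ ^ 2 ≠ 0)
    (hX : WeierstrassR31 ψ₁ φ₁ ψ₂ φ₂ X) :
    IsConformalImmersion sigR31 X (fun z => ‖ψ₁ z * φ₂ z - ψ₂ z * φ₁ z‖ ^ 2) ∧
      willmoreDensity sigR31 X = fun z => -4 * (p z * q z) := by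
  have hconjR : (fun z => ψ₁ z * conj (φ₁ z)) = fun z => conj (conj (ψ₁ z) * φ₁ z) := by
    simp only [map_mul, Complex.conj_conj]
  have hconjS : (fun z => -(ψ₂ z * conj (φ₂ z))) = fun z => conj (-(conj (ψ₂ z) * φ₂ z)) := by
    simp only [map_neg, map_mul, Complex.conj_conj]
  have hR := hX.2.2.1
  have hS := hX.2.2.2
  rw [hconjR] at hR
  rw [hconjS] at hS
  obtain ⟨hc, hw⟩ := triple_surface (k := fun z => -(p z * q z))
    (l := fun z => ‖ψ₁ z * φ₂ z - ψ₂ z * φ₁ z‖ ^ 2)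
    ((contDiff_conj_comp hψ₂).mul hφ₁) (hψ₁.mul (contDiff_conj_comp hφ₂))
    ((contDiff_conj_comp hψ₁).mul hφ₁) ((contDiff_conj_comp hψ₂).mul hφ₂).neg hX.1 hR hS
    (closed_R31 h₁ h₂ hφ₁ hψ₂ hψ₁ hφ₂)
    (fun z => by
      simp only [map_mul, Complex.conj_conj]
      ring)
    (fun z => by
      apply Complex.ofReal_injective
      push_cast
      rw [Complex.re_eq_add_conj]
      simp only [← Complex.mul_conj', map_sub, map_mul, map_neg, Complex.conj_conj]
      ring)
    hl (fun z => by
      rw [dzbar_neg, dzbar_conj_fst_mul_snd h₂ h₁ hψ₂ hφ₁, dzbar_conj_fst_mul_snd h₁ h₁ hψ₁ hφ₁,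
        dzbar_conj_fst_mul_snd h₂ h₂ hψ₂ hφ₂]
      apply Complex.ofReal_injective
      push_cast
      rw [Complex.re_eq_add_conj, Complex.re_eq_add_conj]
      simp only [← Complex.mul_conj', map_add, map_sub, map_mul, map_neg, Complex.conj_conj,
        Complex.conj_ofReal]
      ring)
  refine ⟨hc, hw.trans (funext fun z => ?_)⟩
  have hpos : 0 < ‖ψ₁ z * φ₂ z - ψ₂ z * φ₁ z‖ ^ 2 :=
    lt_of_le_of_ne (by positivity) (hl z).symm
  rw [sign_pos hpos]
  simp

end Real

/-! ### Conservation of the Willmore functional along the deformations. -/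

section Deformations

open MeasureTheory

variable {n : ℕ} {α γ : ℂ} {s : ℝ} {J : Set ℝ} {ψ₁ φ₁ ψ₂ φ₂ : ℝ → ℂ → ℂ}

theorem willmore_eq {η : Fin 4 → ℝ} {X : ℂ → Fin 4 → ℝ} {c : ℝ} {f : ℂ → ℝ}
    (h : willmoreDensity η X = fun z => c * f z) (hf : Integrable f) :
    Integrable (willmoreDensity η X) ∧ willmore η X = c * ∫ z, f z := by
  rw [willmore, h]
  exact ⟨hf.const_mul c, integral_const_mul c f⟩

theorem hasDerivAt_willmore {η : Fin 4 → ℝ} {X : ℝ → ℂ → Fin 4 → ℝ} {W : ℝ → ℝ} {c t : ℝ}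
    (h : ∀ᶠ τ in 𝓝 t, willmore η (X τ) = c * W τ) (hW : HasDerivAt W 0 t) :
    HasDerivAt (fun τ => willmore η (X τ)) 0 t := by
  have h1 := (hW.const_mul c).congr_of_eventuallyEq h
  rwa [mul_zero] at h1

/-- The formulae determine `X` up to translations depending arbitrarily on `t`. Since `W` is
expressed through `p` alone, its derivative exists for every such choice. -/
theorem deformation_R4 {p : ℝ → ℂ → ℂ} {M₁ M₂ : ℝ → LaxCoeffs} (hs : 1 < s) (hJ : IsOpen J)
    (hp : DecayingFamily s J p) (h : IsReducedDeformation n α (-1) J p M₁ M₂ ψ₁ φ₁ ψ₂ φ₂)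
    (hl : ∀ t ∈ J, ∀ z, (‖ψ₁ t z‖ ^ 2 + ‖φ₁ t z‖ ^ 2) * (‖ψ₂ t z‖ ^ 2 + ‖φ₂ t z‖ ^ 2) ≠ 0) :
    (∃ X : ℝ → ℂ → Fin 4 → ℝ, SmoothSurfaceFamily J X ∧
      ∀ t ∈ J, WeierstrassR4 (ψ₁ t) (φ₁ t) (ψ₂ t) (φ₂ t) (X t)) ∧
    ∀ X : ℝ → ℂ → Fin 4 → ℝ,
      (∀ t ∈ J, WeierstrassR4 (ψ₁ t) (φ₁ t) (ψ₂ t) (φ₂ t) (X t)) → ∀ t ∈ J,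
        IsConformalImmersion sigR4 (X t)
          (fun z => (‖ψ₁ t z‖ ^ 2 + ‖φ₁ t z‖ ^ 2) * (‖ψ₂ t z‖ ^ 2 + ‖φ₂ t z‖ ^ 2)) ∧
        Integrable (willmoreDensity sigR4 (X t)) ∧
        willmore sigR4 (X t) = 4 * ∫ z, ‖p t z‖ ^ 2 ∧
        HasDerivAt (fun τ => willmore sigR4 (X τ)) 0 t := by
  obtain ⟨hflow, -, ⟨hψ₁, hφ₁, h₁, -⟩, ⟨hψ₂, hφ₂, h₂, -⟩⟩ := h
  have hcl := fun t (ht : t ∈ J) => closed_R4 (h₁ t ht) (h₂ t ht) (hψ₁.contDiff ht)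
    (hφ₁.contDiff ht) (hψ₂.contDiff ht) (hφ₂.contDiff ht)
  refine ⟨?_, fun X hX => ?_⟩
  · obtain ⟨X, hXs, hX⟩ := exists_surface_pair hJ (hφ₁.mul hφ₂).neg (hψ₁.mul hψ₂)
      (hψ₂.conj.mul hφ₁) (hψ₁.mul hφ₂.conj) (fun t ht z => (hcl t ht z).1)
      (fun t ht z => (hcl t ht z).2)
    refine ⟨X, hXs, fun t ht => ?_⟩
    have := hX t ht
    simp only [map_mul, map_neg, Complex.conj_conj] at this
    exact this
  · have hS := fun t (ht : t ∈ J) => surface_R4 (h₁ t ht) (h₂ t ht) (hψ₁.contDiff ht)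
      (hφ₁.contDiff ht) (hψ₂.contDiff ht) (hφ₂.contDiff ht) (hl t ht) (hX t ht)
    have hW := fun t (ht : t ∈ J) =>
      willmore_eq (hS t ht).2 ((hp.decays ht).integrable_norm_sq hs)
    refine fun t ht => ⟨(hS t ht).1, (hW t ht).1, (hW t ht).2, ?_⟩
    exact hasDerivAt_willmore (Filter.mem_of_superset (hJ.mem_nhds ht) fun τ hτ => (hW τ hτ).2)
      (hasDerivAt_integral_norm_sq (by norm_num) hs hJ hp hflow ht)

theorem deformation_R22 {p : ℝ → ℂ → ℂ} {M₁ M₂ : ℝ → LaxCoeffs} (hs : 1 < s) (hJ : IsOpen J)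
    (hp : DecayingFamily s J p) (h : IsReducedDeformation n α 1 J p M₁ M₂ ψ₁ φ₁ ψ₂ φ₂)
    (hl : ∀ t ∈ J, ∀ z, (‖ψ₁ t z‖ ^ 2 - ‖φ₁ t z‖ ^ 2) * (‖ψ₂ t z‖ ^ 2 - ‖φ₂ t z‖ ^ 2) ≠ 0) :
    (∃ X : ℝ → ℂ → Fin 4 → ℝ, SmoothSurfaceFamily J X ∧
      ∀ t ∈ J, WeierstrassR22 (ψ₁ t) (φ₁ t) (ψ₂ t) (φ₂ t) (X t)) ∧
    ∀ X : ℝ → ℂ → Fin 4 → ℝ,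
      (∀ t ∈ J, WeierstrassR22 (ψ₁ t) (φ₁ t) (ψ₂ t) (φ₂ t) (X t)) → ∀ t ∈ J,
        IsConformalImmersion sigR22 (X t)
          (fun z => (‖ψ₁ t z‖ ^ 2 - ‖φ₁ t z‖ ^ 2) * (‖ψ₂ t z‖ ^ 2 - ‖φ₂ t z‖ ^ 2)) ∧
        Integrable (willmoreDensity sigR22 (X t)) ∧
        willmore sigR22 (X t) =
          -4 * (SignType.sign ((‖ψ₁ t 0‖ ^ 2 - ‖φ₁ t 0‖ ^ 2) *
            (‖ψ₂ t 0‖ ^ 2 - ‖φ₂ t 0‖ ^ 2)) : ℝ) * ∫ z, ‖p t z‖ ^ 2 ∧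
        HasDerivAt (fun τ => willmore sigR22 (X τ)) 0 t := by
  obtain ⟨hflow, -, ⟨hψ₁, hφ₁, h₁, -⟩, ⟨hψ₂, hφ₂, h₂, -⟩⟩ := h
  have hcl := fun t (ht : t ∈ J) => closed_R22 (h₁ t ht) (h₂ t ht) (hψ₁.contDiff ht)
    (hφ₁.contDiff ht) (hψ₂.contDiff ht) (hφ₂.contDiff ht)
  refine ⟨?_, fun X hX => ?_⟩
  · obtain ⟨X, hXs, hX⟩ := exists_surface_pair hJ (hφ₁.mul hφ₂) (hψ₁.mul hψ₂)
      ((hψ₁.conj.mul hφ₂).const_mul Complex.I) ((hψ₂.mul hφ₁.conj).const_mul Complex.I)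
      (fun t ht z => (hcl t ht z).1) (fun t ht z => (hcl t ht z).2)
    refine ⟨X, hXs, fun t ht => ?_⟩
    have := hX t ht
    simp only [map_mul, Complex.conj_conj, Complex.conj_I, neg_mul] at this
    refine ⟨this.1, this.2.1, this.2.2.1, ?_⟩
    convert this.2.2.2 using 4
  · have hS := fun t (ht : t ∈ J) => surface_R22 (h₁ t ht) (h₂ t ht) (hψ₁.contDiff ht)
      (hφ₁.contDiff ht) (hψ₂.contDiff ht) (hφ₂.contDiff ht) (hl t ht) (hX t ht)
    have hW := fun t (ht : t ∈ J) =>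
      willmore_eq (hS t ht).2 ((hp.decays ht).integrable_norm_sq hs)
    refine fun t ht => ⟨(hS t ht).1, (hW t ht).1, (hW t ht).2, ?_⟩
    have hc : ∀ {f : ℝ → ℂ → ℂ}, SmoothFamily J f → ContinuousAt (fun τ => f τ 0) t := fun hf =>
      (hf.hasDerivAt hJ ht 0).continuousAt
    -- The factor in front of `∫ |p|²` involves the sign of `l` at `z = 0`, which depends on `t` but
    -- is locally constant because `l` has no zeros.
    have hsign : ∀ᶠ τ in 𝓝 t, SignType.sign ((‖ψ₁ τ 0‖ ^ 2 - ‖φ₁ τ 0‖ ^ 2) *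
        (‖ψ₂ τ 0‖ ^ 2 - ‖φ₂ τ 0‖ ^ 2)) = SignType.sign ((‖ψ₁ t 0‖ ^ 2 - ‖φ₁ t 0‖ ^ 2) *
        (‖ψ₂ t 0‖ ^ 2 - ‖φ₂ t 0‖ ^ 2)) := by
      have h1 : ContinuousAt (fun τ => (‖ψ₁ τ 0‖ ^ 2 - ‖φ₁ τ 0‖ ^ 2) *
          (‖ψ₂ τ 0‖ ^ 2 - ‖φ₂ τ 0‖ ^ 2)) t :=
        (((hc hψ₁).norm.pow 2).sub ((hc hφ₁).norm.pow 2)).mul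
          (((hc hψ₂).norm.pow 2).sub ((hc hφ₂).norm.pow 2))
      have h2 : ContinuousAt (fun τ => SignType.sign ((‖ψ₁ τ 0‖ ^ 2 - ‖φ₁ τ 0‖ ^ 2) *
          (‖ψ₂ τ 0‖ ^ 2 - ‖φ₂ τ 0‖ ^ 2))) t :=
        (continuousAt_sign_of_ne_zero (hl t ht 0)).tendsto.comp h1.tendsto
      exact h2.eventually (isOpen_discrete {_}|>.mem_nhds rfl)
    refine hasDerivAt_willmore (c := -4 * (SignType.sign ((‖ψ₁ t 0‖ ^ 2 - ‖φ₁ t 0‖ ^ 2) *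
      (‖ψ₂ t 0‖ ^ 2 - ‖φ₂ t 0‖ ^ 2)) : ℝ)) ?_
      (hasDerivAt_integral_norm_sq (by norm_num) hs hJ hp hflow ht)
    filter_upwards [hJ.mem_nhds ht, hsign] with τ hτ hτ'
    rw [(hW τ hτ).2, hτ']

theorem deformation_R31 {p q : ℝ → ℂ → ℝ} {M : ℝ → LaxCoeffs} (hs : 1 < s) (hJ : IsOpen J)
    (hp : DecayingFamily s J fun t z => (p t z : ℂ))
    (hq : DecayingFamily s J fun t z => (q t z : ℂ))
    (h : IsRealDeformation n α γ J p q M ψ₁ φ₁ ψ₂ φ₂)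
    (hl : ∀ t ∈ J, ∀ z, ‖ψ₁ t z * φ₂ t z - ψ₂ t z * φ₁ t z‖ ^ 2 ≠ 0) :
    (∃ X : ℝ → ℂ → Fin 4 → ℝ, SmoothSurfaceFamily J X ∧
      ∀ t ∈ J, WeierstrassR31 (ψ₁ t) (φ₁ t) (ψ₂ t) (φ₂ t) (X t)) ∧
    ∀ X : ℝ → ℂ → Fin 4 → ℝ,
      (∀ t ∈ J, WeierstrassR31 (ψ₁ t) (φ₁ t) (ψ₂ t) (φ₂ t) (X t)) → ∀ t ∈ J,
        IsConformalImmersion sigR31 (X t)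
          (fun z => ‖ψ₁ t z * φ₂ t z - ψ₂ t z * φ₁ t z‖ ^ 2) ∧
        Integrable (willmoreDensity sigR31 (X t)) ∧
        willmore sigR31 (X t) = -4 * ∫ z, p t z * q t z ∧
        HasDerivAt (fun τ => willmore sigR31 (X τ)) 0 t := by
  obtain ⟨hflow, ⟨hψ₁, hφ₁, h₁, -⟩, ⟨hψ₂, hφ₂, h₂, -⟩⟩ := h
  refine ⟨?_, fun X hX => ?_⟩
  · have hcl := fun t (ht : t ∈ J) => closed_R31 (h₁ t ht) (h₂ t ht) (hφ₁.contDiff ht)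
      (hψ₂.contDiff ht) (hψ₁.contDiff ht) (hφ₂.contDiff ht)
    have hcl₁ := fun t (ht : t ∈ J) => closed_R31 (h₁ t ht) (h₁ t ht) (hφ₁.contDiff ht)
      (hψ₁.contDiff ht) (hψ₁.contDiff ht) (hφ₁.contDiff ht)
    have hcl₂ := fun t (ht : t ∈ J) => closed_R31 (h₂ t ht) (h₂ t ht) (hφ₂.contDiff ht)
      (hψ₂.contDiff ht) (hψ₂.contDiff ht) (hφ₂.contDiff ht)
    obtain ⟨X, hXs, hX⟩ := exists_surface_triple hJ (hψ₂.conj.mul hφ₁) (hψ₁.mul hφ₂.conj)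
      (hψ₁.conj.mul hφ₁) (hψ₂.conj.mul hφ₂).neg hcl
      (fun t ht z => by simpa only [map_mul, Complex.conj_conj] using hcl₁ t ht z)
      (fun t ht z => by
        simp only [map_mul, map_neg, Complex.conj_conj]
        rw [dzbar_neg, dz_neg, hcl₂ t ht])
    refine ⟨X, hXs, fun t ht => ?_⟩
    have := hX t ht
    simp only [map_mul, map_neg, Complex.conj_conj] at this
    exact this
  · have hint : ∀ t ∈ J, Integrable fun z => p t z * q t z := fun t ht => by
      have h3 := ((hp.decays ht).decaysTo.integrable_mul (hq.decays ht).decaysTo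
        (by linarith)).re
      simpa using h3
    have hS := fun t (ht : t ∈ J) => surface_R31 (h₁ t ht) (h₂ t ht) (hψ₁.contDiff ht)
      (hφ₁.contDiff ht) (hψ₂.contDiff ht) (hφ₂.contDiff ht) (hl t ht) (hX t ht)
    have hW := fun t (ht : t ∈ J) => willmore_eq (hS t ht).2 (hint t ht)
    refine fun t ht => ⟨(hS t ht).1, (hW t ht).1, (hW t ht).2, ?_⟩
    exact hasDerivAt_willmore (Filter.mem_of_superset (hJ.mem_nhds ht) fun τ hτ => (hW τ hτ).2)
      (hasDerivAt_integral_mul_real hs hJ hp hq hflow ht)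

end Deformations

end DSII

end

open DSII in
theorem proposition4 (n : ℕ) (hn : 1 ≤ n) :
    -- the `n`-th equation of the hierarchy is a well-defined evolution equation
    (∀ (α γ : ℂ) (s : ℝ) (p q : ℂ → ℂ), 1 < s → Decays s p → Decays s q →
      ∃! V : (ℂ → ℂ) × (ℂ → ℂ), IsDSIIVelocity n α γ p q V.1 V.2) ∧
    -- compatibility with the linear problem: equality of the mixed derivatives on its solutions
    (∀ (α γ : ℂ) (p q P Q : ℂ → ℂ) (M : LaxCoeffs), IsDSIIOperators n α γ p q P Q M →
      ∀ (U : Set ℂ) (ψ φ : ℂ → ℂ), IsOpen U → ContDiffOn ℝ ∞ ψ U → ContDiffOn ℝ ∞ φ U →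
        IsDiracSolution U p q ψ φ → ∀ z ∈ U,
          dz (M.fst n ψ φ) z = P z * φ z + p z * M.snd n ψ φ z ∧
          dzbar (M.snd n ψ φ) z = Q z * ψ z + q z * M.fst n ψ φ z) ∧
    -- `∫ p q dx dy` is an integral of motion
    (∀ (α γ : ℂ) (s : ℝ) (J : Set ℝ) (p q : ℝ → ℂ → ℂ) (M : ℝ → LaxCoeffs), 1 < s → IsOpen J →
      DecayingFamily s J p → DecayingFamily s J q → IsDSIIFlow n α γ J p q M →
      ∀ t ∈ J, MeasureTheory.Integrable (fun z => p t z * q t z) ∧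
        HasDerivAt (fun τ => ∫ z, p τ z * q τ z) 0 t) ∧
    -- the reductions `q = ε p̄` are admissible, with the same equation for `p` for both columns
    (∀ (α : ℂ) (ε : ℝ) (s : ℝ) (p P Q : ℂ → ℂ), (ε = 1 ∨ ε = -1) → 1 < s → Decays s p →
      IsDSIIVelocity n α (conj α) p (fun z => ε * conj (p z)) P Q →
        (∀ z, Q z = ε * conj (P z)) ∧
        IsDSIIVelocity n ((-1) ^ (n + 1) * α) ((-1) ^ (n + 1) * conj α)
          (fun z => conj (p z)) (fun z => ε * p z)
          (fun z => conj (P z)) (fun z => ε * P z)) ∧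
    -- the real reduction is admissible
    (∀ (α : ℂ) (s : ℝ) (p q : ℂ → ℝ) (P Q : ℂ → ℂ), 1 < s →
      Decays s (fun z => (p z : ℂ)) → Decays s (fun z => (q z : ℂ)) →
      IsDSIIVelocity n α ((-1) ^ (n + 1) * conj α) (fun z => (p z : ℂ)) (fun z => (q z : ℂ)) P Q →
        ∀ z, (P z).im = 0 ∧ (Q z).im = 0) ∧
    -- deformations of surfaces in `R^4`
    (∀ (α : ℂ) (s : ℝ) (J : Set ℝ) (p : ℝ → ℂ → ℂ) (M₁ M₂ : ℝ → LaxCoeffs)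
      (ψ₁ φ₁ ψ₂ φ₂ : ℝ → ℂ → ℂ), 1 < s → IsOpen J → DecayingFamily s J p →
      IsReducedDeformation n α (-1) J p M₁ M₂ ψ₁ φ₁ ψ₂ φ₂ →
      (∀ t ∈ J, ∀ z, (‖ψ₁ t z‖ ^ 2 + ‖φ₁ t z‖ ^ 2) * (‖ψ₂ t z‖ ^ 2 + ‖φ₂ t z‖ ^ 2) ≠ 0) →
      (∃ X : ℝ → ℂ → Fin 4 → ℝ, SmoothSurfaceFamily J X ∧
        ∀ t ∈ J, WeierstrassR4 (ψ₁ t) (φ₁ t) (ψ₂ t) (φ₂ t) (X t)) ∧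
      ∀ X : ℝ → ℂ → Fin 4 → ℝ,
        (∀ t ∈ J, WeierstrassR4 (ψ₁ t) (φ₁ t) (ψ₂ t) (φ₂ t) (X t)) → ∀ t ∈ J,
          IsConformalImmersion sigR4 (X t)
            (fun z => (‖ψ₁ t z‖ ^ 2 + ‖φ₁ t z‖ ^ 2) * (‖ψ₂ t z‖ ^ 2 + ‖φ₂ t z‖ ^ 2)) ∧
          MeasureTheory.Integrable (willmoreDensity sigR4 (X t)) ∧
          willmore sigR4 (X t) = 4 * ∫ z, ‖p t z‖ ^ 2 ∧
          HasDerivAt (fun τ => willmore sigR4 (X τ)) 0 t) ∧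
    -- deformations of surfaces in `R^{2,2}`
    (∀ (α : ℂ) (s : ℝ) (J : Set ℝ) (p : ℝ → ℂ → ℂ) (M₁ M₂ : ℝ → LaxCoeffs)
      (ψ₁ φ₁ ψ₂ φ₂ : ℝ → ℂ → ℂ), 1 < s → IsOpen J → DecayingFamily s J p →
      IsReducedDeformation n α 1 J p M₁ M₂ ψ₁ φ₁ ψ₂ φ₂ →
      (∀ t ∈ J, ∀ z, (‖ψ₁ t z‖ ^ 2 - ‖φ₁ t z‖ ^ 2) * (‖ψ₂ t z‖ ^ 2 - ‖φ₂ t z‖ ^ 2) ≠ 0) →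
      (∃ X : ℝ → ℂ → Fin 4 → ℝ, SmoothSurfaceFamily J X ∧
        ∀ t ∈ J, WeierstrassR22 (ψ₁ t) (φ₁ t) (ψ₂ t) (φ₂ t) (X t)) ∧
      ∀ X : ℝ → ℂ → Fin 4 → ℝ,
        (∀ t ∈ J, WeierstrassR22 (ψ₁ t) (φ₁ t) (ψ₂ t) (φ₂ t) (X t)) → ∀ t ∈ J,
          IsConformalImmersion sigR22 (X t)
            (fun z => (‖ψ₁ t z‖ ^ 2 - ‖φ₁ t z‖ ^ 2) * (‖ψ₂ t z‖ ^ 2 - ‖φ₂ t z‖ ^ 2)) ∧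
          MeasureTheory.Integrable (willmoreDensity sigR22 (X t)) ∧
          willmore sigR22 (X t) =
            -4 * (SignType.sign ((‖ψ₁ t 0‖ ^ 2 - ‖φ₁ t 0‖ ^ 2) *
              (‖ψ₂ t 0‖ ^ 2 - ‖φ₂ t 0‖ ^ 2)) : ℝ) * ∫ z, ‖p t z‖ ^ 2 ∧
          HasDerivAt (fun τ => willmore sigR22 (X τ)) 0 t) ∧
    -- deformations of surfaces in `R^{3,1}`
    (∀ (α γ : ℂ) (s : ℝ) (J : Set ℝ) (p q : ℝ → ℂ → ℝ) (M : ℝ → LaxCoeffs)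
      (ψ₁ φ₁ ψ₂ φ₂ : ℝ → ℂ → ℂ), 1 < s → IsOpen J →
      DecayingFamily s J (fun t z => (p t z : ℂ)) → DecayingFamily s J (fun t z => (q t z : ℂ)) →
      IsRealDeformation n α γ J p q M ψ₁ φ₁ ψ₂ φ₂ →
      (∀ t ∈ J, ∀ z, ‖ψ₁ t z * φ₂ t z - ψ₂ t z * φ₁ t z‖ ^ 2 ≠ 0) →
      (∃ X : ℝ → ℂ → Fin 4 → ℝ, SmoothSurfaceFamily J X ∧
        ∀ t ∈ J, WeierstrassR31 (ψ₁ t) (φ₁ t) (ψ₂ t) (φ₂ t) (X t)) ∧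
      ∀ X : ℝ → ℂ → Fin 4 → ℝ,
        (∀ t ∈ J, WeierstrassR31 (ψ₁ t) (φ₁ t) (ψ₂ t) (φ₂ t) (X t)) → ∀ t ∈ J,
          IsConformalImmersion sigR31 (X t)
            (fun z => ‖ψ₁ t z * φ₂ t z - ψ₂ t z * φ₁ t z‖ ^ 2) ∧
          MeasureTheory.Integrable (willmoreDensity sigR31 (X t)) ∧
          willmore sigR31 (X t) = -4 * ∫ z, p t z * q t z ∧
          HasDerivAt (fun τ => willmore sigR31 (X τ)) 0 t) := by
  refine ⟨fun α γ s p q hs hp hq => ?_, fun α γ p q P Q M hM U ψ φ hU hψ hφ h z hz =>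
    hM.mixed_derivatives hU hψ hφ h hz, fun α γ s J p q M hs hJ hp hq hM t ht =>
    ⟨(hp.decays ht).decaysTo.integrable_mul (hq.decays ht).decaysTo (by linarith),
      hM.hasDerivAt_integral hs hJ hp hq ht⟩,
    fun α ε s p P Q hε hs hp h => conj_reduction hε hp.1 h,
    fun α s p q P Q hs hp hq h z => real_reduction hp.1 hq.1 h z,
    fun α s J p M₁ M₂ ψ₁ φ₁ ψ₂ φ₂ hs hJ hp h hl => deformation_R4 hs hJ hp h hl,
    fun α s J p M₁ M₂ ψ₁ φ₁ ψ₂ φ₂ hs hJ hp h hl => deformation_R22 hs hJ hp h hl,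
    fun α γ s J p q M ψ₁ φ₁ ψ₂ φ₂ hs hJ hp hq h hl => deformation_R31 hs hJ hp hq h hl⟩
  obtain ⟨P, Q, h⟩ := exists_velocity hs n α γ (p := ⟨p, hp.1⟩) (q := ⟨q, hq.1⟩) hp hq
  exact ⟨(P, Q), h, fun V hV => Prod.ext_iff.2 (hV.unique hp.1 hq.1 h)⟩
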